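/- Let $M$ be an oriented smooth $N$-dimensional Riemannian manifold (Hausdorff, $\sigma$-compact) and $S\subset M$ an open set with compact closure. Let $\Gamma_1,\Gamma_2$ be disjoint relatively open subsets of $\partial S$ which have the same boundary $\gamma$ in $\partial S$ and satisfy $\partial S=\Gamma_1\cup\Gamma_2\cup\gamma$ (disjoint union). Let $L_2^q(S)$ be the space of square-integrable complex-valued $q$-forms on $S$, with inner product $\langle E,H\rangle_{q,S}=\int_S E\wedge *\overline{H}$ and norm $\|\cdot\|_{q,S}$ (it is $\{0\}$ for $q=-1$). On smooth forms let $\operatorname{rot}=\mathrm d$ be the exterior derivative and $\operatorname{div}=(-1)^{N(q-1)}*\mathrm d*$ the coderivative (on $q$-forms). For $\Gamma\subset\partial S$ let $C_\infty^{q,\Gamma}(\overline S)$ be the set of restrictions to $S$ of smooth $q$-forms on $M$ whose support has positive distance to $\Gamma$. For $(i,j)=(1,2)$ and $(i,j)=(2,1)$ let $$R^{q,\Gamma_i}(S)=\{E\in L_2^q(S): \exists F\in L_2^{q+1}(S)\ \forall \Phi\in C_\infty^{q+1,\Gamma_j}(\overline S):\ \langle E,\operatorname{div}\Phi\rangle_{q,S}=-\langle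 F,\Phi\rangle_{q+1,S}\},\qquad \operatorname{rot}E:=F,$$ $$D^{q,\Gamma_i}(S)=\{E\in L_2^q(S): \exists G\in L_2^{q-1}(S)\ \forall \Phi\in C_\infty^{q-1,\Gamma_j}(\overline S):\ \langle E,\operatorname{rot}\Phi\rangle_{q,S}=-\langle G,\Phi\rangle_{q-1,S}\},\qquad \operatorname{div}E:=G.$$ Let $R_0^{q,\Gamma_i}(S)$ and $D_0^{q,\Gamma_i}(S)$ be the subspaces on which $\operatorname{rot}E=0$ and $\operatorname{div}E=0$, respectively. Let $\hat R^{q,\Gamma_i}(S)$ be the domain of the adjoint of $\operatorname{div}$ on $D^{q+1,\Gamma_j}(S)$, and $\hat D^{q,\Gamma_i}(S)$ the domain of the adjoint of $\operatorname{rot}$ on $R^{q-1,\Gamma_j}(S)$. Assume that $(S,\Gamma_1,\Gamma_2)$ is a D-domain, that is, for some $i\in\{1,2\}$ one has $R^{q,\Gamma_i}(S)=\hat R^{q,\Gamma_i}(S)$ for all $q$, or $D^{q,\Gamma_i}(S)=\hat D^{q,\Gamma_i}(S)$ for all $q$. Let $q\ge 0$ be such that the embedding $R^{q,\Gamma_1}(S)\cap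 D^{q,\Gamma_2}(S)\hookrightarrow L_2^q(S)$ is compact, where the left-hand side carries the norm $(\|E\|_{q,S}^2+\|\operatorname{rot}E\|_{q+1,S}^2+\|\operatorname{div}E\|_{q-1,S}^2)^{1/2}$. Put $\mathcal H^q=R_0^{q,\Gamma_1}(S)\cap D_0^{q,\Gamma_2}(S)$ (the Dirichlet–Neumann fields). Then: 1. There is $c>0$ such that $\|\Phi\|_{q,S}\le c\,\|\operatorname{div}\Phi\|_{q-1,S}$ for all $\Phi\in R_0^{q,\Gamma_1}(S)\cap D^{q,\Gamma_2}(S)$ with $\Phi\perp\mathcal H^q$ in $L_2^q(S)$. 2. There is $c>0$ such that $\|\Phi\|_{q,S}\le c\,\|\operatorname{rot}\Phi\|_{q+1,S}$ for all $\Phi\in R^{q,\Gamma_1}(S)\cap D_0^{q,\Gamma_2}(S)$ with $\Phi\perp\mathcal H^q$ in $L_2^q(S)$. 3. $\operatorname{rot}R^{q,\Gamma_1}(S)$ is closed in $L_2^{q+1}(S)$, and $\operatorname{div}D^{q,\Gamma_2}(S)$ is closed in $L_2^{q-1}(S)$. -/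

import Mathlib

open MeasureTheory Manifold Bundle Set Filter Topology
open scoped ContDiff InnerProductSpace

noncomputable section

namespace MixedForms

/-! ### Open sets with a decomposed boundary -/

/-- A triple `(S, Γ₁, Γ₂)` of subsets. -/
structure Triple (M : Type*) where
  S : Set M
  Γ₁ : Set M
  Γ₂ : Set M

/-- The triple with the two boundary parts interchanged. -/
def Triple.swap {M : Type*} (T : Triple M) : Triple M := ⟨T.S, T.Γ₂, T.Γ₁⟩

/-- The boundary of a subset `Γ` of `∂S`, taken in the topological space `∂S`. -/
def relBoundary {M : Type*} [TopologicalSpace M] (S Γ : Set M) : Set M :=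
  Subtype.val '' frontier (Subtype.val ⁻¹' Γ : Set (frontier S))

/-- `S` is open with compact closure, `Γ₁` and `Γ₂` are disjoint relatively open subsets of `∂S`
with the same boundary `γ` in `∂S`, and `∂S` is the disjoint union of `Γ₁`, `Γ₂` and `γ`. -/
structure Triple.Admissible {M : Type*} [TopologicalSpace M] (T : Triple M) : Prop where
  isOpen : IsOpen T.S
  isCompact_closure : IsCompact (closure T.S)
  subset₁ : T.Γ₁ ⊆ frontier T.S
  subset₂ : T.Γ₂ ⊆ frontier T.S
  relOpen₁ : IsOpen (Subtype.val ⁻¹' T.Γ₁ : Set (frontier T.S))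
  relOpen₂ : IsOpen (Subtype.val ⁻¹' T.Γ₂ : Set (frontier T.S))
  disjoint : Disjoint T.Γ₁ T.Γ₂
  relBoundary_eq : relBoundary T.S T.Γ₁ = relBoundary T.S T.Γ₂
  disjoint_relBoundary : Disjoint (T.Γ₁ ∪ T.Γ₂) (relBoundary T.S T.Γ₁)
  union_eq : T.Γ₁ ∪ T.Γ₂ ∪ relBoundary T.S T.Γ₁ = frontier T.S

/-! ### Linear algebra on an oriented `N`-dimensional Euclidean space -/

section Pointwise

variable {V : Type*} [NormedAddCommGroup V] [InnerProductSpace ℝ V]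

/-- Insert `w 0, …, w (q-1)`, in this order, into the first `q` slots of an alternating form. -/
def contract (p : ℕ) : (q : ℕ) → (V [⋀^Fin (p + q)]→L[ℝ] ℝ) → (Fin q → V) →
    (V [⋀^Fin p]→L[ℝ] ℝ)
  | 0, η, _ => η
  | q + 1, η, w => contract p q (ContinuousAlternatingMap.curryLeft (n := p + q) η (w 0))
      (fun i => w i.succ)

variable {N : ℕ} [Fact (Module.finrank ℝ V = N)]

/-- The volume form of an oriented Euclidean space of dimension `n = N`, as a continuous
alternating map. -/
def volForm (o : Orientation ℝ V (Fin N)) {n : ℕ} (h : n = N) : V [⋀^Fin n]→L[ℝ] ℝ :=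
  AlternatingMap.mkContinuous (o.volumeForm.domDomCongr (finCongr h.symm)) 1 fun v => by
    subst h
    simpa using o.abs_volumeForm_apply_le v

variable (N V) in
/-- Some orthonormal basis; the notions defined through it do not depend on the choice. -/
def onb [FiniteDimensional ℝ V] : OrthonormalBasis (Fin N) ℝ V :=
  (stdOrthonormalBasis ℝ V).reindex (finCongr Fact.out)

variable (N) in
/-- The Hermitian inner product of complex-valued alternating `q`-forms: the sum over the ordered
multi-indices `I` of `α_I * conj η_I`, the components being taken in an orthonormal basis.
It is linear in the first argument. -/
def formInner [FiniteDimensional ℝ V] {q : ℕ} (α η : V [⋀^Fin q]→L[ℝ] ℂ) : ℂ :=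
  ∑ I : Fin q ↪o Fin N, α (fun k => onb V N (I k)) * (starRingEnd ℂ) (η (fun k => onb V N (I k)))

/-- The (complex linear) Hodge star from `q`-forms to `p`-forms, where `p + q = N`:
`(*α)(v) = ∑_I α(b_I) vol(b_I, v)`. For `p + q ≠ N` the value is `0`. -/
def hodgeStar [FiniteDimensional ℝ V] (o : Orientation ℝ V (Fin N)) (q p : ℕ)
    (α : V [⋀^Fin q]→L[ℝ] ℂ) : V [⋀^Fin p]→L[ℝ] ℂ :=
  if h : p + q = N then
    ∑ I : Fin q ↪o Fin N, α (fun k => onb V N (I k)) •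
      Complex.ofRealCLM.compContinuousAlternatingMap
        (contract p q (volForm o h) (fun k => onb V N (I k)))
  else 0

end Pointwise

/-! ### Forms on an oriented Riemannian manifold -/

section Manifold

variable (N : ℕ) (M : Type*) [TopologicalSpace M] [ChartedSpace (EuclideanSpace ℝ (Fin N)) M]

/-- Complex-valued differential forms of degree `q`, without any regularity. -/
abbrev Form (q : ℕ) : Type _ := ∀ x : M, TangentSpace (𝓡 N) x [⋀^Fin q]→L[ℝ] ℂ

instance (x : M) : FiniteDimensional ℝ (TangentSpace (𝓡 N) x) :=
  inferInstanceAs (FiniteDimensional ℝ (EuclideanSpace ℝ (Fin N)))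

instance (x : M) : Fact (Module.finrank ℝ (TangentSpace (𝓡 N) x) = N) :=
  ⟨(finrank_euclideanSpace_fin : Module.finrank ℝ (EuclideanSpace ℝ (Fin N)) = N)⟩

variable {N M}

/-- The coordinate vector fields `∂₁, …, ∂_N` of a chart, at the point with coordinates `y`. -/
def frame (e : OpenPartialHomeomorph M (EuclideanSpace ℝ (Fin N)))
    (y : EuclideanSpace ℝ (Fin N)) (i : Fin N) : TangentSpace (𝓡 N) (e.symm y) :=
  mfderiv (𝓡 N) (𝓡 N) e.symm y (EuclideanSpace.single i (1 : ℝ))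

/-- The form `α` in the coordinates of the chart `e`, that is, its pullback under `e⁻¹`. -/
def inChart (e : OpenPartialHomeomorph M (EuclideanSpace ℝ (Fin N))) {q : ℕ} (α : Form N M q)
    (y : EuclideanSpace ℝ (Fin N)) : EuclideanSpace ℝ (Fin N) [⋀^Fin q]→L[ℝ] ℂ :=
  (α (e.symm y)).compContinuousLinearMap (mfderiv (𝓡 N) (𝓡 N) e.symm y)

/-- `C^∞` forms on `M`. -/
def SmoothForm {q : ℕ} (α : Form N M q) : Prop :=
  ∀ x : M, ContDiffOn ℝ ∞ (inChart (chartAt (EuclideanSpace ℝ (Fin N)) x) α)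
    (chartAt (EuclideanSpace ℝ (Fin N)) x).target

/-- The exterior derivative (`rot` on smooth forms), computed in the chart at each point. -/
def rotS {q : ℕ} (α : Form N M q) : Form N M (q + 1) := fun x =>
  (extDeriv (inChart (chartAt (EuclideanSpace ℝ (Fin N)) x) α)
    (chartAt (EuclideanSpace ℝ (Fin N)) x x)).compContinuousLinearMap
      (mfderiv (𝓡 N) (𝓡 N) (chartAt (EuclideanSpace ℝ (Fin N)) x) x)

/-- The support of a form. -/
def formSupport {q : ℕ} (α : Form N M q) : Set M := closure {x | α x ≠ 0}

/-- Smooth forms on `M` whose support has positive distance to `Γ`. Here `Γ` is always a subset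
of a compact set, so that positive distance, for any metric inducing the topology, means that the
closed support does not meet the compact closure of `Γ`. -/
def TestForm (Γ : Set M) {q : ℕ} (Φ : Form N M q) : Prop :=
  SmoothForm Φ ∧ Disjoint (formSupport Φ) (closure Γ)

variable [RiemannianBundle (fun x : M => TangentSpace (𝓡 N) x)]

variable (N M) in
/-- An orientation of `M`: an orientation of each tangent space, such that near every point the
coordinate frame of the chart is either positively or negatively oriented throughout. -/
structure ManifoldOrientation where
  orient : ∀ x : M, Orientation ℝ (TangentSpace (𝓡 N) x) (Fin N)
  locally_const : ∀ x : M,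
    let e := chartAt (EuclideanSpace ℝ (Fin N)) x
    (∀ᶠ y in 𝓝 (e x), 0 < (orient (e.symm y)).volumeForm (frame e y)) ∨
    (∀ᶠ y in 𝓝 (e x), (orient (e.symm y)).volumeForm (frame e y) < 0)

/-- The Hodge star on forms. -/
def starS (o : ManifoldOrientation N M) (q p : ℕ) (α : Form N M q) : Form N M p :=
  fun x => hodgeStar (o.orient x) q p (α x)

/-- The coderivative (`div` on smooth forms) `δ = (-1)^(N (r-1)) * d *` on forms of degree
`r = q + 1`; it is the negative of the formal adjoint of `d`. (If `q + 1 > N` it vanishes.) -/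
def divS (o : ManifoldOrientation N M) {q : ℕ} (α : Form N M (q + 1)) : Form N M q :=
  ((-1 : ℂ) ^ (N * q)) •
    starS o (N - (q + 1) + 1) q (rotS (starS o (q + 1) (N - (q + 1)) α))

variable [T2Space M] [SigmaCompactSpace M] [IsManifold (𝓡 N) ∞ M]
  [MeasurableSpace M] [BorelSpace M]

variable (N M) in
/-- The Riemannian volume measure: `√(det g) dy` in every chart, glued by a partition of unity. -/
def vol : Measure M :=
  Measure.sum fun i : M =>
    let e := chartAt (EuclideanSpace ℝ (Fin N)) i
    let ξ := Classical.choose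
      (SmoothPartitionOfUnity.exists_isSubordinate_chartAt_source (𝓡 N) M)
    Measure.map e.symm (((volume : Measure (EuclideanSpace ℝ (Fin N))).restrict e.target).withDensity
      fun y => ENNReal.ofReal (ξ i (e.symm y) * Real.sqrt (Matrix.gram ℝ (frame e y)).det))

/-! ### The spaces `L₂^q(S)`, `R^{q,Γ₁}(S)`, `D^{q,Γ₂}(S)`

Elements of `L₂^q(S)` are given by representatives: forms on `M`, of which only the values almost
everywhere in `S` matter. -/

/-- `α` represents an element of `L₂^q(S)`: its components in every chart are measurable on `S`,
and `|α|²` is integrable over `S`. -/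
structure IsL2 (S : Set M) {q : ℕ} (α : Form N M q) : Prop where
  measurable : ∀ x : M,
    let e := chartAt (EuclideanSpace ℝ (Fin N)) x
    AEStronglyMeasurable (inChart e α) (volume.restrict (e.target ∩ e.symm ⁻¹' S))
  integrable : IntegrableOn (fun x => (formInner N (α x) (α x)).re) S (vol N M)

/-- The inner product `∫_S E ∧ *conj H` of `L₂^q(S)`. -/
def l2Inner (S : Set M) {q : ℕ} (E H : Form N M q) : ℂ :=
  ∫ x in S, formInner N (E x) (H x) ∂(vol N M)

/-- The norm of `L₂^q(S)`. -/
def l2Norm (S : Set M) {q : ℕ} (E : Form N M q) : ℝ :=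
  Real.sqrt (l2Inner S E E).re

/-- A set of elements of `L₂^q(S)` is closed in `L₂^q(S)`. -/
def L2Closed (S : Set M) {q : ℕ} (A : Set (Form N M q)) : Prop :=
  ∀ (u : ℕ → Form N M q) (F : Form N M q), (∀ n, u n ∈ A) → IsL2 S F →
    Tendsto (fun n => l2Norm S (u n - F)) atTop (𝓝 0) → F ∈ A

variable (o : ManifoldOrientation N M) (T : Triple M)

/-- `E ∈ R^{q,Γ₁}(S)` and `rot E = F`: the defining test forms vanish near the complementary
part `Γ₂` of the boundary. -/
def IsRot (q : ℕ) (E : Form N M q) (F : Form N M (q + 1)) : Prop :=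
  IsL2 T.S E ∧ IsL2 T.S F ∧
    ∀ Φ : Form N M (q + 1), TestForm T.Γ₂ Φ → l2Inner T.S E (divS o Φ) = -l2Inner T.S F Φ

/-- `E ∈ D^{q,Γ₂}(S)` and `div E = G`: the defining test forms vanish near the complementary
part `Γ₁` of the boundary. For `q = 0` there are no forms of degree `-1`, so that `D^{0,Γ₂}(S)` is
all of `L₂^0(S)` with `div = 0`; the zero space `L₂^{-1}(S)` is realised by the almost everywhere
vanishing `G` in degree `0 - 1 = 0`. -/
def IsDiv : (q : ℕ) → Form N M q → Form N M (q - 1) → Prop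
  | 0, E, G => IsL2 T.S E ∧ IsL2 T.S G ∧ ∀ᵐ x ∂((vol N M).restrict T.S), G x = 0
  | q + 1, E, G => IsL2 T.S E ∧ IsL2 T.S (q := q) G ∧
      ∀ Φ : Form N M q, TestForm T.Γ₁ Φ → l2Inner T.S E (rotS Φ) = -l2Inner T.S (q := q) G Φ

/-- The space `R^{q,Γ₁}(S)`. -/
def spaceR (q : ℕ) : Set (Form N M q) := {E | ∃ F, IsRot o T q E F}

/-- The space `R₀^{q,Γ₁}(S)` of the elements of `R^{q,Γ₁}(S)` with `rot E = 0`. -/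
def spaceR₀ (q : ℕ) : Set (Form N M q) := {E | IsRot o T q E 0}

/-- The space `D^{q,Γ₂}(S)`. -/
def spaceD (q : ℕ) : Set (Form N M q) := {E | ∃ G, IsDiv T q E G}

/-- The space `D₀^{q,Γ₂}(S)` of the elements of `D^{q,Γ₂}(S)` with `div E = 0`. -/
def spaceD₀ (q : ℕ) : Set (Form N M q) := {E | IsDiv T q E 0}

/-- The image `rot R^{q,Γ₁}(S)`. -/
def rotRange (q : ℕ) : Set (Form N M (q + 1)) := {F | ∃ E, IsRot o T q E F}

/-- The image `div D^{q,Γ₂}(S)`. -/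
def divRange (q : ℕ) : Set (Form N M (q - 1)) := {G | ∃ E, IsDiv T q E G}

/-- The space `R̂^{q,Γ₁}(S)`: the domain of the adjoint of `div` on `D^{q+1,Γ₂}(S)`. -/
def spaceRhat (q : ℕ) : Set (Form N M q) :=
  {E | IsL2 T.S E ∧ ∃ F : Form N M (q + 1), IsL2 T.S F ∧
    ∀ (H : Form N M (q + 1)) (G : Form N M q), IsDiv T (q + 1) H G →
      l2Inner T.S E G = -l2Inner T.S F H}

/-- The space `D̂^{q,Γ₂}(S)`: the domain of the adjoint of `rot` on `R^{q-1,Γ₁}(S)`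
(all of `L₂^0(S)` if `q = 0`). -/
def spaceDhat : (q : ℕ) → Set (Form N M q)
  | 0 => {E | IsL2 T.S E}
  | q + 1 => {E | IsL2 T.S E ∧ ∃ G : Form N M q, IsL2 T.S G ∧
      ∀ (H : Form N M q) (F : Form N M (q + 1)), IsRot o T q H F →
        l2Inner T.S E F = -l2Inner T.S G H}

/-- `(S, Γ₁, Γ₂)` is a D-domain: it is admissible, and for `i = 1` or for `i = 2` one has
`R^{q,Γᵢ}(S) = R̂^{q,Γᵢ}(S)` for all `q` or `D^{q,Γᵢ}(S) = D̂^{q,Γᵢ}(S)` for all `q`. -/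
def IsDDomain : Prop :=
  T.Admissible ∧
    (((∀ q, spaceR o T q = spaceRhat T q) ∨
      (∀ q, spaceD T.swap q = spaceDhat o T.swap q)) ∨
    ((∀ q, spaceR o T.swap q = spaceRhat T.swap q) ∨
      (∀ q, spaceD T q = spaceDhat o T q)))

/-- The embedding `R^{q,Γ₁}(S) ∩ D^{q,Γ₂}(S) ↪ L₂^q(S)` is compact, where the left side carries
the norm `(‖E‖² + ‖rot E‖² + ‖div E‖²)^{1/2}`: every sequence bounded in this norm has a
subsequence which converges in `L₂^q(S)`. -/
def CompactEmbedding (q : ℕ) : Prop :=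
  ∀ (E : ℕ → Form N M q) (F : ℕ → Form N M (q + 1)) (G : ℕ → Form N M (q - 1)) (C : ℝ),
    (∀ n, IsRot o T q (E n) (F n)) → (∀ n, IsDiv T q (E n) (G n)) →
    (∀ n, l2Norm T.S (E n) ^ 2 + l2Norm T.S (F n) ^ 2 + l2Norm T.S (G n) ^ 2 ≤ C) →
    ∃ (φ : ℕ → ℕ) (E' : Form N M q), StrictMono φ ∧ IsL2 T.S E' ∧
      Tendsto (fun n => l2Norm T.S (E (φ n) - E')) atTop (𝓝 0)

end Manifold

end MixedForms

end

open MixedForms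

noncomputable section

namespace MixedForms

/-! ### Sums over multi-indices -/

/-! The analysis is Hilbert space theory for two weakly defined operators. That `E` has the
derivative `F` is a family of linear conditions `⟨a, E⟩ = -⟨b, F⟩` indexed by pairs `(a, b)` built
from test forms; this is `WeakRel`. Each condition is continuous in `E` and `F`, so both operators
are closed.

For the two estimates (`CompactGraph.exists_norm_le`), suppose that no constant works. Then there
are fields of norm one, orthogonal to the Dirichlet–Neumann fields, with one derivative zero and the
other tending to zero. By compactness a subsequence converges in L₂, by closedness the limit is a
Dirichlet–Neumann field, and it is orthogonal to all such fields. Hence its norm is zero, although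
it should be one.

For the closed ranges (`CompactGraph.exists_weakRel_of_tendsto`), let `rot Eₙ` converge. Subtracting
from `Eₙ` its projection onto the kernel of rot does not change `rot Eₙ`. That kernel is the
orthogonal complement of the elements `div Ψ` with `Ψ` a test form, and it contains every `rot Φ`
with `Φ` a test form for div, because `⟨rot Φ, div Ψ⟩ = 0`. The corrected `Eₙ` is therefore
orthogonal to all `rot Φ`, that is, divergence-free, and also orthogonal to the Dirichlet–Neumann
fields. The estimate makes it a Cauchy sequence, and closedness identifies the derivative of its
limit. The range of div is treated in the same way.

The geometric input is the orthogonality `⟨rot Φ, div Ψ⟩ = 0` (`l2Inner_rotS_divS_eq_zero`). The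
supports of `Φ` and `Ψ` avoid the closures of `Γ₁` and `Γ₂`, which together cover `∂S`; so their
common part in the closure of `S` is a compact subset of `S`, and no regularity of `∂S` is needed. A
partition of unity reduces the claim to one chart. There the integrand becomes a constant multiple
of `conj dβ ∧ dΦ` with `β = *Ψ` (`formInner_hodgeStar_mul_volumeForm`, `vol_restrict_source`), whose
integral vanishes by integration by parts and the symmetry of second derivatives
(`integral_wedgeSum_extDeriv_extDeriv`).

The projection argument and the Cauchy argument need L₂ to be complete. This is the Riesz–Fischer
argument, carried out for sections whose values lie in varying fibres. -/

theorem sum_tuples_eq_factorial_smul_sum {q N : ℕ} {F : Type*} [AddCommMonoid F]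
    (f : (Fin q → Fin N) → F) (hperm : ∀ i (σ : Equiv.Perm (Fin q)), f (i ∘ σ) = f i)
    (hinj : ∀ i, ¬ Function.Injective i → f i = 0) :
    ∑ i, f i = q.factorial • ∑ I : Fin q ↪o Fin N, f I := by
  classical
  have h1 : ∑ i, f i = ∑ i with Function.Injective i, f i := by
    rw [Finset.sum_filter]
    exact Finset.sum_congr rfl fun i _ => by
      split_ifs with h
      · rfl
      · exact hinj i h
  rw [h1]
  -- An injective tuple is an increasing one precomposed with a permutation, in a unique way: the
  -- range determines the increasing tuple, and sorting provides the permutation.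
  have h2 : ∑ i : Fin q → Fin N with Function.Injective i, f i =
      ∑ p : (Fin q ↪o Fin N) × Equiv.Perm (Fin q), f (p.1 ∘ p.2) := by
    symm
    refine Finset.sum_bij (fun p _ => p.1 ∘ p.2) ?_ ?_ ?_ ?_
    · intro p _
      simpa using p.1.injective.comp p.2.injective
    · rintro ⟨I, σ⟩ _ ⟨J, τ⟩ _ h
      have hr : Set.range I = Set.range J := by
        have := congrArg Set.range h
        simpa [Set.range_comp] using this
      have hIJ : I = J := by
        rw [← OrderEmbedding.range_inj]; exact hr
      subst hIJ
      congr 1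
      ext k
      have := congrFun h k
      exact congrArg _ (I.injective this)
    · intro i hi
      have hi : Function.Injective i := by simpa using hi
      have hm : StrictMono (i ∘ Tuple.sort i) :=
        (Tuple.monotone_sort i).strictMono_of_injective (hi.comp (Tuple.sort i).injective)
      refine ⟨(OrderEmbedding.ofStrictMono _ hm, (Tuple.sort i)⁻¹), Finset.mem_univ _, ?_⟩
      ext k
      simp
    · intro p _; rfl
  rw [h2, Fintype.sum_prod_type]
  simp [hperm, Finset.sum_const, Finset.smul_sum, Fintype.card_perm]

/-! ### Contractions and change of frame. -/

section Pointwise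

variable {V : Type*} [NormedAddCommGroup V] [InnerProductSpace ℝ V]

/-- Currying always fills the first free slot, so the inserted vectors end up in front, in their
given order; the cast only reconciles `p + q` with `q + p`. -/
theorem contract_apply (p : ℕ) : ∀ (q : ℕ) (η : V [⋀^Fin (p + q)]→L[ℝ] ℝ) (w : Fin q → V)
    (u : Fin p → V), contract p q η w u = η (Fin.append w u ∘ Fin.cast (Nat.add_comm p q))
  | 0, η, w, u => by
    simp only [contract]
    congr 1
    ext k
    have : k.cast (Nat.add_comm p 0) = Fin.natAdd 0 k := by ext; simp
    simp only [Function.comp, this, Fin.append_right]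
  | q + 1, η, w, u => by
    rw [contract, contract_apply p q]
    rw [ContinuousAlternatingMap.curryLeft_apply_apply]
    congr 1
    ext k
    refine Fin.cases ?_ (fun j => ?_) k
    · have h0 : Fin.cast (Nat.add_comm p (q + 1)) 0 = Fin.castAdd p (0 : Fin (q + 1)) := rfl
      simp only [Function.comp, h0, Fin.append_left]
      simp [Matrix.vecCons]
    · simp only [Matrix.vecCons, Fin.cons_succ, Function.comp]
      by_cases hj : (j : ℕ) < q
      · have h1 : Fin.cast (Nat.add_comm p q) j = Fin.castAdd p ⟨j, hj⟩ := rfl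
        have h2 : Fin.cast (Nat.add_comm p (q + 1)) j.succ = Fin.castAdd p ⟨j + 1, by omega⟩ := rfl
        rw [h1, h2, Fin.append_left, Fin.append_left]
        rfl
      · have h1 : Fin.cast (Nat.add_comm p q) j = Fin.natAdd q ⟨j - q, by omega⟩ := by
          ext; simp; omega
        have h2 : Fin.cast (Nat.add_comm p (q + 1)) j.succ =
            Fin.natAdd (q + 1) ⟨j - q, by omega⟩ := by
          ext; simp; omega
        rw [h1, h2, Fin.append_right, Fin.append_right]

theorem map_perm_mul_map_perm {q : ℕ} {F G : Type*} [AddCommGroup F] [Module ℝ F]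
    [AddCommGroup G] [Module ℝ G] {H : Type*} [AddCommGroup H] [Module ℝ H]
    (B : F →ₗ[ℝ] G →ₗ[ℝ] H) (α : V [⋀^Fin q]→ₗ[ℝ] F) (β : V [⋀^Fin q]→ₗ[ℝ] G)
    (v : Fin q → V) (σ : Equiv.Perm (Fin q)) :
    B (α (v ∘ σ)) (β (v ∘ σ)) = B (α v) (β v) := by
  rw [α.map_perm, β.map_perm]
  rcases Int.units_eq_one_or (Equiv.Perm.sign σ) with h | h <;> simp [h]

variable {N : ℕ}

/-- Change of basis in a contraction over all multi-indices: the components of an orthonormal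
basis are replaced by those of an arbitrary frame and the inverse Gram matrix. -/
theorem sum_orthonormalBasis_eq_sum_frame [FiniteDimensional ℝ V] {q : ℕ}
    (b : OrthonormalBasis (Fin N) ℝ V) (v : Fin N → V) (hv : LinearIndependent ℝ v)
    (α : MultilinearMap ℝ (fun _ : Fin q => V) ℂ) (β : MultilinearMap ℝ (fun _ : Fin q => V) ℂ) :
    ∑ k : Fin q → Fin N, α (fun r => b (k r)) * β (fun r => b (k r)) =
      ∑ i : Fin q → Fin N, ∑ j : Fin q → Fin N,
        ((∏ r, (Matrix.gram ℝ v)⁻¹ (i r) (j r) : ℝ) : ℂ) *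
          (α (fun r => v (i r)) * β (fun r => v (j r))) := by
  classical
  -- `A` holds the components of the frame in `b`. The Gram matrix is `Aᵀ A`, its inverse is `A⁻¹
  -- A⁻ᵀ`, and the columns of `A⁻¹` express `b` through the frame. After multilinear expansion, the
  -- sum over `k` produces one inverse Gram entry for each slot.
  set A : Matrix (Fin N) (Fin N) ℝ := Matrix.of fun k i => inner ℝ (b k) (v i) with hA
  have hg : Matrix.gram ℝ v = A.transpose * A := by
    ext i j
    rw [Matrix.gram_apply, Matrix.mul_apply, ← b.sum_inner_mul_inner]
    simp [hA, real_inner_comm]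
  have hdet : IsUnit A.det := by
    have := (Matrix.det_gram_ne_zero_iff_linearIndependent (𝕜 := ℝ) (v := v)).2 hv
    rw [hg, Matrix.det_mul] at this
    exact isUnit_iff_ne_zero.2 (right_ne_zero_of_mul this)
  have hginv : (Matrix.gram ℝ v)⁻¹ = A⁻¹ * A⁻¹.transpose := by
    rw [hg, Matrix.mul_inv_rev, Matrix.transpose_nonsing_inv]
  have hvb : ∀ i, v i = ∑ k, A k i • b k := fun i => (b.sum_repr' (v i)).symm
  have hbv : ∀ k, b k = ∑ i, A⁻¹ i k • v i := by
    intro k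
    simp_rw [hvb, Finset.smul_sum, smul_smul]
    rw [Finset.sum_comm]
    have : ∀ l, ∑ i, (A⁻¹ i k * A l i) • b l = (if l = k then (1 : ℝ) else 0) • b l := by
      intro l
      rw [← Finset.sum_smul]
      congr 1
      have := congrFun (congrFun (Matrix.mul_nonsing_inv A hdet) l) k
      rw [Matrix.mul_apply, Matrix.one_apply] at this
      rw [← this]
      exact Finset.sum_congr rfl fun _ _ => mul_comm _ _
    simp [this]
  have hexp : ∀ (γ : MultilinearMap ℝ (fun _ : Fin q => V) ℂ) (k : Fin q → Fin N),
      γ (fun r => b (k r)) = ∑ i : Fin q → Fin N, ((∏ r, A⁻¹ (i r) (k r) : ℝ) : ℂ) *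
        γ (fun r => v (i r)) := by
    intro γ k
    have : (fun r => b (k r)) = fun r => ∑ i, A⁻¹ i (k r) • v i := funext fun r => hbv (k r)
    rw [this, MultilinearMap.map_sum]
    exact Finset.sum_congr rfl fun i _ => by rw [γ.map_smul_univ]; simp
  simp_rw [hexp, Finset.sum_mul_sum]
  rw [Finset.sum_comm]
  refine Finset.sum_congr rfl fun i _ => ?_
  rw [Finset.sum_comm]
  refine Finset.sum_congr rfl fun j _ => ?_
  have : ∏ r, (Matrix.gram ℝ v)⁻¹ (i r) (j r) =
      ∑ k : Fin q → Fin N, (∏ r, A⁻¹ (i r) (k r)) * ∏ r, A⁻¹ (j r) (k r) := by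
    simp_rw [hginv, Matrix.mul_apply, Matrix.transpose_apply, ← Finset.prod_mul_distrib]
    rw [Finset.prod_univ_sum]
    simp
  rw [this]
  push_cast
  rw [Finset.sum_mul]
  exact Finset.sum_congr rfl fun k _ => by ring

end Pointwise
end MixedForms
end

noncomputable section

set_option linter.unusedSectionVars false

namespace MixedForms

/-! ### The Hermitian inner product and the Hodge star at a point. -/

section Pointwise

variable {V : Type*} [NormedAddCommGroup V] [InnerProductSpace ℝ V]

/-- The complex conjugate of a complex-valued alternating form. -/
def conjForm {q : ℕ} (α : V [⋀^Fin q]→L[ℝ] ℂ) : V [⋀^Fin q]→L[ℝ] ℂ :=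
  Complex.conjCLE.toContinuousLinearMap.compContinuousAlternatingMap α

@[simp] theorem conjForm_apply {q : ℕ} (α : V [⋀^Fin q]→L[ℝ] ℂ) (v : Fin q → V) :
    conjForm α v = (starRingEnd ℂ) (α v) := rfl

theorem map_perm_mul_map_perm_complex {q : ℕ} (α β : V [⋀^Fin q]→L[ℝ] ℂ)
    (v : Fin q → V) (σ : Equiv.Perm (Fin q)) :
    α (v ∘ σ) * β (v ∘ σ) = α v * β v :=
  map_perm_mul_map_perm (LinearMap.mul ℝ ℂ) α.toAlternatingMap β.toAlternatingMap v σ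

theorem map_comp_eq_zero_of_not_injective {q : ℕ} {ι : Type*} (α : V [⋀^Fin q]→L[ℝ] ℂ) (b : ι → V)
    {i : Fin q → ι} (hi : ¬ Function.Injective i) : α (fun r => b (i r)) = 0 :=
  α.map_eq_zero_of_not_injective _ fun h => hi (Function.Injective.of_comp (f := b) h)

variable {N : ℕ}

theorem sum_tuples_mul_eq {q : ℕ} (b : Fin N → V) (α β : V [⋀^Fin q]→L[ℝ] ℂ) :
    ∑ i : Fin q → Fin N, α (fun r => b (i r)) * β (fun r => b (i r)) =
      (q.factorial : ℂ) * ∑ I : Fin q ↪o Fin N, α (fun r => b (I r)) * β (fun r => b (I r)) := by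
  rw [sum_tuples_eq_factorial_smul_sum
    (fun i => α (fun r => b (i r)) * β (fun r => b (i r))), nsmul_eq_mul]
  · intro i σ
    exact map_perm_mul_map_perm_complex α β (fun r => b (i r)) σ
  · intro i hi
    rw [map_comp_eq_zero_of_not_injective α b hi, zero_mul]

variable [Fact (Module.finrank ℝ V = N)] [FiniteDimensional ℝ V]

/-- The basis `onb` is chosen separately at each point, with no continuity. Summing over all tuples
instead of increasing ones allows it to be exchanged for a frame; for coordinate frames this gives
access to smoothness and measurability of the inner product. -/
theorem formInner_eq_frame {q : ℕ} (v : Fin N → V) (hv : LinearIndependent ℝ v)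
    (α η : V [⋀^Fin q]→L[ℝ] ℂ) :
    formInner N α η = (q.factorial : ℂ)⁻¹ * ∑ i : Fin q → Fin N, ∑ j : Fin q → Fin N,
        ((∏ r, (Matrix.gram ℝ v)⁻¹ (i r) (j r) : ℝ) : ℂ) *
          (α (fun r => v (i r)) * (starRingEnd ℂ) (η (fun r => v (j r)))) := by
  have h := sum_tuples_mul_eq (onb V N) α (conjForm η)
  have h2 := sum_orthonormalBasis_eq_sum_frame (onb V N) v hv α.toMultilinearMap
    (conjForm η).toMultilinearMap
  have hq : (q.factorial : ℂ) ≠ 0 := by exact_mod_cast q.factorial_ne_zero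
  rw [eq_inv_mul_iff_mul_eq₀ hq]
  exact h.symm.trans h2

theorem formInner_self_re {q : ℕ} (α : V [⋀^Fin q]→L[ℝ] ℂ) :
    (formInner N α α).re = ∑ I : Fin q ↪o Fin N, ‖α (fun k => onb V N (I k))‖ ^ 2 := by
  simp only [formInner, Complex.re_sum, Complex.mul_conj, Complex.ofReal_re, Complex.normSq_eq_norm_sq]

theorem formInner_self_nonneg {q : ℕ} (α : V [⋀^Fin q]→L[ℝ] ℂ) : 0 ≤ (formInner N α α).re := by
  rw [formInner_self_re]; positivity

theorem formInner_conj_symm {q : ℕ} (α β : V [⋀^Fin q]→L[ℝ] ℂ) :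
    (starRingEnd ℂ) (formInner N α β) = formInner N β α := by
  simp [formInner, mul_comm]

theorem formInner_add_left {q : ℕ} (α β γ : V [⋀^Fin q]→L[ℝ] ℂ) :
    formInner N (α + β) γ = formInner N α γ + formInner N β γ := by
  simp [formInner, add_mul, Finset.sum_add_distrib]

theorem formInner_smul_left {q : ℕ} (c : ℂ) (α γ : V [⋀^Fin q]→L[ℝ] ℂ) :
    formInner N (c • α) γ = c * formInner N α γ := by
  simp [formInner, mul_assoc, Finset.mul_sum]

theorem formInner_smul_right {q : ℕ} (c : ℂ) (α γ : V [⋀^Fin q]→L[ℝ] ℂ) :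
    formInner N α (c • γ) = (starRingEnd ℂ) c * formInner N α γ := by
  rw [← formInner_conj_symm, formInner_smul_left, map_mul, formInner_conj_symm]

theorem formInner_zero_left {q : ℕ} (γ : V [⋀^Fin q]→L[ℝ] ℂ) : formInner N 0 γ = 0 := by
  simp [formInner]

theorem formInner_zero_right {q : ℕ} (γ : V [⋀^Fin q]→L[ℝ] ℂ) : formInner N γ 0 = 0 := by
  simp [formInner]

/-- A bound cruder than Cauchy–Schwarz suffices, since it only serves to dominate integrands. -/
theorem norm_formInner_le {q : ℕ} (α β : V [⋀^Fin q]→L[ℝ] ℂ) :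
    ‖formInner N α β‖ ≤ (formInner N α α).re + (formInner N β β).re := by
  rw [formInner_self_re, formInner_self_re, ← Finset.sum_add_distrib]
  refine (norm_sum_le _ _).trans (Finset.sum_le_sum fun I _ => ?_)
  rw [norm_mul, RCLike.norm_conj]
  nlinarith [sq_nonneg (‖α (fun k => onb V N (I k))‖ - ‖β (fun k => onb V N (I k))‖),
    sq_nonneg (‖α (fun k => onb V N (I k))‖ + ‖β (fun k => onb V N (I k))‖)]

/-- The pointwise norm of an alternating form. -/
def formNorm (N : ℕ) [Fact (Module.finrank ℝ V = N)] {q : ℕ} (α : V [⋀^Fin q]→L[ℝ] ℂ) : ℝ :=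
  Real.sqrt (formInner N α α).re

theorem formNorm_eq_norm {q : ℕ} (α : V [⋀^Fin q]→L[ℝ] ℂ) :
    formNorm N α = ‖WithLp.toLp 2 fun I : Fin q ↪o Fin N => α (fun k => onb V N (I k))‖ := by
  rw [formNorm, formInner_self_re, EuclideanSpace.norm_eq]

theorem norm_apply_le_formNorm {q : ℕ} (α : V [⋀^Fin q]→L[ℝ] ℂ) (I : Fin q ↪o Fin N) :
    ‖α (fun k => onb V N (I k))‖ ≤ formNorm N α := by
  rw [formNorm_eq_norm]
  exact PiLp.norm_apply_le (WithLp.toLp 2 fun I : Fin q ↪o Fin N => α (fun k => onb V N (I k))) I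

/-- The operator norm of an alternating form is controlled by its Euclidean norm. -/
theorem norm_le_mul_formNorm {q : ℕ} (α : V [⋀^Fin q]→L[ℝ] ℂ) :
    ‖α‖ ≤ (q.factorial * Fintype.card (Fin q ↪o Fin N) : ℝ) * formNorm N α := by
  have hn : 0 ≤ formNorm N α := Real.sqrt_nonneg _
  refine ContinuousAlternatingMap.opNorm_le_bound _ (by positivity) fun u => ?_
  have hu : u = fun r => ∑ k, inner ℝ (onb V N k) (u r) • onb V N k :=
    funext fun r => ((onb V N).sum_repr' (u r)).symm
  have h1 : ‖α u‖ ≤ ∑ i : Fin q → Fin N, ‖α (fun r => onb V N (i r))‖ * ∏ r, ‖u r‖ := by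
    conv_lhs => rw [hu]
    change ‖α.toMultilinearMap _‖ ≤ _
    rw [MultilinearMap.map_sum]
    refine (norm_sum_le _ _).trans (Finset.sum_le_sum fun i _ => ?_)
    rw [MultilinearMap.map_smul_univ, norm_smul, mul_comm]
    refine mul_le_mul_of_nonneg_left ?_ (norm_nonneg _)
    rw [norm_prod]
    refine Finset.prod_le_prod (fun _ _ => norm_nonneg _) fun r _ => ?_
    refine (norm_inner_le_norm _ _).trans ?_
    simp
  rw [← Finset.sum_mul] at h1
  refine h1.trans (mul_le_mul_of_nonneg_right ?_ (by positivity))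
  rw [sum_tuples_eq_factorial_smul_sum (fun i : Fin q → Fin N => ‖α (fun r => onb V N (i r))‖)]
  · rw [nsmul_eq_mul, mul_assoc]
    refine mul_le_mul_of_nonneg_left ?_ (by positivity)
    refine (Finset.sum_le_card_nsmul _ _ _ fun I _ => norm_apply_le_formNorm α I).trans ?_
    simp
  · intro i σ
    change ‖α.toAlternatingMap ((fun r => onb V N (i r)) ∘ σ)‖ =
      ‖α.toAlternatingMap (fun r => onb V N (i r))‖
    rw [AlternatingMap.map_perm]
    rcases Int.units_eq_one_or (Equiv.Perm.sign σ) with h | h <;> simp [h]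
  · intro i hi
    rw [map_comp_eq_zero_of_not_injective α _ hi, norm_zero]

/-! ### Volume form and Hodge star in a frame -/

/-- Both sides are the square of the determinant of `v` in an orthonormal basis, the Gram matrix
being `Bᵀ B` for the coordinate matrix `B`. -/
theorem sq_volumeForm_eq_det_gram (o : Orientation ℝ V (Fin N)) (v : Fin N → V) :
    (o.volumeForm v) ^ 2 = (Matrix.gram ℝ v).det := by
  classical
  have h1 : |o.volumeForm v| = |(onb V N).toBasis.det v| := o.volumeForm_robust' (onb V N) v
  rw [← sq_abs, h1, sq_abs, Matrix.gram_eq_conjTranspose_mul (onb V N), Matrix.det_mul,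
    Matrix.det_conjTranspose, Module.Basis.det_apply, sq]
  simp only [star_trivial]
  congr 2

theorem volForm_apply (o : Orientation ℝ V (Fin N)) {n : ℕ} (h : n = N) (u : Fin n → V) :
    volForm o h u = o.volumeForm (u ∘ Fin.cast h.symm) := rfl

theorem hodgeStar_apply (o : Orientation ℝ V (Fin N)) {q p : ℕ} (h : p + q = N)
    (h' : N = q + p) (α : V [⋀^Fin q]→L[ℝ] ℂ) (u : Fin p → V) :
    hodgeStar o q p α u = ∑ I : Fin q ↪o Fin N, α (fun k => onb V N (I k)) *
      (o.volumeForm (Fin.append (fun k => onb V N (I k)) u ∘ Fin.cast h') : ℂ) := by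
  rw [hodgeStar, dif_pos h, ContinuousAlternatingMap.sum_apply]
  refine Finset.sum_congr rfl fun I _ => ?_
  rw [ContinuousAlternatingMap.smul_apply, smul_eq_mul]
  congr 1
  change ((contract p q (volForm o h) _ u : ℝ) : ℂ) = _
  rw [contract_apply, volForm_apply]
  rfl

theorem hodgeStar_add (o : Orientation ℝ V (Fin N)) (q p : ℕ) (α β : V [⋀^Fin q]→L[ℝ] ℂ) :
    hodgeStar o q p (α + β) = hodgeStar o q p α + hodgeStar o q p β := by
  ext u
  by_cases h : p + q = N
  · have h' : N = q + p := by omega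
    rw [ContinuousAlternatingMap.add_apply]
    simp only [hodgeStar_apply o h h', ContinuousAlternatingMap.add_apply, add_mul,
      Finset.sum_add_distrib]
  · simp [hodgeStar, h]

theorem hodgeStar_zero (o : Orientation ℝ V (Fin N)) (q p : ℕ) :
    hodgeStar o q p (0 : V [⋀^Fin q]→L[ℝ] ℂ) = 0 := by
  simpa using hodgeStar_add o q p 0 0

/-- The alternating form `w ↦ vol(w, z)` of the first `q` arguments. -/
def volFormLeft (o : Orientation ℝ V (Fin N)) {q p : ℕ} (h : p + q = N) (z : Fin p → V) :
    V [⋀^Fin q]→L[ℝ] ℂ :=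
  Complex.ofRealCLM.compContinuousAlternatingMap
    (((Equiv.Perm.sign ((finCongr (show N = q + p by omega)).trans
      (finAddFlip.trans (finCongr h))) : ℤ) : ℝ) •
      contract q p (volForm o (show q + p = N by omega)) z)

/-- `contract` freezes the first slots, whereas here the last ones are frozen. The block swap `σ`
turns one into the other, and its sign is the factor in the definition. The star thus becomes a
contraction of two alternating forms over the same multi-index. -/
theorem volFormLeft_apply (o : Orientation ℝ V (Fin N)) {q p : ℕ} (h : p + q = N)
    (h' : N = q + p) (z : Fin p → V) (w : Fin q → V) :
    volFormLeft o h z w = (o.volumeForm (Fin.append w z ∘ Fin.cast h') : ℂ) := by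
  set σ : Equiv.Perm (Fin N) := (finCongr h').trans (finAddFlip.trans (finCongr h)) with hσ
  change ((((Equiv.Perm.sign σ : ℤ) : ℝ) *
    contract q p (volForm o (show q + p = N by omega)) z w : ℝ) : ℂ) = _
  rw [contract_apply, volForm_apply]
  have h1 : Fin.append w z ∘ Fin.cast h' = (Fin.append z w ∘ Fin.cast h.symm) ∘ σ := by
    ext k
    simp only [hσ, Function.comp, Equiv.trans_apply, finCongr_apply]
    generalize Fin.cast h' k = l
    refine Fin.addCases (fun l => ?_) (fun l => ?_) l <;> simp
  rw [h1, AlternatingMap.map_perm, Units.smul_def, zsmul_eq_mul]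
  rfl

end Pointwise

/-! ### The Hodge star in a frame and its relation to the wedge product. -/

section Star

variable {V : Type*} [NormedAddCommGroup V] [InnerProductSpace ℝ V] {N : ℕ}
  [Fact (Module.finrank ℝ V = N)] [FiniteDimensional ℝ V]

/-- The determinant with respect to the standard basis, as a multilinear function of the last `p`
arguments, the first `q` being the standard basis vectors with indices `j`. -/
def stdContract (N q p : ℕ) (h : p + q = N) (j : Fin q → Fin N) :
    EuclideanSpace ℝ (Fin N) [⋀^Fin p]→L[ℝ] ℂ :=
  haveI : Fact (Module.finrank ℝ (EuclideanSpace ℝ (Fin N)) = N) := ⟨finrank_euclideanSpace_fin⟩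
  Complex.ofRealCLM.compContinuousAlternatingMap
    (contract p q (volForm (EuclideanSpace.basisFun (Fin N) ℝ).toBasis.orientation h)
      (fun k => EuclideanSpace.single (j k) 1))

theorem stdContract_apply {q p : ℕ} (h : p + q = N) (h' : N = q + p) (j : Fin q → Fin N)
    (u : Fin p → EuclideanSpace ℝ (Fin N)) :
    stdContract N q p h j u = (((EuclideanSpace.basisFun (Fin N) ℝ).toBasis.det
      (Fin.append (fun k => EuclideanSpace.single (j k) 1) u ∘ Fin.cast h') : ℝ) : ℂ) := by
  have : Fact (Module.finrank ℝ (EuclideanSpace ℝ (Fin N)) = N) := ⟨finrank_euclideanSpace_fin⟩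
  change ((contract p q (volForm _ h) _ u : ℝ) : ℂ) = _
  rw [contract_apply, volForm_apply,
    Orientation.volumeForm_robust _ (EuclideanSpace.basisFun (Fin N) ℝ) rfl]
  rfl

theorem volumeForm_comp_eq_mul_det (o : Orientation ℝ V (Fin N))
    (L : EuclideanSpace ℝ (Fin N) →L[ℝ] V) (u : Fin N → EuclideanSpace ℝ (Fin N)) :
    o.volumeForm (fun k => L (u k)) = o.volumeForm (fun k => L (EuclideanSpace.single k 1)) *
      (EuclideanSpace.basisFun (Fin N) ℝ).toBasis.det u := by
  have := (o.volumeForm.compLinearMap (L : EuclideanSpace ℝ (Fin N) →ₗ[ℝ] V)).eq_smul_basis_det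
    (EuclideanSpace.basisFun (Fin N) ℝ).toBasis
  have h2 := congrArg (fun f => f u) this
  simpa using h2

/-- The star contracts `α` with `vol(·, L u)`, so the change of basis applies, and `vol` composed
with `L` is a multiple of the standard determinant. The dependence on the point then sits in scalar
coefficients, while `stdContract` is constant; this is why the star preserves smoothness. -/
theorem hodgeStar_compContinuousLinearMap (o : Orientation ℝ V (Fin N)) {q p : ℕ} (h : p + q = N)
    (L : EuclideanSpace ℝ (Fin N) →L[ℝ] V) (v : Fin N → V)
    (hLv : ∀ k, L (EuclideanSpace.single k 1) = v k)
    (hv : LinearIndependent ℝ v) (α : V [⋀^Fin q]→L[ℝ] ℂ) :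
    (hodgeStar o q p α).compContinuousLinearMap L = ∑ i : Fin q → Fin N, ∑ j : Fin q → Fin N,
      ((q.factorial : ℂ)⁻¹ * ((∏ r, (Matrix.gram ℝ v)⁻¹ (i r) (j r) : ℝ) : ℂ) *
        (o.volumeForm v : ℂ) * α (fun r => v (i r))) • stdContract N q p h j := by
  have h' : N = q + p := by omega
  ext u
  rw [ContinuousAlternatingMap.compContinuousLinearMap_apply, hodgeStar_apply o h h']
  set β : V [⋀^Fin q]→L[ℝ] ℂ := volFormLeft o h (L ∘ u)
  have hβ : ∀ w, β w = (o.volumeForm (Fin.append w (L ∘ u) ∘ Fin.cast h') : ℂ) :=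
    volFormLeft_apply o h h' _
  have hq : (q.factorial : ℂ) ≠ 0 := by exact_mod_cast q.factorial_ne_zero
  have h1 := sum_tuples_mul_eq (onb V N) α β
  have h2 := sum_orthonormalBasis_eq_sum_frame (onb V N) v hv α.toMultilinearMap β.toMultilinearMap
  replace h1 := h1.symm.trans h2
  rw [← eq_inv_mul_iff_mul_eq₀ hq] at h1
  simp_rw [← hβ]
  rw [h1]
  simp only [ContinuousAlternatingMap.sum_apply, ContinuousAlternatingMap.smul_apply, smul_eq_mul,
    Finset.mul_sum]
  refine Finset.sum_congr rfl fun i _ => Finset.sum_congr rfl fun j _ => ?_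
  change _ * (_ * (α _ * β _)) = _
  rw [hβ, stdContract_apply h h']
  have : Fin.append (fun r => v (j r)) (L ∘ u) ∘ Fin.cast h' = fun k => L ((Fin.append
    (fun k => EuclideanSpace.single (j k) (1 : ℝ)) u ∘ Fin.cast h') k) := by
    ext k
    simp only [Function.comp]
    generalize Fin.cast h' k = l
    refine Fin.addCases (fun l => ?_) (fun l => ?_) l <;> simp [hLv]
  rw [this, volumeForm_comp_eq_mul_det]
  simp only [hLv]
  push_cast
  ring

/-- The top-degree form `conj β ∧ α`, up to normalisation. -/
def wedgeSum {U : Type*} [NormedAddCommGroup U] [NormedSpace ℝ U] {r s : ℕ} (h : s + r = N)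
    (α : U [⋀^Fin r]→L[ℝ] ℂ) (β : U [⋀^Fin s]→L[ℝ] ℂ) (u : Fin N → U) : ℂ :=
  ∑ σ : Equiv.Perm (Fin N), ((Equiv.Perm.sign σ : ℤ) : ℂ) *
    (α (fun k => u (σ (Fin.cast h (Fin.natAdd s k)))) *
      (starRingEnd ℂ) (β (fun k => u (σ (Fin.cast h (Fin.castAdd r k))))))

/-- The sum is the alternatization of a tensor product. What matters later is only that it is
alternating of top degree, hence proportional to the volume form. -/
theorem exists_alternatingMap_eq_wedgeSum {r s : ℕ} (h : s + r = N)
    (α : V [⋀^Fin r]→L[ℝ] ℂ) (β : V [⋀^Fin s]→L[ℝ] ℂ) :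
    ∃ W : V [⋀^Fin N]→ₗ[ℝ] ℂ, ∀ u, W u = wedgeSum h α β u := by
  refine ⟨MultilinearMap.alternatization
    (((LinearMap.mul' ℝ ℂ).compMultilinearMap (α.toMultilinearMap.domCoprod
      (Complex.conjCLE.toContinuousLinearMap.compContinuousAlternatingMap β).toMultilinearMap)).domDomCongr
      ((Equiv.sumComm _ _).trans (finSumFinEquiv.trans (finCongr h)))), fun u => ?_⟩
  rw [MultilinearMap.alternatization_apply]
  refine Finset.sum_congr rfl fun σ _ => ?_
  rw [Units.smul_def, zsmul_eq_mul]
  rfl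

theorem alternatingMap_mul_volumeForm (o : Orientation ℝ V (Fin N)) (W : V [⋀^Fin N]→ₗ[ℝ] ℂ)
    (u v : Fin N → V) : W u * o.volumeForm v = W v * o.volumeForm u := by
  classical
  set e := (onb V N).toBasis
  have hW : ∀ u, W u = e.det u * W e := by
    have : W = ((1 : ℝ →L[ℝ] ℝ).smulRight (W e)).toLinearMap.compAlternatingMap e.det := by
      refine Module.Basis.ext_alternating e fun i h => ?_
      let σ : Equiv.Perm (Fin N) := Equiv.ofBijective i (Finite.injective_iff_bijective.1 h)
      change W (e ∘ σ) = (e.det (e ∘ σ)) • W e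
      simp [AlternatingMap.map_perm, Module.Basis.det_self]
    intro u
    conv_lhs => rw [this]
    change e.det u • W e = _
    simp
  have ho : ∀ u, o.volumeForm u = o.volumeForm e * e.det u := fun u => by
    conv_lhs => rw [o.volumeForm.eq_smul_basis_det e]
    simp
  rw [hW u, hW v, ho u, ho v]
  push_cast
  ring

/-- At an orthonormal basis `b` the inner product expands into terms `α(b_i) conj β(b_j) vol(b_j,
b_i)`; the factorials count the passage from increasing multi-indices to all tuples. Proportionality
of top-degree forms then carries the identity from `b` to any `v`. -/
theorem formInner_hodgeStar_mul_volumeForm (o : Orientation ℝ V (Fin N)) {r s : ℕ} (h : s + r = N)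
    (α : V [⋀^Fin r]→L[ℝ] ℂ) (β : V [⋀^Fin s]→L[ℝ] ℂ) (v : Fin N → V) :
    formInner N α (hodgeStar o s r β) * o.volumeForm v =
      (r.factorial * s.factorial : ℂ)⁻¹ * wedgeSum h α β v := by
  classical
  set b : Fin N → V := fun k => onb V N k with hb
  have hr : (r.factorial : ℂ) ≠ 0 := by exact_mod_cast r.factorial_ne_zero
  have hs : (s.factorial : ℂ) ≠ 0 := by exact_mod_cast s.factorial_ne_zero
  have hvb : (o.volumeForm b : ℂ) * o.volumeForm b = 1 := by
    have := o.abs_volumeForm_apply_of_orthonormal (onb V N)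
    rw [← Complex.ofReal_mul, ← abs_mul_abs_self, this]
    simp
  -- the sum over all permutations
  have key : formInner N α (hodgeStar o s r β) * (r.factorial * s.factorial : ℂ) =
      o.volumeForm b * wedgeSum h α β b := by
    have h1 : ∀ u : Fin r → V, (s.factorial : ℂ) * (starRingEnd ℂ) (hodgeStar o s r β u) =
        ∑ j : Fin s → Fin N, (starRingEnd ℂ) (β fun k => b (j k)) *
          (o.volumeForm (Fin.append (fun k => b (j k)) u ∘ Fin.cast h.symm) : ℂ) := by
      intro u
      have := sum_tuples_mul_eq b (conjForm β) (volFormLeft o (q := s) (p := r) (by omega) u)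
      simp only [volFormLeft_apply o _ h.symm, conjForm_apply] at this
      rw [this, hodgeStar_apply o (by omega) h.symm, map_sum]
      simp only [map_mul, Complex.conj_ofReal]
      rfl
    have h2 : (r.factorial : ℂ) * formInner N α (hodgeStar o s r β) =
        ∑ i : Fin r → Fin N, α (fun k => b (i k)) *
          (starRingEnd ℂ) (hodgeStar o s r β fun k => b (i k)) := by
      have := sum_tuples_mul_eq b α (conjForm (hodgeStar o s r β))
      exact this.symm
    have h3 : formInner N α (hodgeStar o s r β) * (r.factorial * s.factorial : ℂ) =
        ∑ p : (Fin s → Fin N) × (Fin r → Fin N), α (fun k => b (p.2 k)) *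
          ((starRingEnd ℂ) (β fun k => b (p.1 k)) *
          (o.volumeForm (b ∘ Fin.append p.1 p.2 ∘ Fin.cast h.symm) : ℂ)) := by
      rw [← mul_assoc, mul_comm (formInner N α (hodgeStar o s r β)), h2, Finset.sum_mul,
        Fintype.sum_prod_type_right]
      refine Finset.sum_congr rfl fun i _ => ?_
      rw [mul_assoc, mul_comm _ (s.factorial : ℂ), h1, Finset.mul_sum]
      refine Finset.sum_congr rfl fun j _ => ?_
      have : Fin.append (fun k => b (j k)) (fun k => b (i k)) ∘ Fin.cast h.symm =
          b ∘ Fin.append j i ∘ Fin.cast h.symm := by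
        ext k
        simp only [Function.comp]
        generalize Fin.cast h.symm k = l
        refine Fin.addCases (fun l => ?_) (fun l => ?_) l <;> simp
      rw [this]
    rw [h3, ← ((Fin.appendEquiv (α := Fin N) s r).trans
      ((finCongr h).arrowCongr (Equiv.refl _))).symm.sum_comp, wedgeSum, Finset.mul_sum]
    -- The concatenation of `j` and `i` is a self-map `K` of `Fin N`. The volume form kills the
    -- non-injective ones; the others are permutations and contribute their signs.
    have h4 : ∀ K : Fin N → Fin N, ¬ Function.Injective K → o.volumeForm (b ∘ K) = 0 :=
      fun K hK => o.volumeForm.map_eq_zero_of_not_injective _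
        fun hi => hK (Function.Injective.of_comp (f := b) hi)
    symm
    refine Finset.sum_of_injOn (fun σ : Equiv.Perm (Fin N) => (σ : Fin N → Fin N))
      (fun _ _ _ _ hab => DFunLike.coe_injective hab) (fun _ _ => Finset.mem_univ _) ?_ ?_
    · intro K _ hK
      have hK' : ¬ Function.Injective K := fun hi => hK
        ⟨Equiv.ofBijective K (Finite.injective_iff_bijective.1 hi), by simp, rfl⟩
      have h6 : Fin.append (((Fin.appendEquiv (α := Fin N) s r).trans
          ((finCongr h).arrowCongr (Equiv.refl _))).symm K).1 (((Fin.appendEquiv (α := Fin N) s r).trans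
          ((finCongr h).arrowCongr (Equiv.refl _))).symm K).2 ∘ Fin.cast h.symm = K :=
        ((Fin.appendEquiv (α := Fin N) s r).trans
          ((finCongr h).arrowCongr (Equiv.refl _))).apply_symm_apply K
      rw [h6, h4 K hK']
      simp
    · intro σ _
      have h6 : Fin.append (((Fin.appendEquiv (α := Fin N) s r).trans
          ((finCongr h).arrowCongr (Equiv.refl _))).symm σ).1 (((Fin.appendEquiv (α := Fin N) s r).trans
          ((finCongr h).arrowCongr (Equiv.refl _))).symm σ).2 ∘ Fin.cast h.symm = σ :=
        ((Fin.appendEquiv (α := Fin N) s r).trans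
          ((finCongr h).arrowCongr (Equiv.refl _))).apply_symm_apply σ
      rw [h6, AlternatingMap.map_perm, Units.smul_def, zsmul_eq_mul]
      push_cast
      change _ = α (fun k => b (σ (Fin.cast h (Fin.natAdd s k)))) *
        ((starRingEnd ℂ) (β (fun k => b (σ (Fin.cast h (Fin.castAdd r k))))) * _)
      ring
  have hW := exists_alternatingMap_eq_wedgeSum h α β
  obtain ⟨W, hW⟩ := hW
  have h5 := alternatingMap_mul_volumeForm o W b v
  rw [hW, hW] at h5
  rw [eq_inv_mul_iff_mul_eq₀ (mul_ne_zero hr hs)]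
  -- The factor `vol(b)² = 1` removes the reference to the basis.
  linear_combination (o.volumeForm v : ℂ) * key + (o.volumeForm b : ℂ) * h5 +
    wedgeSum h α β v * hvb

end Star
end MixedForms
end

noncomputable section

set_option linter.unusedSectionVars false

namespace MixedForms

/-! ### Stokes' theorem for compactly supported forms on a vector space. -/

section Stokes

variable {E : Type*} [NormedAddCommGroup E] [NormedSpace ℝ E] [FiniteDimensional ℝ E]
  [MeasurableSpace E] [BorelSpace E] (μ : Measure E) [μ.IsAddHaarMeasure]

/-- One integration by parts moves the derivative along `u` onto `g`. The resulting second
derivative is symmetric in `u` and `v`, which later cancels against the alternating sign. -/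
theorem integral_fderiv_mul_fderiv_eq_neg {f g : E → ℂ} (hf : ContDiff ℝ ∞ f) (hg : ContDiff ℝ ∞ g)
    (hfc : HasCompactSupport f) (u v : E) :
    ∫ y, fderiv ℝ f y u * fderiv ℝ g y v ∂μ =
      - ∫ y, f y * fderiv ℝ (fderiv ℝ g) y u v ∂μ := by
  have hg' : ContDiff ℝ ∞ (fun y => fderiv ℝ g y v) :=
    (hg.fderiv_right (m := ∞) (by simp)).clm_apply contDiff_const
  have hf' : Continuous (fun y => fderiv ℝ f y u) :=
    (hf.continuous_fderiv (by simp)).clm_apply continuous_const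
  have hg'' : Continuous (fun y => fderiv ℝ (fun y => fderiv ℝ g y v) y u) :=
    (hg'.continuous_fderiv (by simp)).clm_apply continuous_const
  have hfc' : HasCompactSupport (fun y => fderiv ℝ f y u) := hfc.fderiv_apply ℝ u
  have h1 := integral_mul_fderiv_eq_neg_fderiv_mul_of_integrable (μ := μ) (f := f)
    (g := fun y => fderiv ℝ g y v) (v := u)
    ((hf'.mul hg'.continuous).integrable_of_hasCompactSupport (hfc'.mul_right))
    ((hf.continuous.mul hg'').integrable_of_hasCompactSupport (hfc.mul_right))
    ((hf.continuous.mul hg'.continuous).integrable_of_hasCompactSupport (hfc.mul_right))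
    (fun x _ => hf.differentiable (by simp) x) (fun x _ => hg'.differentiable (by simp) x)
  have h2 : ∀ y, fderiv ℝ (fun y => fderiv ℝ g y v) y u = fderiv ℝ (fderiv ℝ g) y u v := by
    intro y
    rw [fderiv_clm_apply ((hg.fderiv_right (m := ∞) (by simp)).differentiable (by simp) y)
      (differentiableAt_const v)]
    simp
  simp_rw [h2] at h1
  rw [h1, neg_neg]

variable {N : ℕ}

/-- `∫ dφ ∧ conj dω = 0` for compactly supported `φ`. -/
theorem integral_wedgeSum_extDeriv_extDeriv {a b : ℕ} (h : (b + 1) + (a + 1) = N) (e : Fin N → E)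
    {φ : E → E [⋀^Fin a]→L[ℝ] ℂ} {w : E → E [⋀^Fin b]→L[ℝ] ℂ} (hφ : ContDiff ℝ ∞ φ)
    (hw : ContDiff ℝ ∞ w) (hc : HasCompactSupport φ) :
    ∫ y, wedgeSum h (extDeriv φ y) (extDeriv w y) e ∂μ = 0 := by
  classical
  let first : Fin (b + 1) → Fin N := fun l => Fin.cast h (Fin.castAdd (a + 1) l)
  let last : Fin (a + 1) → Fin N := fun k => Fin.cast h (Fin.natAdd (b + 1) k)
  have hfirst : Function.Injective first := fun i j hij => by simpa [first] using hij
  have hlast : Function.Injective last := fun i j hij => by simpa [last] using hij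
  have hfl : ∀ l k, first l ≠ last k := fun l k hlk => by
    have := congrArg Fin.val hlk
    simp [first, last] at this
    omega
  -- In `dφ` and `dw` the direction of differentiation uses up slot `k` or `l`; `P` and `Q` are the
  -- coefficients in the remaining slots.
  let P : Equiv.Perm (Fin N) → Fin (a + 1) → E → ℂ :=
    fun σ k y => φ y (k.removeNth fun i => e (σ (last i)))
  let Q : Equiv.Perm (Fin N) → Fin (b + 1) → E → ℂ :=
    fun σ l y => (starRingEnd ℂ) (w y (l.removeNth fun i => e (σ (first i))))
  have happly : ∀ {n : ℕ} (η : E → E [⋀^Fin n]→L[ℝ] ℂ), ContDiff ℝ ∞ η → ∀ u,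
      ContDiff ℝ ∞ (fun y => η y u) := fun η hη u =>
    (ContinuousAlternatingMap.apply ℝ E ℂ u).contDiff.comp hη
  have hP : ∀ σ k, ContDiff ℝ ∞ (P σ k) := fun σ k => happly φ hφ _
  have hQ' : ∀ σ l, ContDiff ℝ ∞ (Q σ l) := fun σ l =>
    Complex.conjCLE.contDiff.comp (happly w hw _)
  have hPc : ∀ σ k, HasCompactSupport (P σ k) := fun σ k =>
    hc.comp_left (g := fun η : E [⋀^Fin a]→L[ℝ] ℂ => η (k.removeNth fun i => e (σ (last i)))) rfl
  have hdφ : ∀ σ y, extDeriv φ y (fun k => e (σ (last k))) =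
      ∑ k, (-1) ^ k.val * fderiv ℝ (P σ k) y (e (σ (last k))) := by
    intro σ y
    rw [extDeriv_apply (hφ.differentiable (by simp) y)]
    simp [P]
  have hdw : ∀ σ y, (starRingEnd ℂ) (extDeriv w y (fun k => e (σ (first k)))) =
      ∑ l, (-1) ^ l.val * fderiv ℝ (Q σ l) y (e (σ (first l))) := by
    intro σ y
    rw [extDeriv_apply (hw.differentiable (by simp) y), map_sum]
    refine Finset.sum_congr rfl fun l _ => ?_
    have : fderiv ℝ (Q σ l) y = Complex.conjCLE.toContinuousLinearMap.comp
        (fderiv ℝ (fun y => w y (l.removeNth fun i => e (σ (first i)))) y) :=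
      ((Complex.conjCLE.toContinuousLinearMap.hasFDerivAt).comp y
        ((happly w hw _).differentiable (by simp) y).hasFDerivAt).fderiv
    rw [this]
    simp
  have hint : ∀ σ k l, Integrable (fun y => fderiv ℝ (P σ k) y (e (σ (last k))) *
      fderiv ℝ (Q σ l) y (e (σ (first l)))) μ := fun σ k l =>
    ((((hP σ k).continuous_fderiv (by simp)).clm_apply continuous_const).mul
      (((hQ' σ l).continuous_fderiv (by simp)).clm_apply
        continuous_const)).integrable_of_hasCompactSupport ((hPc σ k).fderiv_apply ℝ _).mul_right
  have hexp : ∀ y, wedgeSum h (extDeriv φ y) (extDeriv w y) e =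
      ∑ σ : Equiv.Perm (Fin N), ∑ k, ∑ l, (((Equiv.Perm.sign σ : ℤ) : ℂ) *
        ((-1) ^ k.val * (-1) ^ l.val)) * (fderiv ℝ (P σ k) y (e (σ (last k))) *
          fderiv ℝ (Q σ l) y (e (σ (first l)))) := by
    intro y
    refine Finset.sum_congr rfl fun σ _ => ?_
    rw [hdφ σ y, hdw σ y, Finset.sum_mul_sum, Finset.mul_sum]
    refine Finset.sum_congr rfl fun k _ => ?_
    rw [Finset.mul_sum]
    exact Finset.sum_congr rfl fun l _ => by ring
  simp_rw [hexp]
  rw [integral_finsetSum _ fun σ _ => integrable_finsetSum _ fun k _ =>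
    integrable_finsetSum _ fun l _ => (hint σ k l).const_mul _]
  simp_rw [integral_finsetSum _ fun k _ => integrable_finsetSum _ fun l _ =>
    (hint _ k l).const_mul _]
  simp_rw [integral_finsetSum _ fun l _ => (hint _ _ l).const_mul _]
  simp_rw [integral_const_mul, integral_fderiv_mul_fderiv_eq_neg μ (hP _ _) (hQ' _ _) (hPc _ _)]
  rw [Finset.sum_comm]
  refine Finset.sum_eq_zero fun k _ => ?_
  rw [Finset.sum_comm]
  refine Finset.sum_eq_zero fun l _ => ?_
  set S : ℂ := ∑ σ : Equiv.Perm (Fin N), _ with hS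
  -- Compose `σ` with the transposition of the slots `last k` and `first l`. The coefficients `P`
  -- and `Q` omit these slots and do not change, the two directions in the second derivative are
  -- interchanged without effect, and the sign flips.
  have hSS : S = - S := by
    conv_lhs => rw [hS, ← Equiv.sum_comp (Equiv.mulRight (Equiv.swap (last k) (first l)))]
    rw [hS, ← Finset.sum_neg_distrib]
    refine Finset.sum_congr rfl fun σ _ => ?_
    simp only [Equiv.coe_mulRight]
    have h1 : P (σ * Equiv.swap (last k) (first l)) k = P σ k := by
      ext y
      refine congrArg (φ y) (funext fun i => ?_)
      simp only [Fin.removeNth, Equiv.Perm.coe_mul, Function.comp]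
      rw [Equiv.swap_apply_of_ne_of_ne (fun hh => Fin.succAbove_ne k i (hlast hh))
        (hfl _ _).symm]
    have h2 : Q (σ * Equiv.swap (last k) (first l)) l = Q σ l := by
      ext y
      refine congrArg (fun u => (starRingEnd ℂ) (w y u)) (funext fun i => ?_)
      simp only [Fin.removeNth, Equiv.Perm.coe_mul, Function.comp]
      rw [Equiv.swap_apply_of_ne_of_ne (hfl _ _) (fun hh => Fin.succAbove_ne l i (hfirst hh))]
    have h3 : ∀ y u v, fderiv ℝ (fderiv ℝ (Q σ l)) y u v = fderiv ℝ (fderiv ℝ (Q σ l)) y v u :=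
      fun y u v => ((hQ' σ l).contDiffAt.isSymmSndFDerivAt
        (by simpa using WithTop.coe_le_coe.2 (le_top : (2 : ℕ∞) ≤ ⊤))).eq u v
    rw [h1, h2, Equiv.Perm.sign_mul, Equiv.Perm.sign_swap (hfl l k).symm]
    simp only [Equiv.Perm.coe_mul, Function.comp, Equiv.swap_apply_left, Equiv.swap_apply_right]
    simp_rw [h3 _ (e (σ (first l)))]
    push_cast
    ring
  linear_combination (1 / 2 : ℂ) * hSS

end Stokes
end MixedForms
end

noncomputable section

set_option linter.unusedSectionVars false

namespace MixedForms

/-! ### Smoothness of pullbacks and of the exterior derivative. -/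

section Pullback

variable {E F G : Type*} [NormedAddCommGroup E] [NormedSpace ℝ E] [NormedAddCommGroup F]
  [NormedSpace ℝ F] [NormedAddCommGroup G] [NormedSpace ℝ G]

/-- Alternatization divided by `q!` is a continuous linear left inverse of the inclusion of
alternating into multilinear maps, so smoothness can be tested after the inclusion. -/
theorem contDiffAt_of_toContinuousMultilinearMap {q : ℕ} {n : ℕ∞ω} {f : G → E [⋀^Fin q]→L[ℝ] F}
    {x : G} (hf : ContDiffAt ℝ n (fun y => (f y).toContinuousMultilinearMap) x) :
    ContDiffAt ℝ n f x := by
  let A : ContinuousMultilinearMap ℝ (fun _ : Fin q => E) F →L[ℝ] E [⋀^Fin q]→L[ℝ] F :=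
    LinearMap.mkContinuous
      { toFun := fun m => ContinuousMultilinearMap.alternatization m
        map_add' := map_add _
        map_smul' := fun c m => by
          ext u
          simp [ContinuousMultilinearMap.alternatization_apply_apply, Finset.smul_sum,
            smul_comm c] } (q.factorial : ℝ) fun m => by
      refine ContinuousAlternatingMap.opNorm_le_bound _ (by positivity) fun u => ?_
      simp only [LinearMap.coe_mk, AddHom.coe_mk,
        ContinuousMultilinearMap.alternatization_apply_apply]
      refine (norm_sum_le _ _).trans ((Finset.sum_le_card_nsmul _ _ (‖m‖ * ∏ i, ‖u i‖)
        fun σ _ => ?_).trans (le_of_eq ?_))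
      · have h1 : ‖Equiv.Perm.sign σ • m (u ∘ σ)‖ = ‖m (u ∘ σ)‖ := by
          rcases Int.units_eq_one_or (Equiv.Perm.sign σ) with h | h <;> simp [h]
        rw [h1]
        refine (m.le_opNorm _).trans (le_of_eq ?_)
        congr 1
        exact Equiv.prod_comp σ fun i => ‖u i‖
      · simp [Fintype.card_perm, mul_assoc]
  have hA : f = fun y => (q.factorial : ℝ)⁻¹ • A (f y).toContinuousMultilinearMap := by
    ext y u
    have hq : (q.factorial : ℝ) ≠ 0 := by exact_mod_cast q.factorial_ne_zero
    rw [ContinuousAlternatingMap.smul_apply, eq_inv_smul_iff₀ hq]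
    change _ = ContinuousMultilinearMap.alternatization (f y).toContinuousMultilinearMap u
    rw [ContinuousMultilinearMap.alternatization_apply_apply]
    have : ∀ σ : Equiv.Perm (Fin q), Equiv.Perm.sign σ •
        (f y).toContinuousMultilinearMap (u ∘ σ) = f y u := by
      intro σ
      change Equiv.Perm.sign σ • (f y).toAlternatingMap (u ∘ σ) = (f y).toAlternatingMap u
      rw [AlternatingMap.map_perm, smul_smul, Int.units_mul_self, one_smul]
    rw [Finset.sum_congr rfl fun σ _ => this σ]
    simp [Fintype.card_perm, Nat.cast_smul_eq_nsmul]
  rw [hA]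
  exact (A.contDiff.contDiffAt.comp x hf).const_smul _

/-- The pullback is linear in the form and multilinear in `q` copies of `L`. -/
theorem contDiffAt_form_compContinuousLinearMap {H : Type*} [NormedAddCommGroup H]
    [NormedSpace ℝ H] {q : ℕ} {n : ℕ∞ω} {f : G → E [⋀^Fin q]→L[ℝ] F} {L : G → H →L[ℝ] E} {x : G}
    (hf : ContDiffAt ℝ n f x) (hL : ContDiffAt ℝ n L x) :
    ContDiffAt ℝ n (fun y => (f y).compContinuousLinearMap (L y)) x := by
  refine contDiffAt_of_toContinuousMultilinearMap ?_
  have h1 : ContDiffAt ℝ n (fun y => (f y).toContinuousMultilinearMap) x :=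
    ContDiffAt.comp x (g := fun m : E [⋀^Fin q]→L[ℝ] F => m.toContinuousMultilinearMap)
      (ContinuousAlternatingMap.toContinuousMultilinearMapLI (𝕜 := ℝ) (E := E) (F := F)
        (ι := Fin q)).contDiff.contDiffAt hf
  have h2 : ContDiffAt ℝ n (fun y => ContinuousMultilinearMap.compContinuousLinearMapContinuousMultilinear
      ℝ (fun _ : Fin q => H) (fun _ : Fin q => E) F (fun _ => L y)) x :=
    (ContinuousMultilinearMap.contDiff _).contDiffAt.comp x (contDiffAt_pi.2 fun _ => hL)
  exact h2.clm_apply h1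

theorem contDiffAt_extDeriv {n : ℕ} {η : E → E [⋀^Fin n]→L[ℝ] F} {y : E}
    (h : ContDiffAt ℝ ∞ η y) : ContDiffAt ℝ ∞ (extDeriv η) y :=
  ContDiffAt.comp y (g := ContinuousAlternatingMap.alternatizeUncurryFinCLM ℝ E F)
    (ContinuousLinearMap.contDiff _).contDiffAt (h.fderiv_right (m := ∞) (by simp))

end Pullback

/-! ### Differential forms in charts. -/

section Charts

variable {N : ℕ} {M : Type*} [TopologicalSpace M] [ChartedSpace (EuclideanSpace ℝ (Fin N)) M]

/-- The derivative of the inverse of a chart, as an endomorphism of the model space. -/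
def chartDeriv (e : OpenPartialHomeomorph M (EuclideanSpace ℝ (Fin N)))
    (y : EuclideanSpace ℝ (Fin N)) : EuclideanSpace ℝ (Fin N) →L[ℝ] EuclideanSpace ℝ (Fin N) :=
  mfderiv (𝓡 N) (𝓡 N) e.symm y

/-- A form, its values being regarded as forms on the model space. -/
def toModel {q : ℕ} (α : Form N M q) (x : M) : EuclideanSpace ℝ (Fin N) [⋀^Fin q]→L[ℝ] ℂ := α x

theorem inChart_eq (e : OpenPartialHomeomorph M (EuclideanSpace ℝ (Fin N))) {q : ℕ}
    (α : Form N M q) (y : EuclideanSpace ℝ (Fin N)) :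
    inChart e α y = (toModel α (e.symm y)).compContinuousLinearMap (chartDeriv e y) := rfl

theorem inChart_add (e : OpenPartialHomeomorph M (EuclideanSpace ℝ (Fin N))) {q : ℕ}
    (α β : Form N M q) : inChart e (α + β) = inChart e α + inChart e β := rfl

variable [IsManifold (𝓡 N) ∞ M]
  {e e' : OpenPartialHomeomorph M (EuclideanSpace ℝ (Fin N))}

theorem contMDiffAt_symm (he : e ∈ IsManifold.maximalAtlas (𝓡 N) ∞ M)
    {y : EuclideanSpace ℝ (Fin N)} (hy : y ∈ e.target) : ContMDiffAt (𝓡 N) (𝓡 N) ∞ e.symm y :=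
  (contMDiffOn_symm_of_mem_maximalAtlas he).contMDiffAt (e.open_target.mem_nhds hy)

theorem mdifferentiableAt_symm (he : e ∈ IsManifold.maximalAtlas (𝓡 N) ∞ M)
    {y : EuclideanSpace ℝ (Fin N)} (hy : y ∈ e.target) :
    MDifferentiableAt (𝓡 N) (𝓡 N) e.symm y :=
  (contMDiffAt_symm he hy).mdifferentiableAt (by simp)

/-- The change of charts is smooth. -/
theorem contDiffAt_transition (he : e ∈ IsManifold.maximalAtlas (𝓡 N) ∞ M)
    (he' : e' ∈ IsManifold.maximalAtlas (𝓡 N) ∞ M) {y : EuclideanSpace ℝ (Fin N)}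
    (hy : y ∈ e.target) (hy' : e.symm y ∈ e'.source) : ContDiffAt ℝ ∞ (e' ∘ e.symm) y := by
  rw [← contMDiffAt_iff_contDiffAt]
  exact ((contMDiffOn_of_mem_maximalAtlas he').contMDiffAt
    (e'.open_source.mem_nhds hy')).comp y (contMDiffAt_symm he hy)

theorem eventuallyEq_symm {y : EuclideanSpace ℝ (Fin N)}
    (hy : y ∈ e.target) (hy' : e.symm y ∈ e'.source) :
    e'.symm ∘ (e' ∘ e.symm) =ᶠ[𝓝 y] e.symm := by
  have : ∀ᶠ z in 𝓝 y, e.symm z ∈ e'.source :=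
    (e.symm.continuousAt hy).eventually (e'.open_source.mem_nhds hy')
  filter_upwards [this] with z hz
  simp [e'.left_inv hz]

theorem chartDeriv_eq_comp (he : e ∈ IsManifold.maximalAtlas (𝓡 N) ∞ M)
    (he' : e' ∈ IsManifold.maximalAtlas (𝓡 N) ∞ M) {y : EuclideanSpace ℝ (Fin N)}
    (hy : y ∈ e.target) (hy' : e.symm y ∈ e'.source) :
    chartDeriv e y = (chartDeriv e' (e' (e.symm y))).comp (fderiv ℝ (e' ∘ e.symm) y) := by
  have h1 := (eventuallyEq_symm hy hy').mfderiv_eq (I := 𝓡 N) (I' := 𝓡 N)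
  have h2 := mfderiv_comp (I := 𝓡 N) (I' := 𝓡 N) (I'' := 𝓡 N) y
    (g := e'.symm) (f := e' ∘ e.symm)
    (mdifferentiableAt_symm he' (e'.map_source hy'))
    ((contMDiffAt_iff_contDiffAt.2 (contDiffAt_transition he he' hy hy')).mdifferentiableAt
      (by simp))
  rw [mfderiv_eq_fderiv] at h2
  exact h1.symm.trans h2

theorem mfderiv_comp_chartDeriv (he : e ∈ IsManifold.maximalAtlas (𝓡 N) ∞ M)
    (he' : e' ∈ IsManifold.maximalAtlas (𝓡 N) ∞ M) {y : EuclideanSpace ℝ (Fin N)}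
    (hy : y ∈ e.target) (hy' : e.symm y ∈ e'.source) :
    (mfderiv (𝓡 N) (𝓡 N) e' (e.symm y)).comp (mfderiv (𝓡 N) (𝓡 N) e.symm y) =
      fderiv ℝ (e' ∘ e.symm) y := by
  rw [← mfderiv_eq_fderiv]
  exact (mfderiv_comp (I := 𝓡 N) (I' := 𝓡 N) (I'' := 𝓡 N) y
    (g := e') (f := e.symm)
    (((contMDiffOn_of_mem_maximalAtlas he').contMDiffAt
      (e'.open_source.mem_nhds hy')).mdifferentiableAt (by simp))
    (mdifferentiableAt_symm he hy)).symm

theorem chartDeriv_injective (he : e ∈ IsManifold.maximalAtlas (𝓡 N) ∞ M)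
    {y : EuclideanSpace ℝ (Fin N)} (hy : y ∈ e.target) : Function.Injective (chartDeriv e y) := by
  have h := mfderiv_comp_chartDeriv he he hy (e.map_target hy)
  have h1 : e ∘ e.symm =ᶠ[𝓝 y] id := by
    filter_upwards [e.open_target.mem_nhds hy] with z hz'
    simp [e.right_inv hz']
  rw [h1.fderiv_eq, fderiv_id] at h
  intro u w huw
  have hu := congrArg (fun L => L u) h
  have hw := congrArg (fun L => L w) h
  have h2 := congrArg (mfderiv (𝓡 N) (𝓡 N) e (e.symm y)) huw
  exact (hu.symm.trans h2).trans hw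

theorem linearIndependent_frame (he : e ∈ IsManifold.maximalAtlas (𝓡 N) ∞ M)
    {y : EuclideanSpace ℝ (Fin N)} (hy : y ∈ e.target) : LinearIndependent ℝ (frame e y) := by
  have h := (EuclideanSpace.basisFun (Fin N) ℝ).toBasis.linearIndependent.map'
    (chartDeriv e y).toLinearMap (LinearMap.ker_eq_bot.2 (chartDeriv_injective he hy))
  have h2 : ((chartDeriv e y).toLinearMap ∘ (EuclideanSpace.basisFun (Fin N) ℝ).toBasis) =
      frame e y := by
    ext1 k
    simp only [Function.comp, OrthonormalBasis.coe_toBasis, EuclideanSpace.basisFun_apply]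
    rfl
  rw [h2] at h
  exact h

/-! ### Smooth forms and the exterior derivative in charts -/

theorem inChart_eq_pullback (he : e ∈ IsManifold.maximalAtlas (𝓡 N) ∞ M)
    (he' : e' ∈ IsManifold.maximalAtlas (𝓡 N) ∞ M) {q : ℕ} (α : Form N M q)
    {y : EuclideanSpace ℝ (Fin N)} (hy : y ∈ e.target) (hy' : e.symm y ∈ e'.source) :
    inChart e α y = (inChart e' α ((e' ∘ e.symm) y)).compContinuousLinearMap
      (fderiv ℝ (e' ∘ e.symm) y) := by
  rw [inChart_eq, inChart_eq, chartDeriv_eq_comp he he' hy hy']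
  have : e'.symm ((e' ∘ e.symm) y) = e.symm y := e'.left_inv hy'
  rw [this]
  rfl

theorem eventually_inChart_eq_pullback (he : e ∈ IsManifold.maximalAtlas (𝓡 N) ∞ M)
    (he' : e' ∈ IsManifold.maximalAtlas (𝓡 N) ∞ M) {q : ℕ} (α : Form N M q)
    {y : EuclideanSpace ℝ (Fin N)} (hy : y ∈ e.target) (hy' : e.symm y ∈ e'.source) :
    ∀ᶠ z in 𝓝 y, inChart e α z = (inChart e' α ((e' ∘ e.symm) z)).compContinuousLinearMap
      (fderiv ℝ (e' ∘ e.symm) z) := by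
  have : ∀ᶠ z in 𝓝 y, e.symm z ∈ e'.source :=
    (e.symm.continuousAt hy).eventually (e'.open_source.mem_nhds hy')
  filter_upwards [this, e.open_target.mem_nhds hy] with z hz hz'
  exact inChart_eq_pullback he he' α hz' hz

theorem contDiffAt_inChart_transfer (he : e ∈ IsManifold.maximalAtlas (𝓡 N) ∞ M)
    (he' : e' ∈ IsManifold.maximalAtlas (𝓡 N) ∞ M) {q : ℕ} {α : Form N M q}
    {y : EuclideanSpace ℝ (Fin N)} (hy : y ∈ e.target) (hy' : e.symm y ∈ e'.source)
    (hα : ContDiffAt ℝ ∞ (inChart e' α) (e' (e.symm y))) : ContDiffAt ℝ ∞ (inChart e α) y := by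
  refine ContDiffAt.congr_of_eventuallyEq ?_ (eventually_inChart_eq_pullback he he' α hy hy')
  have hf := contDiffAt_transition he he' hy hy'
  have h1 : ContDiffAt ℝ ∞ (fun z => inChart e' α ((e' ∘ e.symm) z)) y :=
    ContDiffAt.comp y (g := inChart e' α) hα hf
  exact contDiffAt_form_compContinuousLinearMap h1 (hf.fderiv_right (m := ∞) (by simp))

theorem chartAt_mem (x : M) :
    chartAt (EuclideanSpace ℝ (Fin N)) x ∈ IsManifold.maximalAtlas (𝓡 N) ∞ M :=
  IsManifold.chart_mem_maximalAtlas x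

theorem SmoothForm.contDiffAt {q : ℕ} {α : Form N M q} (hα : SmoothForm α)
    (he : e ∈ IsManifold.maximalAtlas (𝓡 N) ∞ M)
    {y : EuclideanSpace ℝ (Fin N)} (hy : y ∈ e.target) : ContDiffAt ℝ ∞ (inChart e α) y :=
  contDiffAt_inChart_transfer he (chartAt_mem (e.symm y)) hy (mem_chart_source _ _)
    ((hα (e.symm y)).contDiffAt ((chartAt _ (e.symm y)).open_target.mem_nhds
      (mem_chart_target _ _)))

/-- Transition maps carry smoothness from one chart to another, so the chart centres suffice. The
star needs this, because an orientation is controlled only near the centre of each chart. -/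
theorem smoothForm_of_contDiffAt {q : ℕ} {α : Form N M q}
    (hα : ∀ x : M, ContDiffAt ℝ ∞ (inChart (chartAt (EuclideanSpace ℝ (Fin N)) x) α)
      (chartAt (EuclideanSpace ℝ (Fin N)) x x)) : SmoothForm α := fun x y hy =>
  (contDiffAt_inChart_transfer (chartAt_mem x) (chartAt_mem _) hy (mem_chart_source _ _)
    (hα ((chartAt _ x).symm y))).contDiffWithinAt

/-- `rotS` uses another preferred chart at every point. Naturality of the exterior derivative under
the smooth transition map shows that every chart computes the same form. -/
theorem inChart_rotS (he : e ∈ IsManifold.maximalAtlas (𝓡 N) ∞ M) {q : ℕ} {α : Form N M q}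
    (hα : SmoothForm α) {y : EuclideanSpace ℝ (Fin N)} (hy : y ∈ e.target) :
    inChart e (rotS α) y = extDeriv (inChart e α) y := by
  set e' := chartAt (EuclideanSpace ℝ (Fin N)) (e.symm y) with he'_def
  have he' : e' ∈ IsManifold.maximalAtlas (𝓡 N) ∞ M := chartAt_mem _
  have hy' : e.symm y ∈ e'.source := mem_chart_source _ _
  have h1 : inChart e (rotS α) y = (extDeriv (inChart e' α) (e' (e.symm y))).compContinuousLinearMap
      ((mfderiv (𝓡 N) (𝓡 N) e' (e.symm y)).comp (mfderiv (𝓡 N) (𝓡 N) e.symm y)) := rfl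
  have h2 : minSmoothness ℝ 2 ≤ ∞ := by
    simpa using WithTop.coe_le_coe.2 (le_top : (2 : ℕ∞) ≤ ⊤)
  have hd : DifferentiableAt ℝ (inChart e' α) ((e' ∘ e.symm) y) :=
    (hα.contDiffAt he' (e'.map_source hy')).differentiableAt (by simp)
  have h3 := extDeriv_pullback hd (contDiffAt_transition he he' hy hy') h2
  rw [h1, mfderiv_comp_chartDeriv he he' hy hy',
    Filter.EventuallyEq.extDeriv_eq (eventually_inChart_eq_pullback he he' α hy hy'),
    h3]
  rfl

theorem SmoothForm.rotS {q : ℕ} {α : Form N M q} (hα : SmoothForm α) : SmoothForm (rotS α) := by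
  intro x y hy
  have h1 : ContDiffAt ℝ ∞ (extDeriv (inChart (chartAt (EuclideanSpace ℝ (Fin N)) x) α)) y :=
    contDiffAt_extDeriv (hα.contDiffAt (chartAt_mem x) hy)
  refine (h1.congr_of_eventuallyEq ?_).contDiffWithinAt
  filter_upwards [(chartAt (EuclideanSpace ℝ (Fin N)) x).open_target.mem_nhds hy] with z hz
  exact inChart_rotS (chartAt_mem x) hα hz

theorem SmoothForm.add {q : ℕ} {α β : Form N M q} (hα : SmoothForm α) (hβ : SmoothForm β) :
    SmoothForm (α + β) := fun x => (hα x).add (hβ x)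

theorem SmoothForm.const_smul {q : ℕ} {α : Form N M q} (hα : SmoothForm α) (c : ℂ) :
    SmoothForm (c • α) := fun x => (hα x).const_smul c

theorem smoothForm_zero {q : ℕ} : SmoothForm (0 : Form N M q) := fun _ => contDiffOn_const (c := 0)

end Charts
end MixedForms
end

noncomputable section

set_option linter.unusedSectionVars false

namespace MixedForms

/-! ### The metric in charts. -/

theorem gram_sum_smul {V : Type*} [NormedAddCommGroup V] [InnerProductSpace ℝ V] {N : ℕ}
    (v w : Fin N → V) (A : Matrix (Fin N) (Fin N) ℝ) (h : ∀ k, v k = ∑ l, A l k • w l) :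
    Matrix.gram ℝ v = A.transpose * Matrix.gram ℝ w * A := by
  ext k l
  simp only [Matrix.gram_apply, Matrix.mul_apply, Matrix.transpose_apply, h, sum_inner, inner_sum,
    inner_smul_left, inner_smul_right, Finset.sum_mul, Finset.mul_sum, conj_trivial]
  exact Finset.sum_congr rfl fun i _ => Finset.sum_congr rfl fun j _ => by ring

section Metric

variable {N : ℕ} {M : Type*} [TopologicalSpace M] [ChartedSpace (EuclideanSpace ℝ (Fin N)) M]
  [RiemannianBundle (fun x : M => TangentSpace (𝓡 N) x)]

/-- The Gram matrix, at the point `x`, of the images of the standard basis vectors. -/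
def gramAt (x : M) (L : EuclideanSpace ℝ (Fin N) →L[ℝ] EuclideanSpace ℝ (Fin N)) :
    Matrix (Fin N) (Fin N) ℝ :=
  Matrix.gram ℝ (E := TangentSpace (𝓡 N) x) fun k => L (EuclideanSpace.single k 1)

theorem gram_frame_eq (e : OpenPartialHomeomorph M (EuclideanSpace ℝ (Fin N)))
    (y : EuclideanSpace ℝ (Fin N)) :
    Matrix.gram ℝ (frame e y) = gramAt (e.symm y) (chartDeriv e y) := rfl

theorem det_gramAt_comp (x : M)
    (L F : EuclideanSpace ℝ (Fin N) →L[ℝ] EuclideanSpace ℝ (Fin N)) :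
    (gramAt x (L.comp F)).det = F.det ^ 2 * (gramAt x L).det := by
  set b := (EuclideanSpace.basisFun (Fin N) ℝ).toBasis with hb
  set A := LinearMap.toMatrix b b (F : EuclideanSpace ℝ (Fin N) →ₗ[ℝ] EuclideanSpace ℝ (Fin N))
    with hA
  have h1 : ∀ k, F (EuclideanSpace.single k 1) = ∑ l, A l k • EuclideanSpace.single l (1 : ℝ) := by
    intro k
    have := b.sum_repr (F (EuclideanSpace.single k 1))
    rw [← this]
    refine Finset.sum_congr rfl fun l _ => ?_
    simp [hA, LinearMap.toMatrix_apply, hb]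
  have h3 : ∀ k, L.comp F (EuclideanSpace.single k 1) =
      ∑ l, A l k • L (EuclideanSpace.single l (1 : ℝ)) := by
    intro k
    rw [ContinuousLinearMap.comp_apply, h1, map_sum]
    simp
  have h2 : gramAt x (L.comp F) = A.transpose * gramAt x L * A :=
    gram_sum_smul (V := TangentSpace (𝓡 N) x) _ _ A h3
  rw [h2, Matrix.det_mul, Matrix.det_mul, Matrix.det_transpose, hA, LinearMap.det_toMatrix]
  change _ = LinearMap.det _ ^ 2 * _
  ring

variable [IsManifold (𝓡 N) ∞ M]
  {e e' : OpenPartialHomeomorph M (EuclideanSpace ℝ (Fin N))}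

theorem det_gram_frame_pos (he : e ∈ IsManifold.maximalAtlas (𝓡 N) ∞ M)
    {y : EuclideanSpace ℝ (Fin N)} (hy : y ∈ e.target) : 0 < (Matrix.gram ℝ (frame e y)).det :=
  (Matrix.posDef_gram_of_linearIndependent (linearIndependent_frame he hy)).det_pos

/-- The square root of this identity is the transformation law of the volume density, in which the
Jacobian of the transition map appears. -/
theorem det_gram_frame_transition (he : e ∈ IsManifold.maximalAtlas (𝓡 N) ∞ M)
    (he' : e' ∈ IsManifold.maximalAtlas (𝓡 N) ∞ M) {y : EuclideanSpace ℝ (Fin N)}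
    (hy : y ∈ e.target) (hy' : e.symm y ∈ e'.source) :
    (Matrix.gram ℝ (frame e y)).det = (fderiv ℝ (e' ∘ e.symm) y).det ^ 2 *
      (Matrix.gram ℝ (frame e' (e' (e.symm y)))).det := by
  rw [gram_frame_eq, gram_frame_eq, chartDeriv_eq_comp he he' hy hy', det_gramAt_comp,
    e'.left_inv hy']

variable [IsContMDiffRiemannianBundle (𝓡 N) ∞ (EuclideanSpace ℝ (Fin N))
      (fun x : M => TangentSpace (𝓡 N) x)]

/-- A coordinate field is the tangent map of the inverse chart applied to a constant section. -/
theorem contMDiffAt_frame (he : e ∈ IsManifold.maximalAtlas (𝓡 N) ∞ M)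
    {y : EuclideanSpace ℝ (Fin N)} (hy : y ∈ e.target) (i : Fin N) :
    ContMDiffAt (𝓡 N) (𝓡 N).tangent ∞
      (fun z => (⟨e.symm z, frame e z i⟩ : TangentBundle (𝓡 N) M)) y := by
  have h1 : ContMDiffAt (𝓡 N) (𝓡 N).tangent ∞
      (fun z => (⟨z, EuclideanSpace.single i (1 : ℝ)⟩ : TangentBundle (𝓡 N)
        (EuclideanSpace ℝ (Fin N)))) y :=
    contMDiffAt_vectorSpace_iff_contDiffAt.2 contDiffAt_const
  have h2 := (contMDiffOn_symm_of_mem_maximalAtlas he).contMDiffOn_tangentMapWithin (m := ∞)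
    (by simp) e.open_target.uniqueMDiffOn
  have h3 := (h2.contMDiffAt (x := ⟨y, EuclideanSpace.single i (1 : ℝ)⟩) ?_).comp y h1
  · refine h3.congr_of_eventuallyEq ?_
    filter_upwards [e.open_target.mem_nhds hy] with z hz
    simp only [Function.comp, tangentMapWithin, frame]
    rw [mfderivWithin_of_isOpen e.open_target hz]
  · exact (FiberBundle.continuous_proj _ _).continuousAt.preimage_mem_nhds
      (e.open_target.mem_nhds hy)

theorem contDiffAt_gram_frame (he : e ∈ IsManifold.maximalAtlas (𝓡 N) ∞ M)
    {y : EuclideanSpace ℝ (Fin N)} (hy : y ∈ e.target) (i j : Fin N) :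
    ContDiffAt ℝ ∞ (fun z => Matrix.gram ℝ (frame e z) i j) y := by
  rw [← contMDiffAt_iff_contDiffAt]
  exact ContMDiffAt.inner_bundle (contMDiffAt_frame he hy i) (contMDiffAt_frame he hy j)

theorem contDiffAt_det_gram_frame (he : e ∈ IsManifold.maximalAtlas (𝓡 N) ∞ M)
    {y : EuclideanSpace ℝ (Fin N)} (hy : y ∈ e.target) :
    ContDiffAt ℝ ∞ (fun z => (Matrix.gram ℝ (frame e z)).det) y := by
  simp only [Matrix.det_apply]
  have h := contDiffAt_gram_frame he hy
  refine ContDiffAt.sum fun σ _ => ContDiffAt.const_smul _ (contDiffAt_prod fun i _ => ?_)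
  exact h _ _

/-- By Cramer's rule the entries are polynomials in the Gram entries divided by a nonzero
determinant. -/
theorem contDiffAt_inv_gram_frame (he : e ∈ IsManifold.maximalAtlas (𝓡 N) ∞ M)
    {y : EuclideanSpace ℝ (Fin N)} (hy : y ∈ e.target) (i j : Fin N) :
    ContDiffAt ℝ ∞ (fun z => (Matrix.gram ℝ (frame e z))⁻¹ i j) y := by
  have h := contDiffAt_gram_frame he hy
  simp only [Matrix.inv_def, Ring.inverse_eq_inv', Matrix.smul_apply, smul_eq_mul,
    Matrix.adjugate_apply, Matrix.det_apply]
  refine ContDiffAt.mul ?_ ?_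
  · have := (contDiffAt_det_gram_frame he hy).inv (det_gram_frame_pos he hy).ne'
    simp only [Matrix.det_apply] at this
    exact this
  · refine ContDiffAt.sum fun σ _ => ContDiffAt.const_smul _ (contDiffAt_prod fun k _ => ?_)
    simp only [Matrix.updateRow_apply]
    split_ifs
    · exact contDiffAt_const
    · exact h _ _

theorem continuousOn_sqrt_det_gram_frame (he : e ∈ IsManifold.maximalAtlas (𝓡 N) ∞ M) :
    ContinuousOn (fun z => Real.sqrt (Matrix.gram ℝ (frame e z)).det) e.target := fun _ hy =>
  (Real.continuous_sqrt.continuousAt.comp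
    (contDiffAt_det_gram_frame he hy).continuousAt).continuousWithinAt

end Metric
end MixedForms
end

noncomputable section

set_option linter.unusedSectionVars false

namespace MixedForms

/-! ### The Riemannian volume measure. -/

section Volume

theorem measurableSet_target_inter_preimage {X Y : Type*} [TopologicalSpace X]
    [TopologicalSpace Y] [MeasurableSpace X] [BorelSpace X] [MeasurableSpace Y] [BorelSpace Y]
    (e : OpenPartialHomeomorph X Y) {A : Set X} (hA : MeasurableSet A) :
    MeasurableSet (e.target ∩ e.symm ⁻¹' A) := by
  have h : Measurable (e.target.domRestrict e.symm) :=
    (continuousOn_iff_continuous_domRestrict.1 e.continuousOn_symm).measurable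
  have := e.open_target.measurableSet.subtype_image (h hA)
  convert this using 1
  ext y
  simp [Set.domRestrict, and_comm]

variable {N : ℕ} {M : Type*} [TopologicalSpace M] [ChartedSpace (EuclideanSpace ℝ (Fin N)) M]
  [RiemannianBundle (fun x : M => TangentSpace (𝓡 N) x)]

variable [IsManifold (𝓡 N) ∞ M] [T2Space M] [SigmaCompactSpace M]
  [MeasurableSpace M] [BorelSpace M]
  [IsContMDiffRiemannianBundle (𝓡 N) ∞ (EuclideanSpace ℝ (Fin N))
      (fun x : M => TangentSpace (𝓡 N) x)]
  {e e' : OpenPartialHomeomorph M (EuclideanSpace ℝ (Fin N))}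

theorem aemeasurable_symm (e : OpenPartialHomeomorph M (EuclideanSpace ℝ (Fin N)))
    (f : EuclideanSpace ℝ (Fin N) → ENNReal) :
    AEMeasurable e.symm ((volume.restrict e.target).withDensity f) :=
  (e.continuousOn_symm.aemeasurable e.open_target.measurableSet).mono_ac
    (withDensity_absolutelyContinuous _ _)

theorem map_symm_withDensity_apply (e : OpenPartialHomeomorph M (EuclideanSpace ℝ (Fin N)))
    (f : EuclideanSpace ℝ (Fin N) → ENNReal) {A : Set M} (hA : MeasurableSet A) :
    Measure.map e.symm ((volume.restrict e.target).withDensity f) A =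
      ∫⁻ y in e.target ∩ e.symm ⁻¹' A, f y := by
  rw [Measure.map_apply_of_aemeasurable (aemeasurable_symm e f) hA, withDensity_apply',
    Measure.restrict_restrict' e.open_target.measurableSet, inter_comm]

/-- Change of charts in an integral against the Riemannian volume density. -/
theorem lintegral_chart_transition (he : e ∈ IsManifold.maximalAtlas (𝓡 N) ∞ M)
    (he' : e' ∈ IsManifold.maximalAtlas (𝓡 N) ∞ M) {A : Set M} (hA : MeasurableSet A)
    (g : M → ENNReal) :
    ∫⁻ y in e'.target ∩ e'.symm ⁻¹' (A ∩ e.source),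
        g (e'.symm y) * ENNReal.ofReal (Real.sqrt (Matrix.gram ℝ (frame e' y)).det) =
      ∫⁻ y in e.target ∩ e.symm ⁻¹' (A ∩ e'.source),
        g (e.symm y) * ENNReal.ofReal (Real.sqrt (Matrix.gram ℝ (frame e y)).det) := by
  set C := e.target ∩ e.symm ⁻¹' (A ∩ e'.source) with hC
  have himg : e'.target ∩ e'.symm ⁻¹' (A ∩ e.source) = (e' ∘ e.symm) '' C := by
    ext y
    constructor
    · rintro ⟨hy, hyA, hye⟩
      refine ⟨e (e'.symm y), ⟨e.map_source hye, ?_⟩, ?_⟩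
      · simp only [mem_preimage, e.left_inv hye]
        exact ⟨hyA, e'.map_target hy⟩
      · simp [e.left_inv hye, e'.right_inv hy]
    · rintro ⟨z, ⟨hz, hzA, hze⟩, rfl⟩
      refine ⟨e'.map_source hze, ?_⟩
      simp only [mem_preimage, Function.comp, e'.left_inv hze]
      exact ⟨hzA, e.map_target hz⟩
  have hCm : MeasurableSet C :=
    measurableSet_target_inter_preimage e (hA.inter e'.open_source.measurableSet)
  rw [himg, lintegral_image_eq_lintegral_abs_det_fderiv_mul volume hCm
    (f' := fun z => fderiv ℝ (e' ∘ e.symm) z)]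
  · refine setLIntegral_congr_fun hCm fun z hz => ?_
    obtain ⟨hz, -, hze⟩ := hz
    have hs : e'.symm ((e' ∘ e.symm) z) = e.symm z := e'.left_inv hze
    have hg := det_gram_frame_transition he he' hz hze
    simp only [hs]
    rw [mul_left_comm, ← ENNReal.ofReal_mul (abs_nonneg _), hg,
      Real.sqrt_mul (sq_nonneg _), Real.sqrt_sq_eq_abs]
    rfl
  · intro z hz
    exact ((contDiffAt_transition he he' hz.1 hz.2.2).differentiableAt
      (by simp)).hasFDerivAt.hasFDerivWithinAt
  · rintro z ⟨hz, -, hze⟩ w ⟨hw, -, hwe⟩ hzw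
    exact e.symm.injOn hz hw (e'.injOn hze hwe hzw)

/-- `vol` is a sum over all points of `M`. Local finiteness and σ-compactness leave countably many
nonzero terms, as needed to exchange sum and integral. -/
theorem countable_support_nonempty {ι : Type*} {s : Set M}
    (ξ : SmoothPartitionOfUnity ι (𝓡 N) M s) : {i | (Function.support (ξ i)).Nonempty}.Countable := by
  have h : LocallyFinite fun i : {i | (Function.support (ξ i)).Nonempty} =>
      Function.support (ξ i) := ξ.locallyFinite.comp_injective Subtype.val_injective
  have := h.countable_univ fun i => i.2
  exact Set.countable_coe_iff.1 (Set.countable_univ_iff.1 this)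

/-- In a chart, the Riemannian volume is `√(det g) dy`. -/
theorem vol_restrict_source (he : e ∈ IsManifold.maximalAtlas (𝓡 N) ∞ M) :
    (vol N M).restrict e.source = Measure.map e.symm ((volume.restrict e.target).withDensity
      fun y => ENNReal.ofReal (Real.sqrt (Matrix.gram ℝ (frame e y)).det)) := by
  ext A hA
  have hAe := hA.inter e.open_source.measurableSet
  rw [Measure.restrict_apply hA, map_symm_withDensity_apply e _ hA]
  set ξ := Classical.choose
      (SmoothPartitionOfUnity.exists_isSubordinate_chartAt_source (𝓡 N) M) with hξ
  have hsub := Classical.choose_spec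
      (SmoothPartitionOfUnity.exists_isSubordinate_chartAt_source (𝓡 N) M)
  rw [← hξ] at hsub
  -- Each summand is transported from its own chart to `e`. The domain can be enlarged from the
  -- overlap to all of `e.target`, because `ξ i` vanishes outside the source of the `i`-th chart;
  -- afterwards the `ξ i` add up to one.
  have hvol : vol N M (A ∩ e.source) = ∑' i : M, ∫⁻ y in e.target ∩ e.symm ⁻¹' A,
      ENNReal.ofReal (ξ i (e.symm y)) *
        ENNReal.ofReal (Real.sqrt (Matrix.gram ℝ (frame e y)).det) := by
    rw [vol, Measure.sum_apply _ hAe]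
    refine tsum_congr fun i => ?_
    rw [map_symm_withDensity_apply _ _ hAe]
    refine Eq.trans (lintegral_congr fun y => ENNReal.ofReal_mul (ξ.nonneg i _)) ?_
    rw [lintegral_chart_transition he (chartAt_mem i) hA (fun x => ENNReal.ofReal (ξ i x)),
      ← lintegral_indicator (measurableSet_target_inter_preimage e
        (hA.inter (chartAt _ i).open_source.measurableSet)),
      ← lintegral_indicator (measurableSet_target_inter_preimage e hA)]
    refine lintegral_congr fun y => ?_
    by_cases hy : y ∈ e.target ∩ e.symm ⁻¹' A
    · by_cases hyi : e.symm y ∈ (chartAt (EuclideanSpace ℝ (Fin N)) i).source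
      · have hmem : y ∈ e.target ∩ e.symm ⁻¹'
            (A ∩ (chartAt (EuclideanSpace ℝ (Fin N)) i).source) := ⟨hy.1, hy.2, hyi⟩
        rw [indicator_of_mem hy, indicator_of_mem hmem]
      · have h0 : ξ i (e.symm y) = 0 := by
          by_contra h0
          exact hyi (hsub i (subset_tsupport _ h0))
        rw [indicator_of_mem hy, indicator_of_notMem fun h => hyi h.2.2, h0]
        simp
    · rw [indicator_of_notMem hy, indicator_of_notMem fun h => hy ⟨h.1, h.2.1⟩]
  rw [hvol]
  have hcount := countable_support_nonempty ξ
  set I : Set M := {i | (Function.support (ξ i)).Nonempty}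
  have hI : ∀ i ∉ I, ∀ x, ξ i x = 0 := fun i hi x => by
    by_contra h0
    exact hi ⟨x, h0⟩
  have : Countable I := hcount.to_subtype
  have hmeasI : MeasurableSet (e.target ∩ e.symm ⁻¹' A) := measurableSet_target_inter_preimage e hA
  rw [← tsum_subtype_eq_of_support_subset (s := I), ← lintegral_tsum]
  · refine setLIntegral_congr_fun hmeasI fun y hy => ?_
    rw [ENNReal.tsum_mul_right]
    have h1 : ∑' i : I, ENNReal.ofReal (ξ i (e.symm y)) = 1 := by
      rw [tsum_subtype_eq_of_support_subset (s := I) (f := fun i => ENNReal.ofReal (ξ i (e.symm y)))]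
      · have hfin : (Function.support fun i => ξ i (e.symm y)).Finite := ξ.locallyFinite.point_finite _
        rw [tsum_eq_sum (s := hfin.toFinset), ← ENNReal.ofReal_sum_of_nonneg fun i _ => ξ.nonneg i _,
          ← finsum_eq_sum _ hfin, ξ.sum_eq_one (mem_univ _), ENNReal.ofReal_one]
        intro i hi
        have : ξ i (e.symm y) = 0 := by simpa using hi
        simp [this]
      · intro i hi
        by_contra hiI
        exact hi (by simp [hI i hiI])
    rw [h1, one_mul]
  · intro i
    have h1 : AEMeasurable (fun y => ξ i (e.symm y)) (volume.restrict (e.target ∩ e.symm ⁻¹' A)) :=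
      (((ξ i).2.continuous.comp_continuousOn e.continuousOn_symm).aemeasurable
        e.open_target.measurableSet).mono_measure (Measure.restrict_mono inter_subset_left le_rfl)
    have h2 : AEMeasurable (fun y => Real.sqrt (Matrix.gram ℝ (frame e y)).det)
        (volume.restrict (e.target ∩ e.symm ⁻¹' A)) :=
      ((continuousOn_sqrt_det_gram_frame he).aemeasurable
        e.open_target.measurableSet).mono_measure (Measure.restrict_mono inter_subset_left le_rfl)
    exact h1.ennreal_ofReal.mul h2.ennreal_ofReal
  · intro i hi
    by_contra hiI
    exact hi (by simp [hI i hiI])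

theorem integral_source (he : e ∈ IsManifold.maximalAtlas (𝓡 N) ∞ M) {f : M → ℂ}
    (hf : AEStronglyMeasurable f ((vol N M).restrict e.source)) :
    ∫ x in e.source, f x ∂(vol N M) =
      ∫ y in e.target, (Real.sqrt (Matrix.gram ℝ (frame e y)).det : ℂ) * f (e.symm y) := by
  rw [vol_restrict_source he] at hf ⊢
  rw [integral_map (aemeasurable_symm e _) hf, integral_withDensity_eq_integral_toReal_smul₀
    (((continuousOn_sqrt_det_gram_frame he).aemeasurable
      e.open_target.measurableSet).ennreal_ofReal) (by simp)]
  refine integral_congr_ae (Eventually.of_forall fun y => ?_)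
  simp [ENNReal.toReal_ofReal (Real.sqrt_nonneg _)]

theorem aemeasurable_chart (e : OpenPartialHomeomorph M (EuclideanSpace ℝ (Fin N))) :
    AEMeasurable e ((vol N M).restrict e.source) :=
  e.continuousOn.aemeasurable e.open_source.measurableSet

/-- The continuous density `√(det g)` is bounded on a small coordinate ball. -/
instance isLocallyFiniteMeasure_vol : IsLocallyFiniteMeasure (vol N M) where
  finiteAtNhds x := by
    set e := chartAt (EuclideanSpace ℝ (Fin N)) x with he_def
    have he : e ∈ IsManifold.maximalAtlas (𝓡 N) ∞ M := chartAt_mem x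
    have hx : e x ∈ e.target := mem_chart_target _ _
    have hc : ContinuousAt (fun z => Real.sqrt (Matrix.gram ℝ (frame e z)).det) (e x) :=
      (continuousOn_sqrt_det_gram_frame he).continuousAt (e.open_target.mem_nhds hx)
    set C := Real.sqrt (Matrix.gram ℝ (frame e (e x))).det + 1 with hC
    have h1 : ∀ᶠ z in 𝓝 (e x), Real.sqrt (Matrix.gram ℝ (frame e z)).det < C :=
      hc.eventually_lt continuousAt_const (by simp [hC])
    obtain ⟨r, hr, hball⟩ := Metric.eventually_nhds_iff_ball.1 (h1.and (e.open_target.mem_nhds hx))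
    have hopen : IsOpen (e.source ∩ e ⁻¹' Metric.ball (e x) r) :=
      e.isOpen_inter_preimage Metric.isOpen_ball
    refine ⟨e.source ∩ e ⁻¹' Metric.ball (e x) r, hopen.mem_nhds
      ⟨mem_chart_source _ _, by simpa using hr⟩, ?_⟩
    have h2 : vol N M (e.source ∩ e ⁻¹' Metric.ball (e x) r) =
        (vol N M).restrict e.source (e.source ∩ e ⁻¹' Metric.ball (e x) r) := by
      rw [Measure.restrict_apply hopen.measurableSet, inter_right_comm, inter_self]
    rw [h2, vol_restrict_source he, map_symm_withDensity_apply _ _ hopen.measurableSet]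
    have hsub : e.target ∩ e.symm ⁻¹' (e.source ∩ e ⁻¹' Metric.ball (e x) r) ⊆
        Metric.ball (e x) r := by
      rintro y ⟨hy, -, hyb⟩
      simpa [e.right_inv hy] using hyb
    refine (setLIntegral_mono' (g := fun _ => ENNReal.ofReal C)
      (measurableSet_target_inter_preimage e hopen.measurableSet) fun y hy =>
        ENNReal.ofReal_le_ofReal (hball y (hsub hy)).1.le).trans_lt ?_
    rw [setLIntegral_const]
    exact ENNReal.mul_lt_top ENNReal.ofReal_lt_top
      ((measure_mono hsub).trans_lt measure_ball_lt_top)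

end Volume
end MixedForms
end

noncomputable section

set_option linter.unusedSectionVars false

namespace MixedForms

/-! ### Smoothness of the star, the coderivative and the inner product. -/

section Smooth

variable {N : ℕ} {M : Type*} [TopologicalSpace M] [ChartedSpace (EuclideanSpace ℝ (Fin N)) M]
  [RiemannianBundle (fun x : M => TangentSpace (𝓡 N) x)] [IsManifold (𝓡 N) ∞ M]
  {e : OpenPartialHomeomorph M (EuclideanSpace ℝ (Fin N))}

theorem formInner_eq_inChart (he : e ∈ IsManifold.maximalAtlas (𝓡 N) ∞ M) {q : ℕ}
    (α η : Form N M q) {y : EuclideanSpace ℝ (Fin N)} (hy : y ∈ e.target) :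
    formInner N (α (e.symm y)) (η (e.symm y)) = (q.factorial : ℂ)⁻¹ *
      ∑ i : Fin q → Fin N, ∑ j : Fin q → Fin N,
        ((∏ r, (Matrix.gram ℝ (frame e y))⁻¹ (i r) (j r) : ℝ) : ℂ) *
          (inChart e α y (fun r => EuclideanSpace.single (i r) 1) *
            (starRingEnd ℂ) (inChart e η y (fun r => EuclideanSpace.single (j r) 1))) :=
  formInner_eq_frame (frame e y) (linearIndependent_frame he hy) _ _

theorem inChart_starS (o : ManifoldOrientation N M)
    (he : e ∈ IsManifold.maximalAtlas (𝓡 N) ∞ M) {q p : ℕ} (h : p + q = N)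
    (α : Form N M q) {y : EuclideanSpace ℝ (Fin N)} (hy : y ∈ e.target) :
    inChart e (starS o q p α) y = ∑ i : Fin q → Fin N, ∑ j : Fin q → Fin N,
      ((q.factorial : ℂ)⁻¹ * ((∏ r, (Matrix.gram ℝ (frame e y))⁻¹ (i r) (j r) : ℝ) : ℂ) *
        ((o.orient (e.symm y)).volumeForm (frame e y) : ℂ) *
          inChart e α y (fun r => EuclideanSpace.single (i r) 1)) • stdContract N q p h j :=
  hodgeStar_compContinuousLinearMap (o.orient (e.symm y)) h
    (mfderiv (𝓡 N) (𝓡 N) e.symm y) (frame e y) (fun _ => rfl) (linearIndependent_frame he hy) _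

/-- The square of `vol` on the frame is the Gram determinant, and an orientation fixes its sign near
the chart centre. -/
theorem ManifoldOrientation.eventually_eq_sqrt (o : ManifoldOrientation N M) (x : M) :
    ∃ s : ℝ, (s = 1 ∨ s = -1) ∧
      ∀ᶠ y in 𝓝 (chartAt (EuclideanSpace ℝ (Fin N)) x x),
        (o.orient ((chartAt (EuclideanSpace ℝ (Fin N)) x).symm y)).volumeForm
          (frame (chartAt (EuclideanSpace ℝ (Fin N)) x) y) = s *
            Real.sqrt (Matrix.gram ℝ (frame (chartAt (EuclideanSpace ℝ (Fin N)) x) y)).det := by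
  rcases o.locally_const x with h | h
  · refine ⟨1, Or.inl rfl, ?_⟩
    filter_upwards [h] with y hy
    rw [← sq_volumeForm_eq_det_gram (o.orient ((chartAt _ x).symm y)), Real.sqrt_sq hy.le, one_mul]
  · refine ⟨-1, Or.inr rfl, ?_⟩
    filter_upwards [h] with y hy
    rw [← sq_volumeForm_eq_det_gram (o.orient ((chartAt _ x).symm y)), Real.sqrt_sq_eq_abs,
      abs_of_neg hy]
    ring

theorem contDiffAt_inChart_apply {q : ℕ} {α : Form N M q} (hα : SmoothForm α)
    (he : e ∈ IsManifold.maximalAtlas (𝓡 N) ∞ M) {y : EuclideanSpace ℝ (Fin N)}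
    (hy : y ∈ e.target) (u : Fin q → EuclideanSpace ℝ (Fin N)) :
    ContDiffAt ℝ ∞ (fun z => inChart e α z u) y :=
  ContDiffAt.comp y (g := ContinuousAlternatingMap.apply ℝ (EuclideanSpace ℝ (Fin N)) ℂ u)
    (ContinuousLinearMap.contDiff _).contDiffAt (hα.contDiffAt he hy)

variable [IsContMDiffRiemannianBundle (𝓡 N) ∞ (EuclideanSpace ℝ (Fin N))
      (fun x : M => TangentSpace (𝓡 N) x)]

theorem contDiffAt_prod_inv_gram (he : e ∈ IsManifold.maximalAtlas (𝓡 N) ∞ M) {q : ℕ}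
    {y : EuclideanSpace ℝ (Fin N)} (hy : y ∈ e.target) (i j : Fin q → Fin N) :
    ContDiffAt ℝ ∞ (fun z =>
      ((∏ r, (Matrix.gram ℝ (frame e z))⁻¹ (i r) (j r) : ℝ) : ℂ)) y := by
  have h : ContDiffAt ℝ ∞ (fun z => ∏ r, (Matrix.gram ℝ (frame e z))⁻¹ (i r) (j r)) y :=
    contDiffAt_prod fun r _ => contDiffAt_inv_gram_frame he hy (i r) (j r)
  exact ContDiffAt.comp y (g := Complex.ofRealCLM) Complex.ofRealCLM.contDiff.contDiffAt h

theorem SmoothForm.starS (o : ManifoldOrientation N M) {q : ℕ} (p : ℕ) {α : Form N M q}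
    (hα : SmoothForm α) : SmoothForm (starS o q p α) := by
  by_cases h : p + q = N
  · refine smoothForm_of_contDiffAt fun x => ?_
    set e := chartAt (EuclideanSpace ℝ (Fin N)) x
    have he : e ∈ IsManifold.maximalAtlas (𝓡 N) ∞ M := chartAt_mem x
    have hx : e x ∈ e.target := mem_chart_target _ _
    obtain ⟨s, -, hs⟩ := o.eventually_eq_sqrt x
    have hsm : ContDiffAt ℝ ∞ (fun y => ∑ i : Fin q → Fin N, ∑ j : Fin q → Fin N,
      ((q.factorial : ℂ)⁻¹ * ((∏ r, (Matrix.gram ℝ (frame e y))⁻¹ (i r) (j r) : ℝ) : ℂ) *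
        ((s * Real.sqrt (Matrix.gram ℝ (frame e y)).det : ℝ) : ℂ) *
          inChart e α y (fun r => EuclideanSpace.single (i r) 1)) • stdContract N q p h j) (e x) := by
      refine ContDiffAt.sum fun i _ => ContDiffAt.sum fun j _ => ?_
      have h1 : ContDiffAt ℝ ∞ (fun y => ((s * Real.sqrt (Matrix.gram ℝ (frame e y)).det : ℝ) : ℂ))
          (e x) := Complex.ofRealCLM.contDiff.contDiffAt.comp (e x)
        (contDiffAt_const.mul ((contDiffAt_det_gram_frame he hx).sqrt
          (det_gram_frame_pos he hx).ne'))
      exact (((contDiffAt_const.mul (contDiffAt_prod_inv_gram he hx i j)).mul h1).mul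
        (contDiffAt_inChart_apply hα he hx _)).smul contDiffAt_const
    refine hsm.congr_of_eventuallyEq ?_
    filter_upwards [hs, e.open_target.mem_nhds hx] with y hy hye
    rw [inChart_starS o he h α hye, hy]
  · have : MixedForms.starS o q p α = 0 := by
      funext x
      simp [MixedForms.starS, hodgeStar, h]
    rw [this]
    exact smoothForm_zero

theorem SmoothForm.divS (o : ManifoldOrientation N M) {q : ℕ} {α : Form N M (q + 1)}
    (hα : SmoothForm α) : SmoothForm (divS o α) :=
  (SmoothForm.starS o _ (SmoothForm.rotS (SmoothForm.starS o _ hα))).const_smul _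

theorem continuous_formInner {q : ℕ} {α η : Form N M q} (hα : SmoothForm α) (hη : SmoothForm η) :
    Continuous (fun x => formInner N (α x) (η x)) := by
  refine continuous_iff_continuousAt.2 fun x => ?_
  set e := chartAt (EuclideanSpace ℝ (Fin N)) x
  have he : e ∈ IsManifold.maximalAtlas (𝓡 N) ∞ M := chartAt_mem x
  have hx : e x ∈ e.target := mem_chart_target _ _
  have h1 : ContinuousAt (fun y => formInner N (α (e.symm y)) (η (e.symm y))) (e x) := by
    have h2 : ContDiffAt ℝ ∞ (fun y => (q.factorial : ℂ)⁻¹ *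
      ∑ i : Fin q → Fin N, ∑ j : Fin q → Fin N,
        ((∏ r, (Matrix.gram ℝ (frame e y))⁻¹ (i r) (j r) : ℝ) : ℂ) *
          (inChart e α y (fun r => EuclideanSpace.single (i r) 1) *
            (starRingEnd ℂ) (inChart e η y (fun r => EuclideanSpace.single (j r) 1)))) (e x) := by
      refine contDiffAt_const.mul (ContDiffAt.sum fun i _ => ContDiffAt.sum fun j _ => ?_)
      exact (contDiffAt_prod_inv_gram he hx i j).mul ((contDiffAt_inChart_apply hα he hx _).mul
        (Complex.conjCLE.contDiff.contDiffAt.comp (e x) (contDiffAt_inChart_apply hη he hx _)))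
    refine h2.continuousAt.congr ?_
    filter_upwards [e.open_target.mem_nhds hx] with y hy
    rw [formInner_eq_inChart he α η hy]
  have h3 := ContinuousAt.comp (f := e) (x := x) h1 (e.continuousAt (mem_chart_source _ _))
  refine h3.congr ?_
  filter_upwards [e.open_source.mem_nhds (mem_chart_source _ x)] with z hz
  simp only [Function.comp]
  rw [e.left_inv hz]

end Smooth
end MixedForms
end

noncomputable section

set_option linter.unusedSectionVars false

namespace MixedForms

/-! ### Measurability and square integrability of forms. -/

section L2

variable {N : ℕ} {M : Type*} [TopologicalSpace M] [ChartedSpace (EuclideanSpace ℝ (Fin N)) M]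
  [RiemannianBundle (fun x : M => TangentSpace (𝓡 N) x)] [IsManifold (𝓡 N) ∞ M]
  [T2Space M] [SigmaCompactSpace M] [MeasurableSpace M] [BorelSpace M]
  [IsContMDiffRiemannianBundle (𝓡 N) ∞ (EuclideanSpace ℝ (Fin N))
      (fun x : M => TangentSpace (𝓡 N) x)]
  {e : OpenPartialHomeomorph M (EuclideanSpace ℝ (Fin N))}

theorem aemeasurable_sqrt_det_gram (he : e ∈ IsManifold.maximalAtlas (𝓡 N) ∞ M) :
    AEMeasurable (fun y => ENNReal.ofReal (Real.sqrt (Matrix.gram ℝ (frame e y)).det))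
      (volume.restrict e.target) :=
  ((continuousOn_sqrt_det_gram_frame he).aemeasurable e.open_target.measurableSet).ennreal_ofReal

theorem vol_inter_source (he : e ∈ IsManifold.maximalAtlas (𝓡 N) ∞ M) {A : Set M}
    (hA : MeasurableSet A) : vol N M (A ∩ e.source) = ∫⁻ y in e.target ∩ e.symm ⁻¹' A,
      ENNReal.ofReal (Real.sqrt (Matrix.gram ℝ (frame e y)).det) := by
  rw [← Measure.restrict_apply hA, vol_restrict_source he, map_symm_withDensity_apply _ _ hA]

/-- The density is strictly positive. This links the measurability in `IsL2`, which refers to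
Lebesgue measure in charts, with integrals against `vol`. -/
theorem vol_inter_source_eq_zero_iff (he : e ∈ IsManifold.maximalAtlas (𝓡 N) ∞ M) {A : Set M}
    (hA : MeasurableSet A) :
    vol N M (A ∩ e.source) = 0 ↔ volume (e.target ∩ e.symm ⁻¹' A) = 0 := by
  rw [vol_inter_source he hA, lintegral_eq_zero_iff' ((aemeasurable_sqrt_det_gram he).mono_measure
    (Measure.restrict_mono inter_subset_left le_rfl))]
  have hm := measurableSet_target_inter_preimage e hA
  constructor
  · intro h
    have h2 : ∀ᵐ y ∂(volume.restrict (e.target ∩ e.symm ⁻¹' A)), False := by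
      filter_upwards [h, ae_restrict_mem hm] with y hy hye
      have := Real.sqrt_pos.2 (det_gram_frame_pos he hye.1)
      simp only [Pi.zero_apply, ENNReal.ofReal_eq_zero] at hy
      linarith
    rw [eventually_false_iff_eq_bot, ae_eq_bot, Measure.restrict_eq_zero] at h2
    exact h2
  · intro h
    rw [Measure.restrict_eq_zero.2 h, ae_zero]
    exact eventually_bot

theorem ae_chart_of_ae_vol (he : e ∈ IsManifold.maximalAtlas (𝓡 N) ∞ M) {S : Set M}
    (hS : MeasurableSet S) {p : M → Prop} (hp : ∀ᵐ x ∂((vol N M).restrict S), p x) :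
    ∀ᵐ y ∂(volume.restrict (e.target ∩ e.symm ⁻¹' S)), p (e.symm y) := by
  rw [ae_restrict_iff' hS] at hp
  rw [ae_restrict_iff' (measurableSet_target_inter_preimage e hS)]
  obtain ⟨B, hB, hBm, hB0⟩ := exists_measurable_superset_of_null (ae_iff.1 hp)
  have h1 : volume (e.target ∩ e.symm ⁻¹' B) = 0 :=
    (vol_inter_source_eq_zero_iff he hBm).1 (measure_mono_null inter_subset_left hB0)
  refine measure_mono_null (fun y hy => ?_) h1
  simp only [mem_compl_iff, mem_ofPred_eq, Classical.not_imp] at hy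
  exact ⟨hy.1.1, hB (by simpa using ⟨hy.1.2, hy.2⟩)⟩

theorem map_restrict_absolutelyContinuous (he : e ∈ IsManifold.maximalAtlas (𝓡 N) ∞ M) {S : Set M}
    (hS : MeasurableSet S) : Measure.map e ((vol N M).restrict (S ∩ e.source)) ≪
      volume.restrict (e.target ∩ e.symm ⁻¹' S) := by
  have hSe := hS.inter e.open_source.measurableSet
  refine Measure.AbsolutelyContinuous.mk fun A hA h0 => ?_
  have hae : AEMeasurable e ((vol N M).restrict (S ∩ e.source)) :=
    (aemeasurable_chart e).mono_measure (Measure.restrict_mono inter_subset_right le_rfl)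
  rw [Measure.map_apply_of_aemeasurable hae hA]
  have hB : MeasurableSet (e.source ∩ e ⁻¹' A) := measurableSet_target_inter_preimage e.symm hA
  rw [Measure.restrict_apply₀' hSe.nullMeasurableSet]
  have h1 : vol N M ((e.source ∩ e ⁻¹' A ∩ S) ∩ e.source) = 0 := by
    rw [vol_inter_source_eq_zero_iff he (hB.inter hS)]
    rw [Measure.restrict_apply hA] at h0
    refine measure_mono_null ?_ h0
    rintro y ⟨hy, ⟨-, hyA⟩, hyS⟩
    refine ⟨?_, hy, hyS⟩
    simpa [e.right_inv hy] using hyA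
  refine measure_mono_null ?_ h1
  rintro x ⟨hxA, hxS, hx⟩
  exact ⟨⟨⟨hx, hxA⟩, hxS⟩, hx⟩

/-- By σ-compactness countably many charts cover `M`, and a chart takes `vol` to a measure
absolutely continuous with respect to Lebesgue measure. -/
theorem aestronglyMeasurable_of_charts {F : Type*} [TopologicalSpace F]
    [TopologicalSpace.PseudoMetrizableSpace F] {S : Set M}
    (hS : MeasurableSet S) {f : M → F} (hf : ∀ x : M,
      AEStronglyMeasurable (fun y => f ((chartAt (EuclideanSpace ℝ (Fin N)) x).symm y))
        (volume.restrict ((chartAt (EuclideanSpace ℝ (Fin N)) x).target ∩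
          (chartAt (EuclideanSpace ℝ (Fin N)) x).symm ⁻¹' S))) :
    AEStronglyMeasurable f ((vol N M).restrict S) := by
  obtain ⟨s, hs, hU⟩ := countable_cover_nhds_of_sigmaCompact fun x : M =>
    (chartAt (EuclideanSpace ℝ (Fin N)) x).open_source.mem_nhds (mem_chart_source _ x)
  have : Countable s := hs.to_subtype
  have hcov : S = ⋃ x : s, S ∩ (chartAt (EuclideanSpace ℝ (Fin N)) (x : M)).source := by
    rw [← inter_iUnion, iUnion_coe_set, hU, inter_univ]
  rw [hcov, aestronglyMeasurable_iUnion_iff]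
  intro x
  set e := chartAt (EuclideanSpace ℝ (Fin N)) (x : M)
  have he : e ∈ IsManifold.maximalAtlas (𝓡 N) ∞ M := chartAt_mem _
  have hae : AEMeasurable e ((vol N M).restrict (S ∩ e.source)) :=
    (aemeasurable_chart e).mono_measure (Measure.restrict_mono inter_subset_right le_rfl)
  have h1 := ((hf x).mono_ac (map_restrict_absolutelyContinuous he hS)).comp_aemeasurable hae
  refine h1.congr ?_
  filter_upwards [ae_restrict_mem (hS.inter e.open_source.measurableSet)] with z hz
  simp only [Function.comp]
  exact congrArg f (e.left_inv hz.2)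

/-- The components of `α` in every chart are measurable on `S`. -/
def MeasurableForm (S : Set M) {q : ℕ} (α : Form N M q) : Prop :=
  ∀ x : M, AEStronglyMeasurable (inChart (chartAt (EuclideanSpace ℝ (Fin N)) x) α)
    (volume.restrict ((chartAt (EuclideanSpace ℝ (Fin N)) x).target ∩
      (chartAt (EuclideanSpace ℝ (Fin N)) x).symm ⁻¹' S))

theorem MeasurableForm.add {S : Set M} {q : ℕ} {α β : Form N M q} (hα : MeasurableForm S α)
    (hβ : MeasurableForm S β) : MeasurableForm S (α + β) := fun x => (hα x).add (hβ x)

theorem MeasurableForm.const_smul {S : Set M} {q : ℕ} {α : Form N M q} (hα : MeasurableForm S α)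
    (c : ℂ) : MeasurableForm S (c • α) := fun x => (hα x).const_smul c

theorem MeasurableForm.formInner {S : Set M} (hS : MeasurableSet S) {q : ℕ} {α η : Form N M q}
    (hα : MeasurableForm S α) (hη : MeasurableForm S η) :
    AEStronglyMeasurable (fun x => formInner N (α x) (η x)) ((vol N M).restrict S) := by
  refine aestronglyMeasurable_of_charts hS fun x => ?_
  set e := chartAt (EuclideanSpace ℝ (Fin N)) x
  have he : e ∈ IsManifold.maximalAtlas (𝓡 N) ∞ M := chartAt_mem _
  have happ : ∀ {γ : Form N M q}, MeasurableForm S γ → ∀ u : Fin q → EuclideanSpace ℝ (Fin N),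
      AEStronglyMeasurable (fun y => inChart e γ y u) (volume.restrict (e.target ∩ e.symm ⁻¹' S)) :=
    fun hγ u => (ContinuousAlternatingMap.apply ℝ (EuclideanSpace ℝ (Fin N)) ℂ
      u).continuous.comp_aestronglyMeasurable (hγ x)
  have hg : ∀ i j : Fin q → Fin N, AEStronglyMeasurable (fun y =>
      ((∏ r, (Matrix.gram ℝ (frame e y))⁻¹ (i r) (j r) : ℝ) : ℂ))
      (volume.restrict (e.target ∩ e.symm ⁻¹' S)) := fun i j =>
    (ContinuousOn.aestronglyMeasurable (fun y hy =>
      (contDiffAt_prod_inv_gram he hy i j).continuousAt.continuousWithinAt)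
      e.open_target.measurableSet).mono_measure (Measure.restrict_mono inter_subset_left le_rfl)
  have h1 : AEStronglyMeasurable (fun y => (q.factorial : ℂ)⁻¹ *
      ∑ i : Fin q → Fin N, ∑ j : Fin q → Fin N,
        ((∏ r, (Matrix.gram ℝ (frame e y))⁻¹ (i r) (j r) : ℝ) : ℂ) *
          (inChart e α y (fun r => EuclideanSpace.single (i r) 1) *
            (starRingEnd ℂ) (inChart e η y (fun r => EuclideanSpace.single (j r) 1))))
      (volume.restrict (e.target ∩ e.symm ⁻¹' S)) := by
    refine aestronglyMeasurable_const.mul (Finset.aestronglyMeasurable_fun_sum _ fun i _ =>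
      Finset.aestronglyMeasurable_fun_sum _ fun j _ => ?_)
    exact (hg i j).mul ((happ hα _).mul
      (Complex.continuous_conj.comp_aestronglyMeasurable (happ hη _)))
  refine h1.congr ?_
  filter_upwards [ae_restrict_mem (measurableSet_target_inter_preimage e hS)] with y hy
  rw [formInner_eq_inChart he α η hy.1]

theorem IsL2.measurableForm {S : Set M} {q : ℕ} {α : Form N M q} (h : IsL2 S α) :
    MeasurableForm S α := h.measurable

theorem integrableOn_re_formInner_iff {S : Set M} (hS : MeasurableSet S) {q : ℕ} {α : Form N M q}
    (hα : MeasurableForm S α) :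
    IntegrableOn (fun x => (formInner N (α x) (α x)).re) S (vol N M) ↔
      ∫⁻ x in S, ENNReal.ofReal (formInner N (α x) (α x)).re ∂(vol N M) < ⊤ := by
  have hm : AEStronglyMeasurable (fun x => (formInner N (α x) (α x)).re) ((vol N M).restrict S) :=
    Complex.continuous_re.comp_aestronglyMeasurable (hα.formInner hS hα)
  rw [IntegrableOn, Integrable, and_iff_right hm,
    hasFiniteIntegral_iff_ofReal (Eventually.of_forall fun x => formInner_self_nonneg _)]

theorem IsL2.integrable_formInner {S : Set M} (hS : MeasurableSet S) {q : ℕ} {α η : Form N M q}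
    (hα : IsL2 S α) (hη : IsL2 S η) :
    IntegrableOn (fun x => MixedForms.formInner N (α x) (η x)) S (vol N M) :=
  Integrable.mono' (hα.integrable.add hη.integrable)
    (hα.measurableForm.formInner hS hη.measurableForm)
    (Eventually.of_forall fun x => norm_formInner_le (α x) (η x))

theorem IsL2.add {S : Set M} (hS : MeasurableSet S) {q : ℕ} {α η : Form N M q}
    (hα : IsL2 S α) (hη : IsL2 S η) : IsL2 S (α + η) := by
  refine ⟨hα.measurableForm.add hη.measurableForm, ?_⟩
  have h : (fun x => (MixedForms.formInner N ((α + η) x) ((α + η) x)).re) = fun x =>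
      (MixedForms.formInner N (α x) (α x) + MixedForms.formInner N (α x) (η x) +
        (MixedForms.formInner N (η x) (α x) + MixedForms.formInner N (η x) (η x))).re := by
    funext x
    rw [Pi.add_apply, formInner_add_left, ← formInner_conj_symm (α x + η x) (α x),
      ← formInner_conj_symm (α x + η x) (η x), formInner_add_left, formInner_add_left, map_add,
      map_add]
    simp only [formInner_conj_symm]
  rw [h]
  exact (((hα.integrable_formInner hS hα).add (hα.integrable_formInner hS hη)).add
    ((hη.integrable_formInner hS hα).add (hη.integrable_formInner hS hη))).re

theorem IsL2.const_smul {S : Set M} {q : ℕ} {α : Form N M q}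
    (hα : IsL2 S α) (c : ℂ) : IsL2 S (c • α) := by
  refine ⟨hα.measurableForm.const_smul c, ?_⟩
  have h : (fun x => (MixedForms.formInner N ((c • α) x) ((c • α) x)).re) = fun x =>
      Complex.normSq c * (MixedForms.formInner N (α x) (α x)).re := by
    funext x
    rw [Pi.smul_apply, formInner_smul_left, formInner_smul_right, ← mul_assoc, Complex.mul_conj,
      Complex.re_ofReal_mul]
  rw [h]
  exact hα.integrable.const_mul _

theorem isL2_zero (S : Set M) {q : ℕ} : IsL2 S (0 : Form N M q) where
  measurable _ := aestronglyMeasurable_const (b := 0)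
  integrable := by
    have : (fun x : M => (MixedForms.formInner N ((0 : Form N M q) x) ((0 : Form N M q) x)).re) =
        fun _ => 0 := by
      funext x
      rw [Pi.zero_apply, formInner_zero_left, Complex.zero_re]
    rw [this]
    exact integrableOn_zero

/-- The pointwise square is continuous, hence integrable on the compact closure of `S`. This places
test forms and their derivatives in L₂. -/
theorem SmoothForm.isL2 {S : Set M} (hc : IsCompact (closure S)) {q : ℕ}
    {α : Form N M q} (hα : SmoothForm α) : IsL2 S α where
  measurable x := ((hα x).continuousOn.aestronglyMeasurable
    (chartAt _ x).open_target.measurableSet).mono_measure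
      (Measure.restrict_mono inter_subset_left le_rfl)
  integrable := ((Complex.continuous_re.comp
    (continuous_formInner hα hα)).continuousOn.integrableOn_compact hc).mono_set subset_closure

end L2
end MixedForms
end

noncomputable section

set_option linter.unusedSectionVars false

namespace MixedForms

/-! ### Weak operators between semi-inner product spaces. -/

section WeakRelation

variable {H₀ H₁ H₂ : Type*} [SeminormedAddCommGroup H₀] [InnerProductSpace ℂ H₀]
  [SeminormedAddCommGroup H₁] [InnerProductSpace ℂ H₁]
  [SeminormedAddCommGroup H₂] [InnerProductSpace ℂ H₂]

/-- Every vector is the sum of a vector orthogonal to `A` and a vector orthogonal to everything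
that is orthogonal to `A`. -/
theorem exists_orthogonal_decomposition [CompleteSpace H₀] (A : Set H₀) (x : H₀) :
    ∃ y, (∀ a ∈ A, ⟪a, y⟫_ℂ = 0) ∧ ∀ z, (∀ a ∈ A, ⟪a, z⟫_ℂ = 0) → ⟪z, x - y⟫_ℂ = 0 := by
  -- The orthogonal projection is available in the separation quotient, a genuine Hilbert space;
  -- orthogonality to `A` does not see the difference.
  set K : Submodule ℂ (SeparationQuotient H₀) :=
    (Submodule.span ℂ (SeparationQuotient.mk '' A))ᗮ with hK
  have hmem : ∀ z : H₀, (∀ a ∈ A, ⟪a, z⟫_ℂ = 0) ↔ SeparationQuotient.mk z ∈ K := by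
    intro z
    constructor
    · intro h
      rw [hK, Submodule.mem_orthogonal]
      intro u hu
      induction hu using Submodule.span_induction with
      | mem u hu =>
        obtain ⟨a, ha, rfl⟩ := hu
        exact h a ha
      | zero => exact inner_zero_left _
      | add u v _ _ hu hv => rw [inner_add_left, hu, hv, add_zero]
      | smul c u _ hu => rw [inner_smul_left, hu, mul_zero]
    · intro h a ha
      exact (Submodule.mem_orthogonal _ _).1 h _ (Submodule.subset_span (mem_image_of_mem _ ha))
  have : IsClosed (K : Set (SeparationQuotient H₀)) := Submodule.isClosed_orthogonal _
  have : CompleteSpace K := this.completeSpace_coe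
  obtain ⟨w, hw, hw'⟩ :=
    Submodule.HasOrthogonalProjection.exists_orthogonal (K := K) (SeparationQuotient.mk x)
  obtain ⟨y, rfl⟩ := SeparationQuotient.surjective_mk w
  refine ⟨y, (hmem y).2 hw, fun z hz => ?_⟩
  exact (Submodule.mem_orthogonal _ _).1 hw' _ ((hmem z).1 hz)

/-- `E` has the image `F` under the weak operator defined by the pairs `(a, b)` in `A`. -/
def WeakRel (A : Set (H₀ × H₁)) (E : H₀) (F : H₁) : Prop :=
  ∀ p ∈ A, ⟪p.1, E⟫_ℂ = -⟪p.2, F⟫_ℂ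

theorem WeakRel.sub {A : Set (H₀ × H₁)} {E E' : H₀} {F F' : H₁} (h : WeakRel A E F)
    (h' : WeakRel A E' F') : WeakRel A (E - E') (F - F') := fun p hp => by
  rw [inner_sub_right, inner_sub_right, h p hp, h' p hp]
  ring

theorem WeakRel.smul {A : Set (H₀ × H₁)} {E : H₀} {F : H₁} (h : WeakRel A E F) (c : ℂ) :
    WeakRel A (c • E) (c • F) := fun p hp => by
  rw [inner_smul_right, inner_smul_right, h p hp]
  ring

/-- Weak operators are closed, since each defining equation is continuous in both entries. -/
theorem weakRel_of_tendsto {A : Set (H₀ × H₁)} {E : ℕ → H₀} {F : ℕ → H₁} {E' : H₀} {F' : H₁}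
    (h : ∀ n, WeakRel A (E n) (F n)) (hE : Tendsto E atTop (𝓝 E')) (hF : Tendsto F atTop (𝓝 F')) :
    WeakRel A E' F' := fun p hp => by
  refine tendsto_nhds_unique (f := fun n => ⟪p.1, E n⟫_ℂ) (l := atTop) (tendsto_const_nhds.inner hE) ?_
  simp only [fun n => h n p hp]
  exact (tendsto_const_nhds.inner hF).neg

/-- Sequences bounded in the graph norm of two weak operators have convergent subsequences. -/
def CompactGraph (A : Set (H₀ × H₁)) (B : Set (H₀ × H₂)) : Prop :=
  ∀ (E : ℕ → H₀) (F : ℕ → H₁) (G : ℕ → H₂) (C : ℝ), (∀ n, WeakRel A (E n) (F n)) →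
    (∀ n, WeakRel B (E n) (G n)) → (∀ n, ‖E n‖ ^ 2 + ‖F n‖ ^ 2 + ‖G n‖ ^ 2 ≤ C) →
    ∃ (φ : ℕ → ℕ) (E' : H₀), StrictMono φ ∧ Tendsto (E ∘ φ) atTop (𝓝 E')

theorem CompactGraph.symm {A : Set (H₀ × H₁)} {B : Set (H₀ × H₂)} (h : CompactGraph A B) :
    CompactGraph B A := fun E F G C hF hG hC =>
  h E G F C hG hF fun n => (le_of_eq (by ring)).trans (hC n)

/-- A failing estimate yields unit vectors with images tending to zero. Their limit lies in both
kernels and is orthogonal to both kernels' intersection, so it is orthogonal to itself, although its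
norm is one. -/
theorem CompactGraph.exists_norm_le {A : Set (H₀ × H₁)} {B : Set (H₀ × H₂)}
    (hcpt : CompactGraph A B) : ∃ c : ℝ, 0 < c ∧ ∀ E F, WeakRel A E F → WeakRel B E 0 →
      (∀ z, WeakRel A z 0 → WeakRel B z 0 → ⟪z, E⟫_ℂ = 0) → ‖E‖ ≤ c * ‖F‖ := by
  by_contra! hcon
  -- The constant `n + 1` is positive and bounds the image of the normalised vector by `1 / (n +
  -- 1)`.
  choose E F hA hB hz hlt using fun n : ℕ => hcon ((n : ℝ) + 1) (by positivity)
  have hpos : ∀ n, 0 < ‖E n‖ := fun n => lt_of_le_of_lt (by positivity) (hlt n)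
  set c : ℕ → ℂ := fun n => ((‖E n‖⁻¹ : ℝ) : ℂ) with hc
  have hcn : ∀ n, ‖c n‖ = ‖E n‖⁻¹ := fun n => by
    rw [hc]
    simp only [Complex.norm_real, norm_inv, norm_norm]
  have hE1 : ∀ n, ‖c n • E n‖ = 1 := fun n => by
    rw [norm_smul, hcn, inv_mul_cancel₀ (hpos n).ne']
  have hF1 : ∀ n : ℕ, ‖c n • F n‖ ≤ 1 / ((n : ℝ) + 1) := fun n => by
    rw [norm_smul, hcn, le_div_iff₀ (by positivity), inv_mul_eq_div, div_mul_eq_mul_div,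
      div_le_one (hpos n), mul_comm]
    exact (hlt n).le
  have hF0 : Tendsto (fun n => c n • F n) atTop (𝓝 0) :=
    squeeze_zero_norm hF1 tendsto_one_div_add_atTop_nhds_zero_nat
  have hB0 : ∀ n, WeakRel B (c n • E n) 0 := fun n => by
    simpa using (hB n).smul (c n)
  obtain ⟨φ, E', hφ, hlim⟩ := hcpt (fun n => c n • E n) (fun n => c n • F n) (fun _ => 0) 2
    (fun n => (hA n).smul (c n)) hB0 (fun n => by
      have h1 : ‖c n • F n‖ ≤ 1 := (hF1 n).trans (by
        rw [div_le_one (by positivity)]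
        linarith [(Nat.cast_nonneg n : (0 : ℝ) ≤ n)])
      have h2 : ‖c n • F n‖ ^ 2 ≤ 1 := pow_le_one₀ (norm_nonneg _) h1
      rw [hE1, norm_zero]
      linarith)
  have hA' : WeakRel A E' 0 := weakRel_of_tendsto (fun n => (hA (φ n)).smul (c (φ n))) hlim
    (hF0.comp hφ.tendsto_atTop)
  have hB' : WeakRel B E' 0 := weakRel_of_tendsto (fun n => hB0 (φ n)) hlim tendsto_const_nhds
  have h0 : ⟪E', E'⟫_ℂ = 0 := by
    refine tendsto_nhds_unique (f := fun n => ⟪E', ((fun n => c n • E n) ∘ φ) n⟫_ℂ) (l := atTop)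
      (tendsto_const_nhds.inner hlim) ?_
    have : ∀ n, ⟪E', ((fun n => c n • E n) ∘ φ) n⟫_ℂ = 0 := fun n => by
      simp only [Function.comp, inner_smul_right, hz (φ n) E' hA' hB', mul_zero]
    simp only [this, tendsto_const_nhds]
  have h1 : ‖E'‖ = 1 := tendsto_nhds_unique hlim.norm (by
    simp only [Function.comp, hE1, tendsto_const_nhds])
  rw [inner_self_eq_norm_sq_to_K, h1] at h0
  norm_num at h0

/-- If the ranges of the two families of test elements are orthogonal, compactness implies that
the weak operator has closed range. -/
theorem CompactGraph.exists_weakRel_of_tendsto [CompleteSpace H₀] {A : Set (H₀ × H₁)}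
    {B : Set (H₀ × H₂)} (hcpt : CompactGraph A B)
    (horth : ∀ p ∈ A, ∀ r ∈ B, ⟪p.1, r.1⟫_ℂ = 0) {u : ℕ → H₁} {F : H₁}
    (hu : ∀ n, ∃ E, WeakRel A E (u n)) (hlim : Tendsto u atTop (𝓝 F)) : ∃ E, WeakRel A E F := by
  obtain ⟨c, hc, hle⟩ := hcpt.exists_norm_le
  have hu' : ∀ n, ∃ E, WeakRel A E (u n) ∧ ∀ z, WeakRel A z 0 → ⟪z, E⟫_ℂ = 0 := by
    intro n
    obtain ⟨E, hE⟩ := hu n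
    -- Here `y` is the projection of `E` onto the kernel of the first operator, that is, onto the
    -- complement of the first entries of `A`. Removing it keeps the image.
    obtain ⟨y, hy, hy'⟩ := exists_orthogonal_decomposition (Prod.fst '' A) E
    refine ⟨E - y, ?_, fun z hz => hy' z ?_⟩
    · intro p hp
      rw [inner_sub_right, hE p hp, hy p.1 (mem_image_of_mem _ hp), sub_zero]
    · rintro _ ⟨p, hp, rfl⟩
      simpa using hz p hp
  choose E hE hperp using hu'
  -- By `horth` the first entries of `B` lie in the kernel of the first operator, to which `E n` is
  -- orthogonal.
  have hB : ∀ n, WeakRel B (E n) 0 := fun n p hp => by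
    rw [inner_zero_right, neg_zero]
    refine hperp n p.1 fun r hr => ?_
    rw [inner_zero_right, neg_zero]
    exact horth r hr p hp
  have hdist : ∀ n m, dist (E n) (E m) ≤ c * dist (u n) (u m) := fun n m => by
    rw [dist_eq_norm, dist_eq_norm]
    refine hle _ _ ((hE n).sub (hE m)) (by simpa using (hB n).sub (hB m)) fun z hz _ => ?_
    rw [inner_sub_right, hperp n z hz, hperp m z hz, sub_zero]
  have hcauchy : CauchySeq E := by
    rw [Metric.cauchySeq_iff']
    intro ε hε
    obtain ⟨n, hn⟩ := Metric.cauchySeq_iff'.1 hlim.cauchySeq (ε / c) (by positivity)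
    refine ⟨n, fun m hm => (hdist m n).trans_lt ?_⟩
    rw [mul_comm, ← lt_div_iff₀ hc]
    exact hn m hm
  obtain ⟨E', hE'⟩ := cauchySeq_tendsto_of_complete hcauchy
  exact ⟨E', weakRel_of_tendsto hE hE' hlim⟩

end WeakRelation

end MixedForms
end

noncomputable section

set_option linter.unusedSectionVars false

namespace MixedForms

/-! ### The complete space of square integrable forms. -/

theorem exists_tendsto_of_formNorm_le {V : Type*} [NormedAddCommGroup V] [InnerProductSpace ℝ V]
    {N : ℕ} [Fact (Module.finrank ℝ V = N)] [FiniteDimensional ℝ V] {q : ℕ}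
    {u : ℕ → V [⋀^Fin q]→L[ℝ] ℂ} {C : ℝ}
    (h : ∀ n, formNorm N (u (n + 1) - u n) ≤ C * (1 / 2) ^ n) :
    ∃ L, Tendsto u atTop (𝓝 L) := by
  refine cauchySeq_tendsto_of_complete (cauchySeq_of_le_geometric (1 / 2)
    ((q.factorial * Fintype.card (Fin q ↪o Fin N) : ℝ) * C) (by norm_num) fun n => ?_)
  rw [dist_comm, dist_eq_norm, mul_assoc]
  exact (norm_le_mul_formNorm (N := N) _).trans (mul_le_mul_of_nonneg_left (h n) (by positivity))

section L2Space

variable {N : ℕ} {M : Type*} [TopologicalSpace M] [ChartedSpace (EuclideanSpace ℝ (Fin N)) M]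
  [RiemannianBundle (fun x : M => TangentSpace (𝓡 N) x)] [IsManifold (𝓡 N) ∞ M]
  [T2Space M] [SigmaCompactSpace M] [MeasurableSpace M] [BorelSpace M]
  [IsContMDiffRiemannianBundle (𝓡 N) ∞ (EuclideanSpace ℝ (Fin N))
      (fun x : M => TangentSpace (𝓡 N) x)]

/-- The submodule of the square integrable forms on an open set. -/
def l2Submodule (S : TopologicalSpace.Opens M) (q : ℕ) : Submodule ℂ (Form N M q) where
  carrier := {α | IsL2 (S : Set M) α}
  add_mem' h h' := IsL2.add S.isOpen.measurableSet h h'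
  zero_mem' := isL2_zero _
  smul_mem' c _ h := h.const_smul c

/-- The space of representatives of elements of `L₂^q(S)`. -/
def L2Form (S : TopologicalSpace.Opens M) (q : ℕ) : Type _ := l2Submodule (N := N) S q

variable {S : TopologicalSpace.Opens M} {q : ℕ}

instance : AddCommGroup (L2Form (N := N) S q) :=
  inferInstanceAs (AddCommGroup (l2Submodule (N := N) S q))

instance : Module ℂ (L2Form (N := N) S q) :=
  inferInstanceAs (Module ℂ (l2Submodule (N := N) S q))

/-- The form underlying an element of `L2Form`. -/
def L2Form.form (E : L2Form (N := N) S q) : Form N M q := E.1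

/-- A square integrable form as an element of `L2Form`. -/
def IsL2.toL2 {E : Form N M q} (h : IsL2 (S : Set M) E) : L2Form (N := N) S q := ⟨E, h⟩

theorem L2Form.isL2 (E : L2Form (N := N) S q) : IsL2 (S : Set M) E.form := E.2

theorem L2Form.form_add (E F : L2Form (N := N) S q) : (E + F).form = E.form + F.form := rfl

theorem L2Form.form_smul (c : ℂ) (E : L2Form (N := N) S q) : (c • E).form = c • E.form := rfl

theorem l2Inner_conj_symm (T : Set M) (E F : Form N M q) :
    (starRingEnd ℂ) (l2Inner T E F) = l2Inner T F E := by
  rw [l2Inner, ← integral_conj, l2Inner]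
  simp only [formInner_conj_symm]

theorem re_l2Inner_self {T : Set M} (hT : MeasurableSet T) {E : Form N M q} (hE : IsL2 T E) :
    (l2Inner T E E).re = ∫ x in T, (formInner N (E x) (E x)).re ∂(vol N M) := by
  rw [l2Inner]
  exact (integral_re (hE.integrable_formInner hT hE)).symm

/-- The inner product of `L₂^q(S)`, linear in the second argument. -/
@[reducible]
def l2Core : PreInnerProductSpace.Core ℂ (L2Form (N := N) S q) where
  inner E F := l2Inner (S : Set M) F.form E.form
  conj_inner_symm E F := l2Inner_conj_symm _ _ _
  re_inner_nonneg E := by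
    change 0 ≤ (l2Inner (S : Set M) E.form E.form).re
    rw [re_l2Inner_self S.isOpen.measurableSet E.isL2]
    exact integral_nonneg fun x => formInner_self_nonneg _
  add_left E F G := by
    have hS := S.isOpen.measurableSet
    rw [← l2Inner_conj_symm, ← l2Inner_conj_symm _ E.form, ← l2Inner_conj_symm _ F.form, ← map_add,
      L2Form.form_add]
    congr 1
    simp only [l2Inner, Pi.add_apply, formInner_add_left]
    exact integral_add (E.isL2.integrable_formInner hS G.isL2) (F.isL2.integrable_formInner hS G.isL2)
  smul_left E F c := by
    rw [L2Form.form_smul]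
    simp only [l2Inner, Pi.smul_apply, formInner_smul_right]
    exact integral_const_mul _ _

/-- Forms agreeing almost everywhere on `S` are not identified, so this is only a seminorm; the
abstract lemmas are stated for that setting. -/
instance : SeminormedAddCommGroup (L2Form (N := N) S q) :=
  @InnerProductSpace.Core.toSeminormedAddCommGroup ℂ _ _ _ _ l2Core

instance : InnerProductSpace ℂ (L2Form (N := N) S q) := InnerProductSpace.ofCore l2Core

theorem L2Form.inner_eq (E F : L2Form (N := N) S q) :
    ⟪E, F⟫_ℂ = l2Inner (S : Set M) F.form E.form := rfl

theorem L2Form.norm_eq (E : L2Form (N := N) S q) : ‖E‖ = l2Norm (S : Set M) E.form := rfl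

theorem L2Form.lintegral_eq (E : L2Form (N := N) S q) :
    ∫⁻ x in (S : Set M), ENNReal.ofReal (formInner N (E.form x) (E.form x)).re ∂(vol N M) =
      ENNReal.ofReal (‖E‖ ^ 2) := by
  rw [← ofReal_integral_eq_lintegral_ofReal E.isL2.integrable
    (Eventually.of_forall fun x => formInner_self_nonneg _),
    ← re_l2Inner_self S.isOpen.measurableSet E.isL2, L2Form.norm_eq, l2Norm, Real.sq_sqrt]
  rw [re_l2Inner_self S.isOpen.measurableSet E.isL2]
  exact integral_nonneg fun x => formInner_self_nonneg _

/-- Pulling values back to the model space is continuous at each point, so limits almost everywhere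
survive in every chart. -/
theorem MeasurableForm.of_tendsto {T : Set M} (hT : MeasurableSet T) {u : ℕ → Form N M q}
    {U : Form N M q} (hu : ∀ n, MeasurableForm T (u n))
    (hlim : ∀ᵐ x ∂((vol N M).restrict T), Tendsto (fun n => u n x) atTop (𝓝 (U x))) :
    MeasurableForm T U := fun x => by
  refine aestronglyMeasurable_of_tendsto_ae atTop (fun n => hu n x) ?_
  filter_upwards [ae_chart_of_ae_vol (chartAt_mem x) hT hlim] with y hy
  exact ((ContinuousAlternatingMap.compContinuousLinearMapCLM (F := ℂ) (ι := Fin q)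
    (mfderiv (𝓡 N) (𝓡 N) (chartAt (EuclideanSpace ℝ (Fin N)) x).symm y)).continuous.tendsto _).comp
      hy

theorem continuous_re_formInner_self (x : M) :
    Continuous fun α : TangentSpace (𝓡 N) x [⋀^Fin q]→L[ℝ] ℂ => (formInner N α α).re := by
  refine Complex.continuous_re.comp (continuous_finsetSum _ fun I _ => ?_)
  have h := (ContinuousAlternatingMap.apply ℝ (TangentSpace (𝓡 N) x) ℂ
    fun k => onb (TangentSpace (𝓡 N) x) N (I k)).continuous
  exact h.mul (Complex.continuous_conj.comp h)

/-- Since `∑ 4ⁿ · 16⁻ⁿ` converges, `∑ 4ⁿ dₙ` is finite almost everywhere. There the pointwise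
increments are at most a constant times `2⁻ⁿ`. -/
theorem ae_exists_tendsto {u : ℕ → Form N M q} {T : Set M} (hT : MeasurableSet T)
    (hu : ∀ n, MeasurableForm T (u (n + 1) - u n))
    (h : ∀ n, ∫⁻ x in T, ENNReal.ofReal (formInner N ((u (n + 1) - u n) x)
      ((u (n + 1) - u n) x)).re ∂(vol N M) ≤ (16⁻¹ : ENNReal) ^ n) :
    ∀ᵐ x ∂((vol N M).restrict T), ∃ L, Tendsto (fun n => u n x) atTop (𝓝 L) := by
  set d : ℕ → M → ENNReal := fun n x =>
    ENNReal.ofReal (formInner N ((u (n + 1) - u n) x) ((u (n + 1) - u n) x)).re with hd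
  have hdm : ∀ n, AEMeasurable (d n) ((vol N M).restrict T) := fun n =>
    (Complex.continuous_re.comp_aestronglyMeasurable
      ((hu n).formInner hT (hu n))).aemeasurable.ennreal_ofReal
  have hsum : ∫⁻ x in T, ∑' n, (4 : ENNReal) ^ n * d n x ∂(vol N M) ≠ ⊤ := by
    rw [lintegral_tsum fun n => (hdm n).const_mul _]
    refine ne_top_of_le_ne_top (b := ∑' n, (4⁻¹ : ENNReal) ^ n) ?_ (ENNReal.tsum_le_tsum fun n => ?_)
    · rw [ENNReal.tsum_geometric]
      refine ENNReal.inv_ne_top.2 ?_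
      rw [ne_eq, tsub_eq_zero_iff_le, not_le]
      exact ENNReal.inv_lt_one.2 (by norm_num)
    · rw [lintegral_const_mul'' _ (hdm n)]
      refine (mul_le_mul_right (h n) _).trans (le_of_eq ?_)
      rw [← mul_pow]
      congr 1
      rw [show (16 : ENNReal) = 4 * 4 by norm_num, ENNReal.mul_inv (by simp) (by simp), ← mul_assoc,
        ENNReal.mul_inv_cancel (by simp) (by simp), one_mul]
  filter_upwards [ae_lt_top' (AEMeasurable.tsum fun n => (hdm n).const_mul _) hsum] with x hx
  set C := (∑' n, (4 : ENNReal) ^ n * d n x).toReal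
  have hle : ∀ n, formNorm N ((u (n + 1) - u n) x) ≤ Real.sqrt C * (1 / 2) ^ n := by
    intro n
    have h1 : (4 : ENNReal) ^ n * d n x ≤ ∑' n, (4 : ENNReal) ^ n * d n x := ENNReal.le_tsum n
    have h2 := ENNReal.toReal_mono hx.ne h1
    rw [ENNReal.toReal_mul, ENNReal.toReal_pow, hd, ENNReal.toReal_ofReal (formInner_self_nonneg _)]
      at h2
    rw [formNorm]
    refine Real.sqrt_le_iff.2 ⟨by positivity, ?_⟩
    rw [mul_pow, Real.sq_sqrt ENNReal.toReal_nonneg, ← pow_mul, mul_comm n 2, pow_mul]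
    norm_num at h2 ⊢
    rw [one_div, inv_pow, ← div_eq_mul_inv, le_div_iff₀ (by positivity), mul_comm]
    exact h2
  exact exists_tendsto_of_formNorm_le hle

/-- Riesz–Fischer: a rapidly Cauchy sequence converges pointwise almost everywhere, and Fatou's
lemma bounds the distance to the pointwise limit. Distances below `4⁻ⁿ` have squares below `16⁻ⁿ`.
-/
instance : CompleteSpace (L2Form (N := N) S q) := by
  have hS := S.isOpen.measurableSet
  refine Metric.complete_of_convergent_controlled_sequences (fun n => (1 / 4 : ℝ) ^ n)
    (fun n => by positivity) fun u hu => ?_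
  have hle : ∀ K n m : ℕ, K ≤ n → K ≤ m → ∫⁻ x in (S : Set M), ENNReal.ofReal (formInner N
      ((u n - u m).form x) ((u n - u m).form x)).re ∂(vol N M) ≤
        ENNReal.ofReal (((1 / 4 : ℝ) ^ K) ^ 2) := fun K n m hn hm => by
    rw [L2Form.lintegral_eq, ← dist_eq_norm]
    exact ENNReal.ofReal_le_ofReal (pow_le_pow_left₀ dist_nonneg (hu K n m hn hm).le 2)
  have hconv : ∀ᵐ x ∂((vol N M).restrict S), ∃ L, Tendsto (fun n => (u n).form x) atTop (𝓝 L) := by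
    refine ae_exists_tendsto hS (fun n => (u (n + 1) - u n).isL2.measurableForm) fun n =>
      (hle n (n + 1) n n.le_succ le_rfl).trans (le_of_eq ?_)
    rw [← pow_mul, mul_comm n 2, pow_mul, ENNReal.ofReal_pow (by positivity)]
    congr 1
    rw [show ((1 / 4 : ℝ) ^ 2) = 16⁻¹ by norm_num, ENNReal.ofReal_inv_of_pos (by norm_num),
      ENNReal.ofReal_ofNat]
  classical
  set U : Form N M q := fun x =>
    if h : ∃ L, Tendsto (fun n => (u n).form x) atTop (𝓝 L) then h.choose else 0 with hUdef
  have hU : ∀ᵐ x ∂((vol N M).restrict S), Tendsto (fun n => (u n).form x) atTop (𝓝 (U x)) := by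
    filter_upwards [hconv] with x hx
    rw [hUdef]
    simp only [dif_pos hx]
    exact hx.choose_spec
  have hUm : MeasurableForm (S : Set M) U :=
    MeasurableForm.of_tendsto hS (fun n => (u n).isL2.measurableForm) hU
  have hfatou : ∀ m, ∫⁻ x in (S : Set M), ENNReal.ofReal (formInner N
      ((U - (u m).form) x) ((U - (u m).form) x)).re ∂(vol N M) ≤
        ENNReal.ofReal (((1 / 4 : ℝ) ^ m) ^ 2) := by
    intro m
    have h1 : ∀ᵐ x ∂((vol N M).restrict S), ENNReal.ofReal (formInner N
        ((U - (u m).form) x) ((U - (u m).form) x)).re = liminf (fun n => ENNReal.ofReal (formInner N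
          ((u n - u m).form x) ((u n - u m).form x)).re) atTop := by
      filter_upwards [hU] with x hx
      refine (Tendsto.liminf_eq ?_).symm
      refine (ENNReal.continuous_ofReal.tendsto _).comp
        (((continuous_re_formInner_self x).tendsto _).comp ?_)
      exact hx.sub_const _
    rw [lintegral_congr_ae h1]
    refine (lintegral_liminf_le' fun n => (Complex.continuous_re.comp_aestronglyMeasurable
      ((u n - u m).isL2.measurableForm.formInner hS
        (u n - u m).isL2.measurableForm)).aemeasurable.ennreal_ofReal).trans ?_
    refine liminf_le_of_frequently_le' (Eventually.frequently ?_)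
    filter_upwards [eventually_ge_atTop m] with n hn
    exact hle m n m hn le_rfl
  have hdiff : ∀ m, IsL2 (S : Set M) (U - (u m).form) := fun m => by
    have hm : MeasurableForm (S : Set M) (U - (u m).form) := by
      rw [sub_eq_add_neg, ← neg_one_smul ℂ (u m).form]
      exact hUm.add ((u m).isL2.measurableForm.const_smul _)
    exact ⟨hm, (integrableOn_re_formInner_iff hS hm).2 ((hfatou m).trans_lt ENNReal.ofReal_lt_top)⟩
  have hUL : IsL2 (S : Set M) U := by
    have := (hdiff 0).add hS (u 0).isL2
    rwa [sub_add_cancel] at this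
  refine ⟨hUL.toL2, tendsto_iff_norm_sub_tendsto_zero.2 (squeeze_zero (fun _ => norm_nonneg _)
    (fun m => ?_) (tendsto_pow_atTop_nhds_zero_of_lt_one (r := (1 / 4 : ℝ)) (by norm_num)
      (by norm_num)))⟩
  have h2 := hfatou m
  rw [show U - (u m).form = (hUL.toL2 - u m).form from rfl, L2Form.lintegral_eq,
    ENNReal.ofReal_le_ofReal_iff (by positivity)] at h2
  rw [norm_sub_rev]
  exact le_of_sq_le_sq h2 (by positivity)

end L2Space

end MixedForms
end

noncomputable section

set_option linter.unusedSectionVars false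

namespace MixedForms

/-! ### Cut-offs and locality. -/

/-- Multiply by a bump function equal to one near `K` and zero near the complement of `U`. Chart
expressions, smooth only on the chart target, thus become globally smooth. -/
theorem exists_contDiff_eventuallyEq {E F : Type*} [NormedAddCommGroup E] [NormedSpace ℝ E]
    [FiniteDimensional ℝ E] [NormedAddCommGroup F] [NormedSpace ℝ F] {K U : Set E}
    (hK : IsClosed K) (hU : IsOpen U) (hKU : K ⊆ U) {f : E → F}
    (hf : ∀ y ∈ U, ContDiffAt ℝ ∞ f y) :
    ∃ w : E → F, ContDiff ℝ ∞ w ∧ (∀ y ∈ K, w =ᶠ[𝓝 y] f) ∧ ∀ y, w y ≠ 0 → y ∈ U ∧ f y ≠ 0 := by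
  obtain ⟨χ, h0, h1, -⟩ := exists_contMDiffMap_zero_one_nhds_of_isClosed (n := ⊤) 𝓘(ℝ, E)
    hU.isClosed_compl hK (disjoint_compl_left_iff_subset.2 hKU)
  have hχ : ContDiff ℝ ∞ χ := χ.contMDiff.contDiff
  refine ⟨fun y => χ y • f y, contDiff_iff_contDiffAt.2 fun y => ?_, fun y hy => ?_, fun y hy => ?_⟩
  · by_cases hy : y ∈ U
    · exact hχ.contDiffAt.smul (hf y hy)
    · refine (contDiffAt_const (c := (0 : F))).congr_of_eventuallyEq ?_
      filter_upwards [eventually_nhdsSet_iff_forall.1 h0 y hy] with z hz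
      rw [hz, zero_smul]
  · filter_upwards [eventually_nhdsSet_iff_forall.1 h1 y hy] with z hz
    rw [hz, one_smul]
  · refine ⟨?_, fun h => hy (by beta_reduce; rw [h, smul_zero])⟩
    by_contra hyU
    refine hy ?_
    beta_reduce
    rw [(eventually_nhdsSet_iff_forall.1 h0 y hyU).self_of_nhds, zero_smul]

section Locality

variable {N : ℕ} {M : Type*} [TopologicalSpace M] [ChartedSpace (EuclideanSpace ℝ (Fin N)) M]

theorem inChart_congr (e : OpenPartialHomeomorph M (EuclideanSpace ℝ (Fin N))) {q : ℕ}
    {α β : Form N M q} {y : EuclideanSpace ℝ (Fin N)} (h : α (e.symm y) = β (e.symm y)) :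
    inChart e α y = inChart e β y := by
  rw [inChart, inChart, h]

theorem rotS_congr {q : ℕ} {α β : Form N M q} {x : M} (h : ∀ᶠ z in 𝓝 x, α z = β z) :
    rotS α x = rotS β x := by
  set e := chartAt (EuclideanSpace ℝ (Fin N)) x
  have h1 : ∀ᶠ y in 𝓝 (e x), α (e.symm y) = β (e.symm y) := by
    have h0 : Tendsto e.symm (𝓝 (e x)) (𝓝 x) := by
      have := e.symm.continuousAt (mem_chart_target _ x)
      rwa [ContinuousAt, e.left_inv (mem_chart_source _ x)] at this
    exact h0.eventually h
  have h2 : inChart e α =ᶠ[𝓝 (e x)] inChart e β := h1.mono fun y hy => inChart_congr e hy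
  rw [rotS, rotS, h2.extDeriv_eq]

theorem rotS_zero {q : ℕ} : rotS (0 : Form N M q) = 0 := by
  funext x
  have : inChart (chartAt (EuclideanSpace ℝ (Fin N)) x) (0 : Form N M q) = 0 := rfl
  rw [rotS, this, ← zero_smul ℝ (0 : EuclideanSpace ℝ (Fin N) → _), extDeriv_smul, zero_smul]
  rfl

theorem eventually_eq_zero_of_notMem_formSupport {q : ℕ} {α : Form N M q} {x : M}
    (h : x ∉ formSupport α) : ∀ᶠ z in 𝓝 x, α z = 0 := by
  filter_upwards [isClosed_closure.isOpen_compl.mem_nhds h] with z hz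
  by_contra hne
  exact hz (subset_closure hne)

theorem rotS_eq_zero_of_notMem_formSupport {q : ℕ} {α : Form N M q} {x : M}
    (h : x ∉ formSupport α) : rotS α x = 0 := by
  rw [rotS_congr (β := 0) (eventually_eq_zero_of_notMem_formSupport h), rotS_zero, Pi.zero_apply]

variable [IsManifold (𝓡 N) ∞ M]

theorem rotS_add {q : ℕ} {α β : Form N M q} (hα : SmoothForm α) (hβ : SmoothForm β) :
    rotS (α + β) = rotS α + rotS β := by
  funext x
  rw [Pi.add_apply, rotS, inChart_add, extDeriv_add
    ((hα.contDiffAt (chartAt_mem x) (mem_chart_target _ _)).differentiableAt (by simp))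
    ((hβ.contDiffAt (chartAt_mem x) (mem_chart_target _ _)).differentiableAt (by simp))]
  rfl

theorem SmoothForm.sum {ι : Type*} {q : ℕ} {α : ι → Form N M q} (s : Finset ι)
    (h : ∀ i, SmoothForm (α i)) : SmoothForm (∑ i ∈ s, α i) := by
  classical
  induction s using Finset.induction_on with
  | empty => exact smoothForm_zero
  | insert i s hi ih =>
    rw [Finset.sum_insert hi]
    exact (h i).add ih

theorem rotS_sum {ι : Type*} {q : ℕ} {α : ι → Form N M q} (s : Finset ι)
    (h : ∀ i, SmoothForm (α i)) : rotS (∑ i ∈ s, α i) = ∑ i ∈ s, rotS (α i) := by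
  classical
  induction s using Finset.induction_on with
  | empty => exact rotS_zero
  | insert i s hi ih => rw [Finset.sum_insert hi, Finset.sum_insert hi,
      rotS_add (h i) (SmoothForm.sum s h), ih]

/-- The product of a form with a real function. -/
def mulForm {q : ℕ} (f : M → ℝ) (α : Form N M q) : Form N M q := fun x => f x • α x

theorem SmoothForm.mulForm {q : ℕ} {f : M → ℝ} (hf : ContMDiff (𝓡 N) 𝓘(ℝ) ∞ f) {α : Form N M q}
    (hα : SmoothForm α) : SmoothForm (mulForm f α) := fun x y hy => by
  have he := chartAt_mem (N := N) x
  have h1 : ContDiffAt ℝ ∞ (f ∘ (chartAt (EuclideanSpace ℝ (Fin N)) x).symm) y :=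
    contMDiffAt_iff_contDiffAt.1 (hf.contMDiffAt.comp y (contMDiffAt_symm he hy))
  exact (h1.smul (hα.contDiffAt he hy)).contDiffWithinAt

theorem formSupport_mulForm_subset {q : ℕ} (f : M → ℝ) (α : Form N M q) :
    formSupport (mulForm f α) ⊆ tsupport f :=
  closure_mono fun x hx hf => hx (by
    rw [mulForm, hf]
    exact zero_smul ℝ (α x))

theorem formSupport_mulForm_subset_formSupport {q : ℕ} (f : M → ℝ) (α : Form N M q) :
    formSupport (mulForm f α) ⊆ formSupport α :=
  closure_mono fun x hx hf => hx (by
    rw [mulForm, hf]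
    exact smul_zero (A := TangentSpace (𝓡 N) x [⋀^Fin q]→L[ℝ] ℂ) (f x))

end Locality

/-! ### Orthogonality of exact and coexact test forms. -/

section Stokes

variable {N : ℕ} {M : Type*} [TopologicalSpace M] [ChartedSpace (EuclideanSpace ℝ (Fin N)) M]
  [RiemannianBundle (fun x : M => TangentSpace (𝓡 N) x)] [IsManifold (𝓡 N) ∞ M]
  [T2Space M] [SigmaCompactSpace M] [MeasurableSpace M] [BorelSpace M]
  [IsContMDiffRiemannianBundle (𝓡 N) ∞ (EuclideanSpace ℝ (Fin N))
      (fun x : M => TangentSpace (𝓡 N) x)]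
  {e : OpenPartialHomeomorph M (EuclideanSpace ℝ (Fin N))}

theorem wedgeSum_zero_left {U : Type*} [NormedAddCommGroup U] [NormedSpace ℝ U] {r s : ℕ}
    (h : s + r = N) (β : U [⋀^Fin s]→L[ℝ] ℂ) (u : Fin N → U) :
    wedgeSum h (0 : U [⋀^Fin r]→L[ℝ] ℂ) β u = 0 := by
  simp [wedgeSum]

/-- On the support, `√(det g)` equals `s` times `vol` of the frame, so the integrand is a constant
multiple of a Euclidean wedge product of two exact forms. The sign `s` must be constant there to
leave the integral. -/
theorem integral_formInner_rotS_starS_rotS (o : ManifoldOrientation N M)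
    (he : e ∈ IsManifold.maximalAtlas (𝓡 N) ∞ M) {a b : ℕ} (h : (b + 1) + (a + 1) = N)
    {Φ : Form N M a} {β : Form N M b} (hΦ : SmoothForm Φ) (hβ : SmoothForm β)
    (hc : IsCompact (formSupport Φ)) (hsub : formSupport Φ ⊆ e.source) {s : ℝ}
    (hs : ∀ z ∈ formSupport Φ, (o.orient (e.symm (e z))).volumeForm (frame e (e z)) =
      s * Real.sqrt (Matrix.gram ℝ (frame e (e z))).det) (hs1 : s = 1 ∨ s = -1) :
    ∫ x, formInner N (rotS Φ x) (starS o (b + 1) (a + 1) (rotS β) x) ∂(vol N M) = 0 := by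
  have h0 : ∀ x ∉ e.source,
      formInner N (rotS Φ x) (starS o (b + 1) (a + 1) (rotS β) x) = 0 := fun x hx => by
    rw [rotS_eq_zero_of_notMem_formSupport fun hx' => hx (hsub hx'), formInner_zero_left]
  rw [← setIntegral_eq_integral_of_forall_compl_eq_zero h0, integral_source he
    (continuous_formInner hΦ.rotS (hβ.rotS.starS o (a + 1))).aestronglyMeasurable]
  set K : Set (EuclideanSpace ℝ (Fin N)) := e '' formSupport Φ with hK
  have hKc : IsCompact K := hc.image_of_continuousOn (e.continuousOn.mono hsub)
  have hKt : K ⊆ e.target := by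
    rintro _ ⟨z, hz, rfl⟩
    exact e.map_source (hsub hz)
  obtain ⟨φ, hφ, hφK, hφ0⟩ := exists_contDiff_eventuallyEq hKc.isClosed e.open_target hKt
    fun y hy => hΦ.contDiffAt he hy
  obtain ⟨w, hw, hwK, -⟩ := exists_contDiff_eventuallyEq hKc.isClosed e.open_target hKt
    fun y hy => hβ.contDiffAt he hy
  have hφ0' : ∀ y ∉ K, φ y = 0 := fun y hy => by
    by_contra hne
    obtain ⟨h1, h2⟩ := hφ0 y hne
    refine h2 ?_
    have : Φ (e.symm y) = 0 := by
      by_contra h3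
      exact hy ⟨e.symm y, subset_closure h3, e.right_inv h1⟩
    rw [inChart_congr (β := 0) e this]
    rfl
  have hφd : ∀ y ∉ K, extDeriv φ y = 0 := fun y hy => by
    have h1 : φ =ᶠ[𝓝 y] (0 : ℝ) • φ := by
      filter_upwards [hKc.isClosed.isOpen_compl.mem_nhds hy] with z hz
      rw [hφ0' z hz, Pi.smul_apply]
      exact (zero_smul ℝ (φ z)).symm
    rw [h1.extDeriv_eq, extDeriv_smul, zero_smul]
  have hint : ∀ y ∈ e.target, (Real.sqrt (Matrix.gram ℝ (frame e y)).det : ℂ) *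
      formInner N (rotS Φ (e.symm y)) (starS o (b + 1) (a + 1) (rotS β) (e.symm y)) =
      s * (((a + 1).factorial * (b + 1).factorial : ℂ)⁻¹ * wedgeSum h (extDeriv φ y)
        (extDeriv w y) (fun k => EuclideanSpace.single k 1)) := by
    intro y hy
    by_cases hyK : y ∈ K
    · have h1 := formInner_hodgeStar_mul_volumeForm (o.orient (e.symm y)) h (rotS Φ (e.symm y))
        (rotS β (e.symm y)) (frame e y)
      have h2 : wedgeSum h (rotS Φ (e.symm y)) (rotS β (e.symm y)) (frame e y) =
          wedgeSum h (inChart e (rotS Φ) y) (inChart e (rotS β) y)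
            (fun k => EuclideanSpace.single k 1) := rfl
      rw [h2, inChart_rotS he hΦ hy, inChart_rotS he hβ hy, ← (hφK y hyK).extDeriv_eq,
        ← (hwK y hyK).extDeriv_eq] at h1
      rw [← h1]
      obtain ⟨z, hz, rfl⟩ := hyK
      rw [hs z hz]
      have hss : (s : ℂ) * s = 1 := by
        rcases hs1 with rfl | rfl <;> simp
      push_cast
      rw [starS]
      linear_combination (-(Real.sqrt (Matrix.gram ℝ (frame e (e z))).det : ℂ) *
        formInner N (rotS Φ (e.symm (e z))) (hodgeStar (o.orient (e.symm (e z))) (b + 1) (a + 1)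
          (rotS β (e.symm (e z))))) * hss
    · have h1 : e.symm y ∉ formSupport Φ := fun h1 => hyK ⟨_, h1, e.right_inv hy⟩
      rw [rotS_eq_zero_of_notMem_formSupport h1, hφd y hyK, formInner_zero_left,
        wedgeSum_zero_left]
      simp
  rw [setIntegral_congr_fun e.open_target.measurableSet hint,
    setIntegral_eq_integral_of_forall_compl_eq_zero fun y hy => by
      rw [hφd y fun h => hy (hKt h), wedgeSum_zero_left, mul_zero, mul_zero],
    integral_const_mul, integral_const_mul, integral_wedgeSum_extDeriv_extDeriv volume h _ hφ hw
      (HasCompactSupport.intro hKc fun y hy => hφ0' y hy), mul_zero, mul_zero]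

/-- The common boundary `γ` is a boundary of `Γ₁` relative to `∂S`, hence contained in the closure
of `Γ₁`. -/
theorem Triple.Admissible.frontier_subset {T : Triple M} (hT : T.Admissible) :
    frontier T.S ⊆ closure T.Γ₁ ∪ closure T.Γ₂ := by
  rw [← hT.union_eq]
  refine union_subset (union_subset_union subset_closure subset_closure) ?_
  refine Subset.trans ?_ subset_union_left
  rintro _ ⟨x, hx, rfl⟩
  have h1 : x ∈ closure (Subtype.val ⁻¹' T.Γ₁ : Set (frontier T.S)) := frontier_subset_closure hx
  exact closure_mono (image_preimage_subset _ _)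
    (image_closure_subset_closure_image continuous_subtype_val ⟨x, h1, rfl⟩)

theorem divS_eq_zero_of_lt (o : ManifoldOrientation N M) {q : ℕ} (h : N < q + 1)
    (Ψ : Form N M (q + 1)) : divS o Ψ = 0 := by
  have : starS o (N - (q + 1) + 1) q (rotS (starS o (q + 1) (N - (q + 1)) Ψ)) = 0 := by
    funext x
    rw [starS, hodgeStar, dif_neg (by omega)]
    rfl
  rw [divS, this]
  exact smul_zero (A := Form N M q) ((-1 : ℂ) ^ (N * q))

theorem divS_eq_zero_of_notMem_formSupport (o : ManifoldOrientation N M) {q : ℕ}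
    {Ψ : Form N M (q + 1)} {x : M} (hx : x ∉ formSupport Ψ) : divS o Ψ x = 0 := by
  have h1 : rotS (starS o (q + 1) (N - (q + 1)) Ψ) x = 0 := by
    rw [rotS_congr (β := 0), rotS_zero, Pi.zero_apply]
    filter_upwards [eventually_eq_zero_of_notMem_formSupport hx] with z hz
    rw [starS, hz, hodgeStar_zero]
    rfl
  rw [divS, Pi.smul_apply, starS, h1, hodgeStar_zero]
  exact smul_zero (A := TangentSpace (𝓡 N) x [⋀^Fin q]→L[ℝ] ℂ) ((-1 : ℂ) ^ (N * q))

/-- `div Ψ` is, up to sign, the star of `d β` with `β = *Ψ`. Degrees above `N` are separate, since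
truncated subtraction makes them meaningless there. -/
theorem integral_formInner_rotS_divS (o : ManifoldOrientation N M)
    (he : e ∈ IsManifold.maximalAtlas (𝓡 N) ∞ M) {q : ℕ}
    {Φ : Form N M q} {Ψ : Form N M (q + 1 + 1)} (hΦ : SmoothForm Φ) (hΨ : SmoothForm Ψ)
    (hc : IsCompact (formSupport Φ)) (hsub : formSupport Φ ⊆ e.source) {s : ℝ}
    (hs : ∀ z ∈ formSupport Φ, (o.orient (e.symm (e z))).volumeForm (frame e (e z)) =
      s * Real.sqrt (Matrix.gram ℝ (frame e (e z))).det) (hs1 : s = 1 ∨ s = -1) :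
    ∫ x, formInner N (rotS Φ x) (divS o Ψ x) ∂(vol N M) = 0 := by
  by_cases h : q + 1 + 1 ≤ N
  · simp only [divS, Pi.smul_apply, formInner_smul_right]
    rw [integral_const_mul, integral_formInner_rotS_starS_rotS o he (by omega) hΦ
      (hΨ.starS o _) hc hsub hs hs1, mul_zero]
  · simp only [divS_eq_zero_of_lt o (not_le.1 h), Pi.zero_apply, formInner_zero_right,
      integral_zero]

/-- The two supports cannot meet on `∂S`, so inside the closure of `S` they meet in a compact subset
of `S`. Localising `Φ` near that set produces no boundary contribution. -/
theorem l2Inner_rotS_divS_eq_zero (o : ManifoldOrientation N M) {T : Triple M} (hT : T.Admissible)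
    {q : ℕ} {Φ : Form N M q} {Ψ : Form N M (q + 1 + 1)} (hΦ : TestForm T.Γ₁ Φ)
    (hΨ : TestForm T.Γ₂ Ψ) : l2Inner T.S (rotS Φ) (divS o Ψ) = 0 := by
  have hSm := hT.isOpen.measurableSet
  have : LocallyCompactSpace M := ChartedSpace.locallyCompactSpace (EuclideanSpace ℝ (Fin N)) M
  set K : Set M := closure T.S ∩ (formSupport Φ ∩ formSupport Ψ) with hK
  have hKc : IsCompact K := hT.isCompact_closure.inter_right
    (isClosed_closure.inter isClosed_closure)
  have hKS : K ⊆ T.S := by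
    rintro x ⟨hx, hx1, hx2⟩
    by_contra hxS
    have hf : x ∈ frontier T.S := by
      rw [hT.isOpen.frontier_eq]
      exact ⟨hx, hxS⟩
    rcases hT.frontier_subset hf with h | h
    · exact disjoint_left.1 hΦ.2 hx1 h
    · exact disjoint_left.1 hΨ.2 hx2 h
  -- A compact neighbourhood of `K` is needed: the partition must sum to one near each point of `K`,
  -- because `rotS` differentiates.
  obtain ⟨K', hK'c, hKK', hK'S⟩ := exists_compact_between hKc hT.isOpen hKS
  have hU : ∀ x : K', ∃ U : Set M, IsOpen U ∧ (x : M) ∈ U ∧ U ⊆ T.S ∧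
      U ⊆ (chartAt (EuclideanSpace ℝ (Fin N)) (x : M)).source ∧ ∃ s : ℝ, (s = 1 ∨ s = -1) ∧
        ∀ z ∈ U, (o.orient ((chartAt (EuclideanSpace ℝ (Fin N)) (x : M)).symm
          (chartAt (EuclideanSpace ℝ (Fin N)) (x : M) z))).volumeForm
            (frame (chartAt (EuclideanSpace ℝ (Fin N)) (x : M))
              (chartAt (EuclideanSpace ℝ (Fin N)) (x : M) z)) =
          s * Real.sqrt (Matrix.gram ℝ (frame (chartAt (EuclideanSpace ℝ (Fin N)) (x : M))
            (chartAt (EuclideanSpace ℝ (Fin N)) (x : M) z))).det := by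
    intro x
    obtain ⟨s, hs1, hs⟩ := o.eventually_eq_sqrt (x : M)
    have h1 := ((chartAt (EuclideanSpace ℝ (Fin N)) (x : M)).continuousAt
      (mem_chart_source _ _)).eventually hs
    obtain ⟨V, hV, hVo, hxV⟩ := eventually_nhds_iff.1 h1
    exact ⟨V ∩ T.S ∩ (chartAt (EuclideanSpace ℝ (Fin N)) (x : M)).source,
      (hVo.inter hT.isOpen).inter (chartAt _ (x : M)).open_source,
      ⟨⟨hxV, hK'S x.2⟩, mem_chart_source _ _⟩, fun z hz => hz.1.2, fun z hz => hz.2,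
      s, hs1, fun z hz => hV z hz.1.1⟩
  choose U hUo hxU hUS hUe s hs1 hs using hU
  obtain ⟨t, ht⟩ := hK'c.elim_finite_subcover U hUo fun x hx => mem_iUnion_of_mem ⟨x, hx⟩ (hxU _)
  have ht' : K' ⊆ ⋃ i : t, U i := by
    simpa only [iUnion_coe_set, SetLike.mem_coe, iUnion_subtype] using ht
  obtain ⟨f, hf⟩ := SmoothPartitionOfUnity.exists_isSubordinate (𝓡 N) hK'c.isClosed
    (fun i : t => U i) (fun i => hUo i) ht'
  have hsm : ∀ i : t, SmoothForm (mulForm (f i) Φ) := fun i => hΦ.1.mulForm (f i).contMDiff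
  have hsupp : ∀ i : t, formSupport (mulForm (f i) Φ) ⊆ U i := fun i =>
    (formSupport_mulForm_subset _ _).trans (hf i)
  have hcpt : ∀ i : t, IsCompact (formSupport (mulForm (f i) Φ)) := fun i =>
    hT.isCompact_closure.of_isClosed_subset isClosed_closure
      (((hsupp i).trans (hUS i)).trans subset_closure)
  -- Where one of the supports is absent, both sides vanish; elsewhere the point lies in `K`.
  have hpt : ∀ x ∈ T.S, formInner N (rotS Φ x) (divS o Ψ x) =
      ∑ i : t, formInner N (rotS (mulForm (f i) Φ) x) (divS o Ψ x) := by
    intro x hx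
    by_cases h1 : x ∈ formSupport Φ
    · by_cases h2 : x ∈ formSupport Ψ
      · have h3 : ∀ᶠ z in 𝓝 x, Φ z = (∑ i : t, mulForm (f i) Φ) z := by
          filter_upwards [mem_interior_iff_mem_nhds.1 (hKK' ⟨subset_closure hx, h1, h2⟩)] with z hz
          have := f.sum_eq_one hz
          rw [finsum_eq_sum_of_fintype] at this
          rw [Finset.sum_apply]
          simp only [mulForm]
          rw [← Finset.sum_smul, this, one_smul]
        rw [rotS_congr h3, rotS_sum _ hsm, Finset.sum_apply]
        have : ∀ (u : Finset t), formInner N (∑ i ∈ u, rotS (mulForm (f i) Φ) x) (divS o Ψ x) =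
            ∑ i ∈ u, formInner N (rotS (mulForm (f i) Φ) x) (divS o Ψ x) := by
          intro u
          classical
          induction u using Finset.induction_on with
          | empty => exact formInner_zero_left _
          | insert i u hi ih => rw [Finset.sum_insert hi, Finset.sum_insert hi,
              formInner_add_left, ih]
        exact this _
      · simp only [divS_eq_zero_of_notMem_formSupport o h2, formInner_zero_right,
          Finset.sum_const_zero]
    · have h3 : ∀ i : t, rotS (mulForm (f i) Φ) x = 0 := fun i =>
        rotS_eq_zero_of_notMem_formSupport fun h =>
          h1 (formSupport_mulForm_subset_formSupport _ _ h)
      simp only [h3, rotS_eq_zero_of_notMem_formSupport h1, formInner_zero_left,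
        Finset.sum_const_zero]
  rw [l2Inner, setIntegral_congr_fun hSm hpt, integral_finsetSum _ fun i _ =>
    ((hsm i).rotS.isL2 hT.isCompact_closure).integrable_formInner hSm
      ((hΨ.1.divS o).isL2 hT.isCompact_closure)]
  refine Finset.sum_eq_zero fun i _ => ?_
  rw [setIntegral_eq_integral_of_forall_compl_eq_zero fun x hx => by
    rw [rotS_eq_zero_of_notMem_formSupport fun h => hx (hUS i (hsupp i h)), formInner_zero_left]]
  exact integral_formInner_rotS_divS o (chartAt_mem (i : M)) (hsm i) hΨ.1 (hcpt i)
    ((hsupp i).trans (hUe i)) (fun z hz => hs i z (hsupp i hz)) (hs1 i)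

end Stokes

end MixedForms
end

noncomputable section

set_option linter.unusedSectionVars false

namespace MixedForms

/-! ### The boundary value spaces as weak operators. -/

section Operators

variable {N : ℕ} {M : Type*} [TopologicalSpace M] [ChartedSpace (EuclideanSpace ℝ (Fin N)) M]
  [RiemannianBundle (fun x : M => TangentSpace (𝓡 N) x)] [IsManifold (𝓡 N) ∞ M]
  [T2Space M] [SigmaCompactSpace M] [MeasurableSpace M] [BorelSpace M]
  [IsContMDiffRiemannianBundle (𝓡 N) ∞ (EuclideanSpace ℝ (Fin N))
      (fun x : M => TangentSpace (𝓡 N) x)]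

/-- The open set of an admissible triple. -/
def Triple.Admissible.opens {T : Triple M} (hT : T.Admissible) : TopologicalSpace.Opens M :=
  ⟨T.S, hT.isOpen⟩

variable {T : Triple M} (hT : T.Admissible) (o : ManifoldOrientation N M)

/-- The pairs `(div Φ, Φ)` of test forms defining the weak operator `rot`. -/
def rotTests (q : ℕ) : Set (L2Form (N := N) hT.opens q × L2Form (N := N) hT.opens (q + 1)) :=
  {p | ∃ Φ, TestForm T.Γ₂ Φ ∧ p.1.form = divS o Φ ∧ p.2.form = Φ}

/-- The pairs `(rot Φ, Φ)` of test forms defining the weak operator `div`; in degree `0` the pairs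
`(0, b)`, which define the zero operator. -/
def divTests : (q : ℕ) → Set (L2Form (N := N) hT.opens q × L2Form (N := N) hT.opens (q - 1))
  | 0 => {p | p.1 = 0}
  | _ + 1 => {p | ∃ Φ, TestForm T.Γ₁ Φ ∧ p.1.form = rotS Φ ∧ p.2.form = Φ}

variable {hT o} {q : ℕ}

/-- Test forms and their coderivatives are square integrable on `S`, so testing with pairs in L₂
loses nothing. -/
theorem isRot_form_iff {E : L2Form (N := N) hT.opens q} {F : L2Form (N := N) hT.opens (q + 1)} :
    IsRot o T q E.form F.form ↔ WeakRel (rotTests hT o q) E F := by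
  constructor
  · rintro ⟨-, -, h⟩ ⟨a, b⟩ ⟨Φ, hΦ, ha, hb⟩
    have h1 := h Φ hΦ
    rw [← ha, ← hb] at h1
    exact h1
  · refine fun h => ⟨E.isL2, F.isL2, fun Φ hΦ => ?_⟩
    have h1 : IsL2 T.S (divS o Φ) := (hΦ.1.divS o).isL2 hT.isCompact_closure
    have h2 : IsL2 T.S Φ := hΦ.1.isL2 hT.isCompact_closure
    exact h (IsL2.toL2 (S := hT.opens) h1, IsL2.toL2 (S := hT.opens) h2) ⟨Φ, hΦ, rfl, rfl⟩

theorem ae_eq_zero_of_norm_eq_zero (G : L2Form (N := N) hT.opens 0) (h : ‖G‖ = 0) :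
    ∀ᵐ x ∂((vol N M).restrict T.S), G.form x = 0 := by
  have h1 := G.lintegral_eq
  have hm := (Complex.continuous_re.comp_aestronglyMeasurable
    (G.isL2.measurableForm.formInner hT.opens.isOpen.measurableSet
      G.isL2.measurableForm)).aemeasurable.ennreal_ofReal
  rw [h, zero_pow two_ne_zero, ENNReal.ofReal_zero, lintegral_eq_zero_iff' hm] at h1
  filter_upwards [h1] with x hx
  have h2 : formNorm N (G.form x) = 0 := by
    rw [formNorm, Real.sqrt_eq_zero']
    exact ENNReal.ofReal_eq_zero.1 hx
  have h3 := norm_le_mul_formNorm (N := N) (G.form x)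
  rw [h2, mul_zero] at h3
  exact norm_le_zero_iff.1 h3

theorem isDiv_form_iff {E : L2Form (N := N) hT.opens q} {G : L2Form (N := N) hT.opens (q - 1)} :
    IsDiv T q E.form G.form ↔ WeakRel (divTests hT q) E G := by
  cases q with
  | zero =>
    constructor
    · rintro ⟨-, -, h⟩ ⟨a, b⟩ hp
      have ha : a = 0 := hp
      have : l2Inner T.S G.form b.form = 0 := by
        refine integral_eq_zero_of_ae ?_
        filter_upwards [h] with x hx
        rw [show G.form x = 0 from hx, formInner_zero_left, Pi.zero_apply]
      rw [ha, inner_zero_left, eq_comm, neg_eq_zero]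
      exact this
    · refine fun h => ⟨E.isL2, G.isL2, ae_eq_zero_of_norm_eq_zero G ?_⟩
      -- Testing with `G` itself forces its norm to vanish.
      have h1 := h (0, G) rfl
      rw [inner_zero_left, eq_comm, neg_eq_zero, inner_self_eq_norm_sq_to_K] at h1
      exact RCLike.ofReal_eq_zero.1 ((pow_eq_zero_iff two_ne_zero).1 h1)
  | succ q =>
    constructor
    · rintro ⟨-, -, h⟩ ⟨a, b⟩ ⟨Φ, hΦ, ha, hb⟩
      have h1 := h Φ hΦ
      rw [← ha, ← hb] at h1
      exact h1
    · refine fun h => ⟨E.isL2, G.isL2, fun Φ hΦ => ?_⟩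
      have h1 : IsL2 T.S (rotS Φ) := hΦ.1.rotS.isL2 hT.isCompact_closure
      have h2 : IsL2 T.S Φ := hΦ.1.isL2 hT.isCompact_closure
      exact h (IsL2.toL2 (S := hT.opens) h1, IsL2.toL2 (S := hT.opens) h2) ⟨Φ, hΦ, rfl, rfl⟩

theorem isDiv_isL2 {E : Form N M q} {G : Form N M (q - 1)} (h : IsDiv T q E G) :
    IsL2 T.S E ∧ IsL2 T.S G := by
  cases q with
  | zero => exact ⟨h.1, h.2.1⟩
  | succ q => exact ⟨h.1, h.2.1⟩

theorem inner_rotTests_divTests {p : L2Form (N := N) hT.opens q × L2Form (N := N) hT.opens (q + 1)}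
    (hp : p ∈ rotTests hT o q)
    {r : L2Form (N := N) hT.opens q × L2Form (N := N) hT.opens (q - 1)}
    (hr : r ∈ divTests hT q) : ⟪p.1, r.1⟫_ℂ = 0 := by
  cases q with
  | zero =>
    have hr' : r.1 = 0 := hr
    rw [hr', inner_zero_right]
  | succ q =>
    obtain ⟨Ψ, hΨ, h1, -⟩ := hp
    obtain ⟨Φ, hΦ, h2, -⟩ := hr
    rw [L2Form.inner_eq, h1, h2]
    exact l2Inner_rotS_divS_eq_zero o hT hΦ hΨ

theorem CompactEmbedding.compactGraph (h : CompactEmbedding o T q) :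
    CompactGraph (rotTests hT o q) (divTests hT q) := fun E F G C hF hG hC => by
  obtain ⟨φ, E', hφ, hE', hlim⟩ := h (fun n => (E n).form) (fun n => (F n).form)
    (fun n => (G n).form) C (fun n => isRot_form_iff.2 (hF n)) (fun n => isDiv_form_iff.2 (hG n)) hC
  exact ⟨φ, IsL2.toL2 (S := hT.opens) hE', hφ, tendsto_iff_norm_sub_tendsto_zero.2 hlim⟩

end Operators

end MixedForms
end

/-! ### The theorem. -/

theorem mainTheorem3 {N : ℕ} {M : Type*} [TopologicalSpace M] [T2Space M] [SigmaCompactSpace M]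
    [ChartedSpace (EuclideanSpace ℝ (Fin N)) M] [IsManifold (𝓡 N) ∞ M]
    [RiemannianBundle (fun x : M => TangentSpace (𝓡 N) x)]
    [IsContMDiffRiemannianBundle (𝓡 N) ∞ (EuclideanSpace ℝ (Fin N))
      (fun x : M => TangentSpace (𝓡 N) x)]
    [MeasurableSpace M] [BorelSpace M]
    (o : ManifoldOrientation N M) (T : Triple M) (hT : IsDDomain o T)
    (q : ℕ) (hq : CompactEmbedding o T q) :
    (∃ c : ℝ, 0 < c ∧ ∀ Φ ∈ spaceR₀ o T q ∩ spaceD T q,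
      (∀ Ψ ∈ spaceR₀ o T q ∩ spaceD₀ T q, l2Inner T.S Φ Ψ = 0) →
      ∀ G, IsDiv (N := N) T q Φ G → l2Norm T.S Φ ≤ c * l2Norm T.S G) ∧
    (∃ c : ℝ, 0 < c ∧ ∀ Φ ∈ spaceR o T q ∩ spaceD₀ T q,
      (∀ Ψ ∈ spaceR₀ o T q ∩ spaceD₀ T q, l2Inner T.S Φ Ψ = 0) →
      ∀ F, IsRot o T q Φ F → l2Norm T.S Φ ≤ c * l2Norm T.S F) ∧
    L2Closed (N := N) T.S (rotRange o T q) ∧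
    L2Closed (N := N) T.S (divRange T q) := by
  have hA := hT.1
  -- Compactness is symmetric in the two operators, so each abstract lemma serves rot directly and
  -- div with the test families interchanged.
  have hcpt : CompactGraph (rotTests hA o q) (divTests hA q) := hq.compactGraph
  refine ⟨?_, ?_, ?_, ?_⟩
  · obtain ⟨c, hc, h⟩ := hcpt.symm.exists_norm_le
    refine ⟨c, hc, fun Φ hΦ hperp G hG => ?_⟩
    have h1 := hΦ.1.1
    have h2 := (isDiv_isL2 hG).2
    refine h (IsL2.toL2 (S := hA.opens) h1) (IsL2.toL2 (S := hA.opens) h2) (isDiv_form_iff.1 hG)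
      (isRot_form_iff.1 hΦ.1) fun z hz hz' => ?_
    exact hperp z.form ⟨isRot_form_iff.2 hz', isDiv_form_iff.2 hz⟩
  · obtain ⟨c, hc, h⟩ := hcpt.exists_norm_le
    refine ⟨c, hc, fun Φ hΦ hperp F hF => ?_⟩
    refine h (IsL2.toL2 (S := hA.opens) hF.1) (IsL2.toL2 (S := hA.opens) hF.2.1)
      (isRot_form_iff.1 hF) (isDiv_form_iff.1 hΦ.2) fun z hz hz' => ?_
    exact hperp z.form ⟨isRot_form_iff.2 hz, isDiv_form_iff.2 hz'⟩
  · intro u F hu hF hlim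
    choose E hE using hu
    obtain ⟨E', hE'⟩ := hcpt.exists_weakRel_of_tendsto
      (fun p hp r hr => inner_rotTests_divTests hp hr)
      (u := fun n => IsL2.toL2 (S := hA.opens) (hE n).2.1) (F := IsL2.toL2 (S := hA.opens) hF)
      (fun n => ⟨IsL2.toL2 (S := hA.opens) (hE n).1, isRot_form_iff.1 (hE n)⟩)
      (tendsto_iff_norm_sub_tendsto_zero.2 hlim)
    exact ⟨E'.form, isRot_form_iff.2 hE'⟩
  · intro u F hu hF hlim
    choose E hE using hu
    obtain ⟨E', hE'⟩ := hcpt.symm.exists_weakRel_of_tendsto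
      (fun p hp r hr => by
        rw [← inner_conj_symm, inner_rotTests_divTests hr hp, map_zero])
      (u := fun n => IsL2.toL2 (S := hA.opens) (isDiv_isL2 (hE n)).2)
      (F := IsL2.toL2 (S := hA.opens) hF)
      (fun n => ⟨IsL2.toL2 (S := hA.opens) (isDiv_isL2 (hE n)).1, isDiv_form_iff.1 (hE n)⟩)
      (tendsto_iff_norm_sub_tendsto_zero.2 hlim)
    exact ⟨E'.form, isDiv_form_iff.2 hE'⟩
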